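/- **Theorem (finite-size corrections for the mean-field monomer-dimer model).** Let $a>0$, $b\in\mathbb R$. For $N\ge 1$ let $\mathscr D_N$ be the set of monomer-dimer configurations on the complete graph with vertex set $\{1,\dots,N\}$, i.e. of sets $D$ of pairwise disjoint pairs of vertices; let $m_N(D)=\frac{N-2|D|}{N}$ be the monomer density, and set $$H_N(D)=-N\Big(\frac a2\,m_N(D)^2+b\,m_N(D)\Big),\qquad Z_N=\sum_{D\in\mathscr D_N}N^{-|D|}e^{-H_N(D)},\qquad \langle f\rangle_N=\frac1{Z_N}\sum_{D\in\mathscr D_N}f(D)\,N^{-|D|}e^{-H_N(D)} .$$ Put $$F(x,y)=-\frac{x^2}2-a\frac{y^2}2+\log\!\big(x+e^{ay+b}\big),\qquad g(x,y)=\frac{\partial F}{\partial b}(x,y)=\frac{e^{ay+b}}{x+e^{ay+b}} .$$ A *phase* is a solution $y\in(0,1)$ of the consistency equation $e^{ay+b}=\frac{y}{\sqrt{1-y}}$ at which $F(\sqrt{1-y},y)$ is maximal among all solutions in $(0,1)$. Assume that the system has at most one phase and that $(a,b)$ is not the critical point $(a_c,b_c)$, where $a_c=\frac{3+2\sqrt2}{2}$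 and $b_c=\frac12\log(2\sqrt2-2)-\frac{2+\sqrt2}{2}$. Then there is a (unique) phase $m_*$, and as $N\to\infty$ $$p_N:=\frac1N\log Z_N=p_*+\frac{\Lambda}{N}+O\!\Big(\frac1{N^2}\Big),\qquad \mu_N:=\langle m_N\rangle_N=m_*+\frac{\Lambda'}{N}+O\!\Big(\frac1{N^2}\Big),$$ $$\chi_N:=N\big(\langle m_N^2\rangle_N-\langle m_N\rangle_N^2\big)=\chi_*+\frac{\Lambda''}{N}+O\!\Big(\frac1{N^2}\Big),$$ where the constants depend only on $a,b$ and are $$p_*=F(\sqrt{1-m_*},m_*),\qquad \Lambda=-\log\sqrt{\frac Da},\qquad \Lambda'=\mathcal K_g,\qquad \chi_*=m_*(1-m_*)+\mathcal K^{(1)}_{(g-m_*)^2},$$ $$\Lambda''=\mathcal K_{g(1-g)}-\mathcal K^{(1)}_{(g-m_*)^2}\,\mathcal L+\mathcal M_{(g-m_*)^2}-(\mathcal K_g)^2 .$$ Here, for a function $G$ smooth near $(x_*,y_*)=(\sqrt{1-m_*},m_*)$, $G_{i,j}=\frac{\partial^{i+j}G}{\partial x^i\partial y^j}(x_*,y_*)$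 and $\hat G_{i,j}=\frac{G_{i,j}}{i!\,j!}$; $D=\det(-\mathrm{Hess}\,F(x_*,y_*))$; $C=(-\mathrm{Hess}\,F(x_*,y_*))^{-1}$; and $$\gamma_{i,j}=\frac{\sqrt D}{2\pi}\iint_{\mathbb R^2}x^iy^j\exp\!\Big(-\tfrac12(x,y)\,C^{-1}(x,y)^T\Big)\,dx\,dy$$ is the moment $\mathbb E[X^iY^j]$ of the centred Gaussian vector with covariance matrix $C$. The coefficients are $$\mathcal L=\sum_{i+j=4}\hat F_{i,j}\,\gamma_{i,j}+\frac12\sum_{\substack{i_1+j_1=3\\ i_2+j_2=3}}\hat F_{i_1,j_1}\hat F_{i_2,j_2}\,\gamma_{i_1+i_2,\,j_1+j_2},$$ $$\mathcal K^{(1)}_G=\sum_{i+j=2}\hat G_{i,j}\,\gamma_{i,j},\qquad \mathcal K_G=\mathcal K^{(1)}_G+\sum_{\substack{i_1+j_1=3\\ i_2+j_2=1}}\hat F_{i_1,j_1}\hat G_{i_2,j_2}\,\gamma_{i_1+i_2,\,j_1+j_2},$$ $$\mathcal M_G=\sum_{i+j=4}\hat G_{i,j}\,\gamma_{i,j}+\sum_{\substack{i_1+j_1=3\\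 i_2+j_2=3}}\hat F_{i_1,j_1}\hat G_{i_2,j_2}\,\gamma_{i_1+i_2,\,j_1+j_2}+\sum_{\substack{i_1+j_1=4\\ i_2+j_2=2}}\hat F_{i_1,j_1}\hat G_{i_2,j_2}\,\gamma_{i_1+i_2,\,j_1+j_2}+\frac12\sum_{\substack{i_1+j_1=3\\ i_2+j_2=3\\ i_3+j_3=2}}\hat F_{i_1,j_1}\hat F_{i_2,j_2}\hat G_{i_3,j_3}\,\gamma_{i_1+i_2+i_3,\,j_1+j_2+j_3}.$$ -/

import Mathlib

noncomputable section

namespace MonomerDimer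

open Finset

/-! ### The finite system -/

/-- Monomer-dimer configurations on the complete graph with vertex set `Fin N`: sets of pairwise
disjoint pairs of vertices (the dimers). -/
def configurations (N : ℕ) : Finset (Finset (Finset (Fin N))) :=
  univ.filter fun D =>
    (∀ e ∈ D, e.card = 2) ∧ ∀ e ∈ D, ∀ f ∈ D, e ≠ f → Disjoint e f

/-- The monomers of a configuration: the vertices covered by no dimer. -/
def monomers {N : ℕ} (D : Finset (Finset (Fin N))) : Finset (Fin N) :=
  univ \ D.biUnion id

/-- The monomer density `m_N(D)`. -/
def monomerDensity {N : ℕ} (D : Finset (Finset (Fin N))) : ℝ :=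
  ((monomers D).card : ℝ) / N

/-- The Hamiltonian `H_N(D) = -N (a/2 m_N(D)^2 + b m_N(D))`. -/
def hamiltonian (a b : ℝ) {N : ℕ} (D : Finset (Finset (Fin N))) : ℝ :=
  -(N : ℝ) * (a / 2 * monomerDensity D ^ 2 + b * monomerDensity D)

/-- The unnormalised Gibbs weight `N^{-|D|} exp(-H_N(D))`. -/
def weight (a b : ℝ) {N : ℕ} (D : Finset (Finset (Fin N))) : ℝ :=
  ((N : ℝ) ^ D.card)⁻¹ * Real.exp (-hamiltonian a b D)

/-- The partition function `Z_N`. -/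
def partitionFunction (a b : ℝ) (N : ℕ) : ℝ :=
  ∑ D ∈ configurations N, weight a b D

/-- The expectation of the observable `f` under the Gibbs measure. -/
def gibbsExpectation (a b : ℝ) (N : ℕ) (f : Finset (Finset (Fin N)) → ℝ) : ℝ :=
  1 / partitionFunction a b N * ∑ D ∈ configurations N, f D * weight a b D

/-- The pressure density `p_N`. -/
def pressureDensity (a b : ℝ) (N : ℕ) : ℝ :=
  1 / (N : ℝ) * Real.log (partitionFunction a b N)

/-- The average monomer density `μ_N`. -/
def averageMonomerDensity (a b : ℝ) (N : ℕ) : ℝ :=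
  gibbsExpectation a b N fun D => monomerDensity D

/-- The susceptibility `χ_N`. -/
def susceptibility (a b : ℝ) (N : ℕ) : ℝ :=
  N * (gibbsExpectation a b N (fun D => monomerDensity D ^ 2)
    - gibbsExpectation a b N (fun D => monomerDensity D) ^ 2)

/-! ### The limiting monomer density -/

/-- `F(x, y) = -x²/2 - a y²/2 + log (x + e^{ay+b})`. -/
def F (a b x y : ℝ) : ℝ :=
  -x ^ 2 / 2 - a * y ^ 2 / 2 + Real.log (x + Real.exp (a * y + b))

/-- `g(x, y) = ∂F/∂b = e^{ay+b} / (x + e^{ay+b})`. -/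
def g (a b x y : ℝ) : ℝ :=
  Real.exp (a * y + b) / (x + Real.exp (a * y + b))

/-- `y ∈ (0, 1)` solves the consistency equation `e^{ay+b} = y / √(1-y)`. -/
def IsConsistent (a b y : ℝ) : Prop :=
  0 < y ∧ y < 1 ∧ Real.exp (a * y + b) = y / √(1 - y)

/-- `m` is a phase of the system: a solution of the consistency equation that maximizes
`F(√(1-y), y)` among all solutions `y`. -/
def IsPhase (a b m : ℝ) : Prop :=
  IsConsistent a b m ∧ ∀ y, IsConsistent a b y → F a b (√(1 - y)) y ≤ F a b (√(1 - m)) m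

/-- The critical value `a_c = (3 + 2√2)/2`. -/
def aCrit : ℝ := (3 + 2 * √2) / 2

/-- The value `b_c` of `b` for which `y = 2 - √2` solves the consistency equation with `a = a_c`:
`b_c = log(2√2 - 2)/2 - (2 + √2)/2`. -/
def bCrit : ℝ := Real.log (2 * √2 - 2) / 2 - (2 + √2) / 2

/-! ### The Laplace coefficients

All of them are computed at the point `(x_*, y_*) = (√(1-m), m)`. -/

/-- The mixed partial derivative `∂^{i+j} G / ∂x^i ∂y^j` at `(x, y)`. -/
def partialDeriv (i j : ℕ) (G : ℝ → ℝ → ℝ) (x y : ℝ) : ℝ :=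
  iteratedDeriv i (fun s => iteratedDeriv j (fun t => G s t) y) x

/-- `G_{i,j}`: the mixed partial derivative at `(√(1-m), m)`. -/
def derivAt (m : ℝ) (G : ℝ → ℝ → ℝ) (i j : ℕ) : ℝ :=
  partialDeriv i j G (√(1 - m)) m

/-- The Taylor coefficient `G_{i,j} / (i! j!)`, for `p = (i, j)`. -/
def taylorCoeff (m : ℝ) (G : ℝ → ℝ → ℝ) (p : ℕ × ℕ) : ℝ :=
  derivAt m G p.1 p.2 / ((p.1.factorial : ℝ) * p.2.factorial)

/-- The Hessian matrix of `F` at `(√(1-m), m)`. -/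
def hessF (a b m : ℝ) : Matrix (Fin 2) (Fin 2) ℝ :=
  !![derivAt m (F a b) 2 0, derivAt m (F a b) 1 1;
     derivAt m (F a b) 1 1, derivAt m (F a b) 0 2]

/-- `D = det (-Hess F)`. -/
def detD (a b m : ℝ) : ℝ := (-hessF a b m).det

/-- The covariance matrix `C = (-Hess F)⁻¹`. -/
def covC (a b m : ℝ) : Matrix (Fin 2) (Fin 2) ℝ := (-hessF a b m)⁻¹

/-- The moment `E[X^i Y^j]`, `p = (i, j)`, of a centred Gaussian vector `(X, Y)` with covariance
matrix `C`, whose density is `√D / (2π) exp(-½ (x,y) C⁻¹ (x,y)ᵀ)`. -/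
def gaussMoment (a b m : ℝ) (p : ℕ × ℕ) : ℝ :=
  √(detD a b m) / (2 * Real.pi) *
    ∫ z : ℝ × ℝ, z.1 ^ p.1 * z.2 ^ p.2 *
      Real.exp (-(1 / 2) * (![z.1, z.2] ⬝ᵥ ((covC a b m)⁻¹.mulVec ![z.1, z.2])))

/-- The coefficient `L` of `1/N` in the normalized Laplace integral of `1`. -/
def coeffL (a b m : ℝ) : ℝ :=
  (∑ p ∈ antidiagonal 4, taylorCoeff m (F a b) p * gaussMoment a b m p)
  + 1 / 2 * ∑ p ∈ antidiagonal 3, ∑ q ∈ antidiagonal 3,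
      taylorCoeff m (F a b) p * taylorCoeff m (F a b) q * gaussMoment a b m (p + q)

/-- `K⁽¹⁾_G`. -/
def coeffK1 (a b m : ℝ) (G : ℝ → ℝ → ℝ) : ℝ :=
  ∑ p ∈ antidiagonal 2, taylorCoeff m G p * gaussMoment a b m p

/-- `K⁽²⁾_G`. -/
def coeffK2 (a b m : ℝ) (G : ℝ → ℝ → ℝ) : ℝ :=
  ∑ p ∈ antidiagonal 3, ∑ q ∈ antidiagonal 1,
    taylorCoeff m (F a b) p * taylorCoeff m G q * gaussMoment a b m (p + q)

/-- `K_G = K⁽¹⁾_G + K⁽²⁾_G`. -/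
def coeffK (a b m : ℝ) (G : ℝ → ℝ → ℝ) : ℝ :=
  coeffK1 a b m G + coeffK2 a b m G

/-- `M_G`, the sum of the four contributions of order `N⁻²`. -/
def coeffM (a b m : ℝ) (G : ℝ → ℝ → ℝ) : ℝ :=
  (∑ p ∈ antidiagonal 4, taylorCoeff m G p * gaussMoment a b m p)
  + (∑ p ∈ antidiagonal 3, ∑ q ∈ antidiagonal 3,
      taylorCoeff m (F a b) p * taylorCoeff m G q * gaussMoment a b m (p + q))
  + (∑ p ∈ antidiagonal 4, ∑ q ∈ antidiagonal 2,
      taylorCoeff m (F a b) p * taylorCoeff m G q * gaussMoment a b m (p + q))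
  + 1 / 2 * ∑ p ∈ antidiagonal 3, ∑ q ∈ antidiagonal 3, ∑ r ∈ antidiagonal 2,
      taylorCoeff m (F a b) p * taylorCoeff m (F a b) q * taylorCoeff m G r
        * gaussMoment a b m (p + q + r)

/-! ### The constants of the expansions -/

/-- `p_* = F(√(1-m), m)`. -/
def pStar (a b m : ℝ) : ℝ := F a b (√(1 - m)) m

/-- `Λ = -log √(D/a)`. -/
def Lam (a b m : ℝ) : ℝ := -Real.log (√(detD a b m / a))

/-- `Λ' = K_g`. -/
def Lam' (a b m : ℝ) : ℝ := coeffK a b m (g a b)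

/-- `(g - m)²`. -/
def gSq (a b m : ℝ) : ℝ → ℝ → ℝ := fun x y => (g a b x y - m) ^ 2

/-- `χ_* = m (1 - m) + K⁽¹⁾_{(g-m)²}`. -/
def chiStar (a b m : ℝ) : ℝ := m * (1 - m) + coeffK1 a b m (gSq a b m)

/-- `Λ'' = K_{g(1-g)} - K⁽¹⁾_{(g-m)²} L + M_{(g-m)²} - (K_g)²`. -/
def Lam'' (a b m : ℝ) : ℝ :=
  coeffK a b m (fun x y => g a b x y * (1 - g a b x y))
    - coeffK1 a b m (gSq a b m) * coeffL a b m
    + coeffM a b m (gSq a b m)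
    - coeffK a b m (g a b) ^ 2

end MonomerDimer

end

/-!
# Finite-size corrections for the mean-field monomer-dimer model

Two Gaussian linearisations turn the partition function into a planar integral. Summing over
matchings gives the matching polynomial of the complete graph, whose three-term recursion is also
satisfied by the Gaussian moments `∫ (x + h) ^ n exp (-N x ^ 2 / 2) dx`
(`integral_add_pow_mul_exp_neg_mul_sq`); the quadratic term of the Hamiltonian is linearised by a
second Gaussian variable `y` (`integral_sum_configurations`). Hence `Z_N` is, up to an explicit
constant, `∬ exp (N F)`, continued to a signed integrand where `x + e ^ (a y + b) ≤ 0`, and the first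
two moments of the monomer density are averages of `g` and `g ^ 2` under the same weight. To avoid
the poles of `g` the integrand is written as `W ^ n P` with `N = n + 2`, where `W` continues `exp F`
and `P` continues `exp (2 F) g ^ k` with `k ≤ 2`.

The weight `|W|` is continuous and vanishes at infinity, so it attains its maximum; a maximum is a
critical point of `F` with `x > 0`, and the critical point equations say that it is
`(√(1 - m), m)` with `m` consistent. So phases exist, they are exactly the maxima of `|W|`, and a
unique phase leaves a gap outside every neighbourhood (`IsPhase.exists_gap`). Along the curve
`(√(1 - y), y)` the sign of the derivative of `F` is opposite to that of
`H y = log (y / √(1 - y)) - a y - b`, and `det (-Hess F)` is a positive multiple of `H' m`. If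
`H' m ≤ 0` then, except at the critical point, `F` would increase along the curve on one side of `m`;
this gives nondegeneracy (`IsPhase.nondegenerate`).

What remains is Laplace's method to second order (`LaplaceData.isBigO`). After the rescaling
`z = z_* + s v`, `s = 1 / √N`, the integrand is a Gaussian times an expression with an expansion in
`s` up to `s ^ 4`, uniformly in `v` up to Gaussian domination (`LaplaceData.exists_hasExpansion`). The
coefficients of odd order are odd in `v` and integrate to zero. An amplitude vanishing to second order,
such as `(g - m) ^ 2`, gains a factor `s ^ 2`, which yields the extra order required for the
susceptibility. The coefficients of even order are polynomials in the Taylor parts of `F` and of the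
amplitude, so their Gaussian integrals are the constants `L`, `K` and `M`
(`gaussMean_laplaceCoeff_two`, `gaussMean_laplaceCoeff_quadratic_two`), and the theorem follows by
dividing expansions.
-/

noncomputable section

namespace MonomerDimer

open Finset MeasureTheory Filter Topology Asymptotics

/-! ### Matchings and the recursion for their generating polynomial -/

/-- The matchings of the complete graph on `S`: the sets of pairwise disjoint two-element subsets
of `S`. -/
def matchings {α : Type*} [DecidableEq α] (S : Finset α) : Finset (Finset (Finset α)) :=
  (S.powersetCard 2).powerset.filter fun D => ∀ e ∈ D, ∀ f ∈ D, e ≠ f → Disjoint e f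

section Matchings

variable {α : Type*} [DecidableEq α]

theorem mem_matchings {S : Finset α} {D : Finset (Finset α)} :
    D ∈ matchings S ↔ (∀ e ∈ D, e ⊆ S ∧ e.card = 2) ∧
      ∀ e ∈ D, ∀ f ∈ D, e ≠ f → Disjoint e f := by
  simp only [matchings, mem_filter, mem_powerset, subset_iff, mem_powersetCard]

theorem insert_pair_mem_matchings {S : Finset α} {v w : α} (hv : v ∉ S) (hw : w ∈ S)
    {D : Finset (Finset α)} (hD : D ∈ matchings (S.erase w)) :
    insert {v, w} D ∈ matchings (insert v S) := by
  rw [mem_matchings] at hD ⊢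
  have hvw : v ≠ w := fun h => hv (h ▸ hw)
  have hdisj : ∀ e ∈ D, Disjoint ({v, w} : Finset α) e := by
    intro e he
    rw [Finset.disjoint_left]
    intro x hx hxe
    have := (hD.1 e he).1 hxe
    simp only [mem_insert, mem_singleton] at hx
    rcases hx with rfl | rfl
    · exact hv (mem_of_mem_erase this)
    · simp at this
  refine ⟨?_, ?_⟩
  · intro e he
    rcases mem_insert.1 he with rfl | he
    · refine ⟨?_, card_pair hvw⟩
      intro x hx
      simp only [mem_insert, mem_singleton] at hx ⊢
      rcases hx with rfl | rfl
      · exact Or.inl rfl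
      · exact Or.inr hw
    · exact ⟨((hD.1 e he).1.trans (erase_subset _ _)).trans (subset_insert _ _), (hD.1 e he).2⟩
  · intro e he f hf hef
    rcases mem_insert.1 he with rfl | he <;> rcases mem_insert.1 hf with rfl | hf
    · exact absurd rfl hef
    · exact hdisj f hf
    · exact (hdisj e he).symm
    · exact hD.2 e he f hf hef

theorem pair_notMem_of_mem_matchings_erase {S : Finset α} {v w : α} (hv : v ∉ S)
    {D : Finset (Finset α)} (hD : D ∈ matchings (S.erase w)) (u : α) :
    ({v, u} : Finset α) ∉ D := fun h =>
  hv (mem_of_mem_erase (((mem_matchings.1 hD).1 _ h).1 (mem_insert_self v _)))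

/-- A matching of `S ∪ {v}` either leaves `v` uncovered, and is a matching of `S`, or contains a
unique pair `{v, w}`, whose removal leaves a matching of `S \ {w}`. -/
theorem matchings_insert {S : Finset α} {v : α} (hv : v ∉ S) :
    matchings (insert v S) = matchings S ∪
      S.biUnion fun w => (matchings (S.erase w)).image (insert {v, w}) := by
  ext D
  simp only [mem_union, mem_biUnion, mem_image]
  constructor
  · intro hD
    have hD' := mem_matchings.1 hD
    by_cases h : ∃ e ∈ D, v ∈ e
    · right
      obtain ⟨e, he, hve⟩ := h
      obtain ⟨w, hw⟩ : ∃ w, e.erase v = {w} := by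
        rw [← card_eq_one, card_erase_of_mem hve, (hD'.1 e he).2]
      have hwe : w ∈ e.erase v := by rw [hw]; exact mem_singleton_self w
      have hev : e = {v, w} := by rw [← insert_erase hve, hw]
      have hwS : w ∈ S := by
        have := (hD'.1 e he).1 (mem_of_mem_erase hwe)
        exact (mem_insert.1 this).resolve_left (ne_of_mem_erase hwe)
      refine ⟨w, hwS, D.erase e, ?_, ?_⟩
      · rw [mem_matchings]
        refine ⟨fun f hf => ⟨?_, (hD'.1 f (mem_of_mem_erase hf)).2⟩, fun f hf f' hf' =>
          hD'.2 f (mem_of_mem_erase hf) f' (mem_of_mem_erase hf')⟩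
        have hd := hD'.2 f (mem_of_mem_erase hf) e he (ne_of_mem_erase hf)
        intro x hx
        have hxe : x ∉ e := Finset.disjoint_left.1 hd hx
        have hxS := (hD'.1 f (mem_of_mem_erase hf)).1 hx
        rw [mem_erase]
        refine ⟨fun h => hxe (h ▸ mem_of_mem_erase hwe), (mem_insert.1 hxS).resolve_left ?_⟩
        exact fun h => hxe (h ▸ hve)
      · rw [← hev, insert_erase he]
    · left
      push Not at h
      rw [mem_matchings]
      refine ⟨fun e he => ⟨fun x hx => ?_, (hD'.1 e he).2⟩, hD'.2⟩
      refine (mem_insert.1 ((hD'.1 e he).1 hx)).resolve_left ?_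
      rintro rfl
      exact h e he hx
  · rintro (hD | ⟨w, hw, D', hD', rfl⟩)
    · rw [mem_matchings] at hD ⊢
      exact ⟨fun e he => ⟨(hD.1 e he).1.trans (subset_insert _ _), (hD.1 e he).2⟩, hD.2⟩
    · exact insert_pair_mem_matchings hv hw hD'

theorem sum_matchings_insert {S : Finset α} {v : α} (hv : v ∉ S)
    (φ : Finset (Finset α) → ℝ) :
    ∑ D ∈ matchings (insert v S), φ D = ∑ D ∈ matchings S, φ D +
      ∑ w ∈ S, ∑ D ∈ matchings (S.erase w), φ (insert {v, w} D) := by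
  rw [matchings_insert hv, sum_union, sum_biUnion]
  · congr 1
    refine sum_congr rfl fun w _ => ?_
    rw [sum_image]
    intro D hD D' hD' h
    have h1 := pair_notMem_of_mem_matchings_erase hv hD w
    have h2 := pair_notMem_of_mem_matchings_erase hv hD' w
    rw [← erase_insert h1, ← erase_insert h2, h]
  · intro w hw w' hw' hne
    rw [Function.onFun, Finset.disjoint_left]
    rintro D hD hD'
    obtain ⟨D₁, h₁, rfl⟩ := mem_image.1 hD
    obtain ⟨D₂, h₂, h⟩ := mem_image.1 hD'
    have : ({v, w} : Finset α) ∈ insert {v, w'} D₂ := by rw [h]; exact mem_insert_self _ _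
    rcases mem_insert.1 this with h' | h'
    · have hw1 : w ∈ ({v, w'} : Finset α) := by rw [← h']; simp
      simp only [mem_insert, mem_singleton] at hw1
      rcases hw1 with rfl | h3
      · exact hv hw
      · exact hne h3
    · exact pair_notMem_of_mem_matchings_erase hv h₂ w h'
  · rw [Finset.disjoint_left]
    intro D hD hD'
    obtain ⟨w, _, hD'⟩ := mem_biUnion.1 hD'
    obtain ⟨D₁, _, rfl⟩ := mem_image.1 hD'
    exact hv (((mem_matchings.1 hD).1 _ (mem_insert_self _ _)).1 (mem_insert_self v _))

/-- The matching polynomial of the complete graph on `n` vertices, with weight `t` for every dimer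
and `h` for every monomer, given by its three-term recursion. -/
def matchingPoly (t : ℝ) : ℕ → ℝ → ℝ
  | 0, _ => 1
  | 1, h => h
  | n + 2, h => h * matchingPoly t (n + 1) h + t * (n + 1) * matchingPoly t n h

theorem sum_matchings_eq_matchingPoly (t h : ℝ) (n : ℕ) (S : Finset α) (hS : S.card = n) :
    ∑ D ∈ matchings S, t ^ D.card * h ^ (S \ D.biUnion id).card = matchingPoly t n h := by
  induction n using Nat.strong_induction_on generalizing S with
  | _ n ih =>
    rcases n with _ | n
    · obtain rfl := card_eq_zero.1 hS
      have : matchings (∅ : Finset α) = {∅} := by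
        ext D
        rw [mem_matchings, mem_singleton]
        constructor
        · rintro ⟨h1, -⟩
          refine eq_empty_of_forall_notMem fun e he => ?_
          have := h1 e he
          rw [subset_empty] at this
          simp [this.1] at this
        · rintro rfl
          simp
      simp [this, matchingPoly]
    obtain ⟨v, S', hv, rfl, hS'⟩ := card_eq_succ.1 hS
    rw [sum_matchings_insert hv]
    have h1 : ∑ D ∈ matchings S', t ^ D.card * h ^ (insert v S' \ D.biUnion id).card
        = h * matchingPoly t n h := by
      rw [← ih n (Nat.lt_succ_self n) S' hS', mul_sum]
      refine sum_congr rfl fun D hD => ?_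
      have hvD : v ∉ D.biUnion id := by
        rw [mem_biUnion]
        rintro ⟨e, he, hve⟩
        exact hv (((mem_matchings.1 hD).1 e he).1 hve)
      rw [insert_sdiff_of_notMem _ hvD, card_insert_of_notMem (fun h => hv (mem_sdiff.1 h).1),
        pow_succ]
      ring
    rw [h1]
    rcases n with _ | n
    · obtain rfl := card_eq_zero.1 hS'
      simp [matchingPoly]
    have h2 : ∀ w ∈ S', ∑ D ∈ matchings (S'.erase w), t ^ (insert {v, w} D).card *
        h ^ (insert v S' \ (insert {v, w} D).biUnion id).card = t * matchingPoly t n h := by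
      intro w hw
      rw [← ih n (by lia) (S'.erase w) (by rw [card_erase_of_mem hw, hS']; rfl), mul_sum]
      refine sum_congr rfl fun D hD => ?_
      rw [card_insert_of_notMem (pair_notMem_of_mem_matchings_erase hv hD w)]
      have : insert v S' \ (insert {v, w} D).biUnion id = S'.erase w \ D.biUnion id := by
        rw [biUnion_insert]
        ext x
        simp only [Finset.mem_sdiff, Finset.mem_insert, Finset.mem_union, id, Finset.mem_singleton,
          Finset.mem_erase]
        constructor
        · tauto
        · rintro ⟨⟨hxw, hxS⟩, hx⟩
          have : x ≠ v := fun h => hv (h ▸ hxS)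
          tauto
      rw [this, pow_succ]
      ring
    rw [sum_congr rfl h2, sum_const, hS', nsmul_eq_mul, matchingPoly]
    push_cast
    ring

end Matchings

theorem configurations_eq_matchings (N : ℕ) : configurations N = matchings univ := by
  ext D
  simp only [configurations, mem_filter, mem_univ, true_and, mem_matchings, subset_univ]

theorem sum_configurations_eq_matchingPoly (t h : ℝ) (N : ℕ) :
    ∑ D ∈ configurations N, t ^ D.card * h ^ (monomers D).card = matchingPoly t N h := by
  rw [configurations_eq_matchings]
  exact sum_matchings_eq_matchingPoly t h N univ (by simp)

/-- The matching polynomials form an Appell sequence: deleting a monomer from a marked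
configuration gives `p_{n+1}' = (n+1) p_n`. -/
theorem hasDerivAt_matchingPoly (t h : ℝ) (n : ℕ) :
    HasDerivAt (matchingPoly t (n + 1)) ((n + 1) * matchingPoly t n h) h := by
  induction n using Nat.strong_induction_on with
  | _ n ih =>
    rcases n with _ | _ | n
    · simpa [matchingPoly] using hasDerivAt_id' h
    · have : HasDerivAt (fun x : ℝ => x * x + t * ((0 : ℕ) + 1) * 1) (1 * h + h * 1) h :=
        ((hasDerivAt_id h).mul (hasDerivAt_id h)).add_const _
      refine (this.congr_deriv ?_)
      simp [matchingPoly]; ring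
    · have h1 := ih (n + 1) (by lia)
      have h0 := ih n (by lia)
      have := ((hasDerivAt_id h).mul h1).add (h0.const_mul (t * ((n + 1 : ℕ) + 1)))
      refine this.congr_deriv ?_
      simp only [matchingPoly, id]
      push_cast
      ring

theorem sum_configurations_monomers (t h : ℝ) (n : ℕ) :
    ∑ D ∈ configurations (n + 1), t ^ D.card * ((monomers D).card * h ^ (monomers D).card)
      = h * ((n + 1) * matchingPoly t n h) := by
  have h1 : HasDerivAt (fun x => ∑ D ∈ configurations (n + 1),
      t ^ D.card * x ^ (monomers D).card) (∑ D ∈ configurations (n + 1),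
      t ^ D.card * ((monomers D).card * h ^ ((monomers D).card - 1))) h :=
    HasDerivAt.fun_sum fun D _ => (hasDerivAt_pow _ h).const_mul _
  have h2 : (fun x => ∑ D ∈ configurations (n + 1),
      t ^ D.card * x ^ (monomers D).card) = matchingPoly t (n + 1) :=
    funext fun x => sum_configurations_eq_matchingPoly t x (n + 1)
  rw [h2] at h1
  rw [← h1.unique (hasDerivAt_matchingPoly t h n), mul_sum]
  refine sum_congr rfl fun D _ => ?_
  rcases (monomers D).card with _ | k
  · simp
  · rw [Nat.add_sub_cancel, pow_succ]; ring

theorem sum_configurations_monomers_sq (t h : ℝ) (n : ℕ) :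
    ∑ D ∈ configurations (n + 2), t ^ D.card * ((monomers D).card ^ 2 * h ^ (monomers D).card)
      = h * ((n + 2) * matchingPoly t (n + 1) h)
        + h ^ 2 * ((n + 2) * ((n + 1) * matchingPoly t n h)) := by
  have h1 : HasDerivAt (fun x => ∑ D ∈ configurations (n + 2),
      t ^ D.card * ((monomers D).card * x ^ (monomers D).card)) (∑ D ∈ configurations (n + 2),
      t ^ D.card * ((monomers D).card * ((monomers D).card * h ^ ((monomers D).card - 1)))) h :=
    HasDerivAt.fun_sum fun D _ => ((hasDerivAt_pow _ h).const_mul _).const_mul _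
  have h2 : (fun x => ∑ D ∈ configurations (n + 2),
      t ^ D.card * ((monomers D).card * x ^ (monomers D).card))
      = fun x => x * (((n + 1 : ℕ) + 1) * matchingPoly t (n + 1) x) :=
    funext fun x => sum_configurations_monomers t x (n + 1)
  rw [h2] at h1
  have h3 := (hasDerivAt_id h).mul ((hasDerivAt_matchingPoly t h n).const_mul ((n + 1 : ℕ) + 1 : ℝ))
  have h4 := h1.unique h3
  have h5 : ∑ D ∈ configurations (n + 2),
      t ^ D.card * ((monomers D).card ^ 2 * h ^ (monomers D).card) =
      h * ∑ D ∈ configurations (n + 2),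
      t ^ D.card * ((monomers D).card * ((monomers D).card * h ^ ((monomers D).card - 1))) := by
    rw [mul_sum]
    refine sum_congr rfl fun D _ => ?_
    rcases (monomers D).card with _ | k
    · simp
    · rw [Nat.add_sub_cancel, pow_succ]; ring
  rw [h5, h4]
  simp only [id]
  push_cast
  ring

/-! ### Gaussian integrals -/

theorem integrable_pow_mul_exp_neg_mul_sq (i : ℕ) {c : ℝ} (hc : 0 < c) :
    Integrable fun x : ℝ => x ^ i * Real.exp (-c * x ^ 2) := by
  have := integrable_rpow_mul_exp_neg_mul_sq hc (s := (i : ℝ))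
    (lt_of_lt_of_le (by norm_num) (Nat.cast_nonneg i))
  simpa only [Real.rpow_natCast] using this

theorem exp_mul_mul_exp_neg_mul_sq (d y : ℝ) {c : ℝ} (hc : 0 < c) :
    Real.exp (d * y) * Real.exp (-c * y ^ 2)
      = Real.exp (d ^ 2 / (4 * c)) * Real.exp (-c * (y - d / (2 * c)) ^ 2) := by
  rw [← Real.exp_add, ← Real.exp_add]
  congr 1
  field_simp
  ring

theorem integrable_exp_mul_mul_exp_neg_mul_sq (d : ℝ) {c : ℝ} (hc : 0 < c) :
    Integrable fun y : ℝ => Real.exp (d * y) * Real.exp (-c * y ^ 2) := by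
  simp only [exp_mul_mul_exp_neg_mul_sq d _ hc]
  exact ((integrable_exp_neg_mul_sq hc).comp_sub_right (d / (2 * c))).const_mul _

theorem integral_exp_mul_mul_exp_neg_mul_sq (d : ℝ) {c : ℝ} (hc : 0 < c) :
    ∫ y : ℝ, Real.exp (d * y) * Real.exp (-c * y ^ 2)
      = Real.exp (d ^ 2 / (4 * c)) * √(Real.pi / c) := by
  simp only [exp_mul_mul_exp_neg_mul_sq d _ hc]
  rw [integral_const_mul, integral_sub_right_eq_self (fun y => Real.exp (-c * y ^ 2)),
    integral_gaussian]

theorem integrable_add_pow_mul_exp_neg_mul_sq (h : ℝ) (n : ℕ) {c : ℝ} (hc : 0 < c) :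
    Integrable fun x : ℝ => (x + h) ^ n * Real.exp (-c * x ^ 2) := by
  simp only [add_pow, sum_mul]
  refine integrable_finsetSum _ fun i _ => ?_
  refine ((integrable_pow_mul_exp_neg_mul_sq i hc).const_mul (h ^ (n - i) * (n.choose i))).congr ?_
  exact Filter.Eventually.of_forall fun x => by ring

/-- Gaussian representation of the matching polynomial: both sides satisfy the same recursion, on
the Gaussian side by integration by parts. -/
theorem integral_add_pow_mul_exp_neg_mul_sq (h : ℝ) {c : ℝ} (hc : 0 < c) (n : ℕ) :
    ∫ x : ℝ, (x + h) ^ n * Real.exp (-c * x ^ 2)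
      = √(Real.pi / c) * matchingPoly (1 / (2 * c)) n h := by
  have hint := fun n => integrable_add_pow_mul_exp_neg_mul_sq h n hc
  have hderiv : ∀ (n : ℕ) (x : ℝ), HasDerivAt (fun x : ℝ => (x + h) ^ n * Real.exp (-c * x ^ 2))
      (n * ((x + h) ^ (n - 1) * Real.exp (-c * x ^ 2))
        - 2 * c * ((x + h) ^ (n + 1) * Real.exp (-c * x ^ 2)
          - h * ((x + h) ^ n * Real.exp (-c * x ^ 2)))) x := by
    intro n x
    have h1 : HasDerivAt (fun x : ℝ => (x + h) ^ n) (n * (x + h) ^ (n - 1) * 1) x :=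
      ((hasDerivAt_id' x).add_const h).pow n
    have h2 : HasDerivAt (fun x : ℝ => Real.exp (-c * x ^ 2))
        (Real.exp (-c * x ^ 2) * (-c * ((2 : ℕ) * x ^ (2 - 1)))) x :=
      ((hasDerivAt_pow 2 x).const_mul (-c)).exp
    refine (h1.mul h2).congr_deriv ?_
    push_cast
    ring
  have hrec : ∀ n : ℕ, n * (∫ x : ℝ, (x + h) ^ (n - 1) * Real.exp (-c * x ^ 2))
      - 2 * c * ((∫ x : ℝ, (x + h) ^ (n + 1) * Real.exp (-c * x ^ 2))
          - h * ∫ x : ℝ, (x + h) ^ n * Real.exp (-c * x ^ 2)) = 0 := by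
    intro n
    have hsub : Integrable fun x : ℝ => 2 * c * ((x + h) ^ (n + 1) * Real.exp (-c * x ^ 2)
        - h * ((x + h) ^ n * Real.exp (-c * x ^ 2))) :=
      ((hint _).sub ((hint _).const_mul _)).const_mul _
    rw [← integral_const_mul, ← integral_const_mul, ← integral_sub (hint _) ((hint _).const_mul _),
      ← integral_const_mul, ← integral_sub ((hint _).const_mul _) hsub]
    exact integral_eq_zero_of_hasDerivAt_of_integrable (hderiv n)
      (((hint _).const_mul _).sub hsub) (hint n)
  have h0 : ∫ x : ℝ, (x + h) ^ 0 * Real.exp (-c * x ^ 2) = √(Real.pi / c) := by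
    simp only [pow_zero, one_mul]
    exact integral_gaussian c
  induction n using Nat.strong_induction_on with
  | _ n ih =>
    rcases n with _ | _ | n
    · rw [h0, matchingPoly, mul_one]
    · have := hrec 0
      rw [h0] at this
      simp only [matchingPoly]
      simp only [Nat.cast_zero, zero_mul, zero_sub, neg_eq_zero, mul_eq_zero] at this
      rcases this with h' | h'
      · norm_num at h'
        exact absurd h' hc.ne'
      · linarith
    · have h1 := hrec (n + 1)
      rw [Nat.add_sub_cancel, ih n (by lia), ih (n + 1) (by lia)] at h1
      simp only [matchingPoly]
      field_simp at h1 ⊢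
      push_cast at h1 ⊢
      linarith

/-! ### The double Gaussian representation of the finite system -/

/-- The function `exp F`, continued to a signed continuous function on the whole plane. -/
def planeWeight (a b : ℝ) (z : ℝ × ℝ) : ℝ :=
  Real.exp (-(z.1 ^ 2 + a * z.2 ^ 2) / 2) * (z.1 + Real.exp (a * z.2 + b))

/-- The observable `g ^ k` times `exp (2 F)`, continued to the whole plane (for `k ≤ 2`). The factor
`exp (2 F)` removes the poles of `g ^ k`. -/
def observable (a b : ℝ) (k : ℕ) (z : ℝ × ℝ) : ℝ :=
  Real.exp (-(z.1 ^ 2 + a * z.2 ^ 2)) *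
    (Real.exp (a * z.2 + b) ^ k * (z.1 + Real.exp (a * z.2 + b)) ^ (2 - k))

/-- The integral of `g ^ k exp (N F)` over the plane, for `N = n + 2`. -/
def planeIntegral (a b : ℝ) (n k : ℕ) : ℝ :=
  ∫ z : ℝ × ℝ, planeWeight a b z ^ n * observable a b k z

theorem continuous_planeWeight (a b : ℝ) : Continuous (planeWeight a b) := by
  unfold planeWeight; fun_prop

theorem abs_planeWeight_le {a : ℝ} (ha : 0 < a) (b : ℝ) (z : ℝ × ℝ) :
    |planeWeight a b z| ≤ (1 + Real.exp (a + b)) * Real.exp (-(z.1 ^ 2 + a * z.2 ^ 2) / 4) := by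
  have h1 : |z.1| ≤ Real.exp ((z.1 ^ 2 + a * z.2 ^ 2) / 4) := by
    have := Real.add_one_le_exp ((z.1 ^ 2 + a * z.2 ^ 2) / 4)
    have h2 : |z.1| ≤ z.1 ^ 2 / 4 + 1 := by
      rw [← sq_abs z.1]; nlinarith [sq_nonneg (|z.1| / 2 - 1)]
    nlinarith [mul_nonneg ha.le (sq_nonneg z.2)]
  have h2 : Real.exp (a * z.2 + b)
      ≤ Real.exp (a + b) * Real.exp ((z.1 ^ 2 + a * z.2 ^ 2) / 4) := by
    rw [← Real.exp_add]
    apply Real.exp_le_exp.2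
    nlinarith [mul_nonneg ha.le (sq_nonneg (z.2 / 2 - 1)), sq_nonneg z.1]
  have h3 : Real.exp (-(z.1 ^ 2 + a * z.2 ^ 2) / 4)
      = Real.exp (-(z.1 ^ 2 + a * z.2 ^ 2) / 2) * Real.exp ((z.1 ^ 2 + a * z.2 ^ 2) / 4) := by
    rw [← Real.exp_add]; congr 1; ring
  rw [planeWeight, abs_mul, Real.abs_exp, h3]
  have h4 : |z.1 + Real.exp (a * z.2 + b)| ≤ |z.1| + Real.exp (a * z.2 + b) := by
    simpa using abs_add_le z.1 (Real.exp (a * z.2 + b))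
  calc _ ≤ Real.exp (-(z.1 ^ 2 + a * z.2 ^ 2) / 2) *
        ((1 + Real.exp (a + b)) * Real.exp ((z.1 ^ 2 + a * z.2 ^ 2) / 4)) := by
        gcongr; linarith
    _ = _ := by ring

theorem exists_abs_planeWeight_le {a : ℝ} (ha : 0 < a) (b : ℝ) :
    ∃ C, ∀ z, |planeWeight a b z| ≤ C := by
  refine ⟨1 + Real.exp (a + b), fun z => (abs_planeWeight_le ha b z).trans ?_⟩
  refine mul_le_of_le_one_right (by positivity) (Real.exp_le_one_iff.2 ?_)
  have := mul_nonneg ha.le (sq_nonneg z.2)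
  nlinarith [sq_nonneg z.1]

theorem integrable_observable {a : ℝ} (ha : 0 < a) (b : ℝ) (k : ℕ) :
    Integrable (observable a b k) := by
  have key : ∀ i j : ℕ, Integrable fun z : ℝ × ℝ => (z.1 ^ i * Real.exp (-1 * z.1 ^ 2)) *
      (Real.exp (j * b) * (Real.exp ((j * a) * z.2) * Real.exp (-a * z.2 ^ 2))) := fun i j =>
    (integrable_pow_mul_exp_neg_mul_sq i one_pos).mul_prod
      ((integrable_exp_mul_mul_exp_neg_mul_sq _ ha).const_mul _)
  have h : observable a b k = fun z => ∑ i ∈ range (2 - k + 1),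
      ((2 - k).choose i : ℝ) * ((z.1 ^ i * Real.exp (-1 * z.1 ^ 2)) *
      (Real.exp (((k + (2 - k - i) : ℕ) : ℝ) * b) *
        (Real.exp ((((k + (2 - k - i) : ℕ) : ℝ) * a) * z.2) * Real.exp (-a * z.2 ^ 2)))) := by
    funext z
    rw [observable, add_pow, mul_sum, mul_sum]
    refine sum_congr rfl fun i _ => ?_
    have h1 : Real.exp (-(z.1 ^ 2 + a * z.2 ^ 2))
        = Real.exp (-1 * z.1 ^ 2) * Real.exp (-a * z.2 ^ 2) := by
      rw [← Real.exp_add]; congr 1; ring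
    have h2 : Real.exp (((k + (2 - k - i) : ℕ) : ℝ) * b) *
        Real.exp ((((k + (2 - k - i) : ℕ) : ℝ) * a) * z.2)
        = Real.exp (a * z.2 + b) ^ k * Real.exp (a * z.2 + b) ^ (2 - k - i) := by
      rw [← pow_add, ← Real.exp_nat_mul, ← Real.exp_add]; congr 1; ring
    rw [h1, ← mul_assoc (Real.exp _) (Real.exp _) (Real.exp _), h2]
    ring
  rw [h]
  exact integrable_finsetSum _ fun i _ => (key _ _).const_mul _

theorem integrable_planeWeight_pow_mul {a : ℝ} (ha : 0 < a) (b : ℝ) (n : ℕ) {P : ℝ × ℝ → ℝ}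
    (hP : Integrable P) : Integrable fun z => planeWeight a b z ^ n * P z := by
  obtain ⟨C, hC⟩ := exists_abs_planeWeight_le ha b
  refine hP.bdd_mul (c := C ^ n) ((continuous_planeWeight a b).pow n).aestronglyMeasurable ?_
  refine Filter.Eventually.of_forall fun z => ?_
  rw [Real.norm_eq_abs, abs_pow]
  exact pow_le_pow_left₀ (abs_nonneg _) (hC z) n

theorem planeIntegral_eq {a : ℝ} (ha : 0 < a) (b : ℝ) (n k : ℕ) (hk : k ≤ 2) :
    planeIntegral a b n k = √(2 * Real.pi / (n + 2 : ℕ)) *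
      ∫ y : ℝ, Real.exp (-((n + 2 : ℕ) * a / 2) * y ^ 2) * (Real.exp (a * y + b) ^ k *
        matchingPoly (1 / (n + 2 : ℕ)) (n + 2 - k) (Real.exp (a * y + b))) := by
  have hint := integrable_planeWeight_pow_mul ha b n (integrable_observable ha b k)
  rw [planeIntegral]
  rw [Measure.volume_eq_prod] at hint ⊢
  rw [integral_prod_symm _ hint, ← integral_const_mul]
  refine integral_congr_ae (Filter.Eventually.of_forall fun y => ?_)
  have hc : (0 : ℝ) < (n + 2 : ℕ) / 2 := by positivity
  have h := integral_add_pow_mul_exp_neg_mul_sq (Real.exp (a * y + b)) hc (n + 2 - k)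
  have h1 : Real.pi / ((n + 2 : ℕ) / 2) = 2 * Real.pi / (n + 2 : ℕ) := by
    field_simp
  have h2 : 1 / (2 * (((n + 2 : ℕ) : ℝ) / 2)) = 1 / (n + 2 : ℕ) := by
    field_simp
  rw [h1, h2] at h
  have h3 : ∀ x : ℝ, planeWeight a b (x, y) ^ n * observable a b k (x, y)
      = Real.exp (-((n + 2 : ℕ) * a / 2) * y ^ 2) * Real.exp (a * y + b) ^ k *
        ((x + Real.exp (a * y + b)) ^ (n + 2 - k) *
          Real.exp (-(((n + 2 : ℕ) : ℝ) / 2) * x ^ 2)) := by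
    intro x
    have h4 : Real.exp (-(x ^ 2 + a * y ^ 2) / 2) ^ n * Real.exp (-(x ^ 2 + a * y ^ 2))
        = Real.exp (-((n + 2 : ℕ) * a / 2) * y ^ 2) *
          Real.exp (-(((n + 2 : ℕ) : ℝ) / 2) * x ^ 2) := by
      rw [← Real.exp_nat_mul, ← Real.exp_add, ← Real.exp_add]
      congr 1
      push_cast
      ring
    have h5 : n + 2 - k = n + (2 - k) := by lia
    simp only [planeWeight, observable]
    rw [mul_pow, h5, pow_add]
    linear_combination (x + Real.exp (a * y + b)) ^ n * (x + Real.exp (a * y + b)) ^ (2 - k) *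
      Real.exp (a * y + b) ^ k * h4
  simp only [h3]
  rw [integral_const_mul, h]
  ring

/-- Linearising the quadratic part of the Hamiltonian by a Gaussian integral over `y`. -/
theorem integral_sum_configurations {a : ℝ} (ha : 0 < a) (b : ℝ) {N : ℕ} (hN : 0 < N)
    (r : Finset (Finset (Fin N)) → ℝ) :
    ∫ y : ℝ, Real.exp (-(N * a / 2) * y ^ 2) * ∑ D ∈ configurations N,
      (1 / (N : ℝ)) ^ D.card * (r D * Real.exp (a * y + b) ^ (monomers D).card)
      = √(2 * Real.pi / (N * a)) * ∑ D ∈ configurations N, r D * weight a b D := by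
  have hN' : (0 : ℝ) < N := by exact_mod_cast hN
  have hc : 0 < N * a / 2 := by positivity
  have h1 : ∀ (D : Finset (Finset (Fin N))) (y : ℝ), Real.exp (-(N * a / 2) * y ^ 2) *
      ((1 / (N : ℝ)) ^ D.card * (r D * Real.exp (a * y + b) ^ (monomers D).card))
      = ((1 / (N : ℝ)) ^ D.card * r D * Real.exp ((monomers D).card * b)) *
        (Real.exp (((monomers D).card * a) * y) * Real.exp (-(N * a / 2) * y ^ 2)) := by
    intro D y
    have : Real.exp (a * y + b) ^ (monomers D).card
        = Real.exp ((monomers D).card * b) * Real.exp (((monomers D).card * a) * y) := by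
      rw [← Real.exp_nat_mul, ← Real.exp_add]; congr 1; ring
    rw [this]; ring
  simp only [mul_sum, h1]
  rw [integral_finsetSum _ fun D _ =>
    (integrable_exp_mul_mul_exp_neg_mul_sq _ hc).const_mul _]
  refine sum_congr rfl fun D _ => ?_
  rw [integral_const_mul, integral_exp_mul_mul_exp_neg_mul_sq _ hc]
  have h2 : Real.pi / (N * a / 2) = 2 * Real.pi / (N * a) := by field_simp
  have h3 : Real.exp (-hamiltonian a b D) = Real.exp ((monomers D).card * b) *
      Real.exp (((monomers D).card * a) ^ 2 / (4 * (N * a / 2))) := by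
    rw [← Real.exp_add, hamiltonian, monomerDensity]
    congr 1
    field_simp
    ring
  rw [h2, weight, h3, one_div, inv_pow]
  ring

/-- The ratio between the plane integrals and the sums over configurations, for `N = n + 2`. -/
def gaussConst (a : ℝ) (n : ℕ) : ℝ :=
  √(2 * Real.pi / (n + 2 : ℕ)) * √(2 * Real.pi / ((n + 2 : ℕ) * a))

theorem planeIntegral_zero {a : ℝ} (ha : 0 < a) (b : ℝ) (n : ℕ) :
    planeIntegral a b n 0 = gaussConst a n * partitionFunction a b (n + 2) := by
  rw [planeIntegral_eq ha b n 0 (by lia), gaussConst, mul_assoc]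
  congr 1
  have := integral_sum_configurations ha b (N := n + 2) (by lia) (fun _ => 1)
  simp only [one_mul] at this
  rw [partitionFunction, ← this]
  simp only [sum_configurations_eq_matchingPoly, pow_zero, one_mul, Nat.sub_zero]

theorem planeIntegral_one {a : ℝ} (ha : 0 < a) (b : ℝ) (n : ℕ) :
    (n + 2 : ℕ) * planeIntegral a b n 1 = gaussConst a n *
      ∑ D ∈ configurations (n + 2), ((monomers D).card : ℝ) * weight a b D := by
  rw [planeIntegral_eq ha b n 1 (by lia), gaussConst, mul_assoc, mul_left_comm]
  congr 1
  rw [← integral_sum_configurations ha b (N := n + 2) (by lia), ← integral_const_mul]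
  refine integral_congr_ae (Filter.Eventually.of_forall fun y => ?_)
  simp only [sum_configurations_monomers]
  rw [show n + 2 - 1 = n + 1 from rfl]
  push_cast
  ring

theorem planeIntegral_two {a : ℝ} (ha : 0 < a) (b : ℝ) (n : ℕ) :
    (n + 2 : ℕ) * planeIntegral a b n 1 + (n + 2 : ℕ) * (n + 1) * planeIntegral a b n 2
      = gaussConst a n *
        ∑ D ∈ configurations (n + 2), ((monomers D).card : ℝ) ^ 2 * weight a b D := by
  have h1 := planeIntegral_one ha b n
  have h2 : (n + 2 : ℕ) * (n + 1) * planeIntegral a b n 2 = gaussConst a n *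
      ∑ D ∈ configurations (n + 2),
        (((monomers D).card : ℝ) ^ 2 - (monomers D).card) * weight a b D := by
    rw [planeIntegral_eq ha b n 2 (by lia), gaussConst, mul_assoc (√_), mul_left_comm]
    congr 1
    rw [← integral_sum_configurations ha b (N := n + 2) (by lia), ← integral_const_mul]
    refine integral_congr_ae (Filter.Eventually.of_forall fun y => ?_)
    simp only [sub_mul, mul_sub, sum_sub_distrib, sum_configurations_monomers,
      sum_configurations_monomers_sq]
    rw [show n + 2 - 2 = n from rfl]
    push_cast
    ring
  rw [h1, h2, ← mul_add, ← sum_add_distrib]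
  congr 1
  exact sum_congr rfl fun D _ => by ring

/-! ### The maximum of the weight -/

/-- The point `(√(1-m), m)` of the plane. -/
def basePoint (m : ℝ) : ℝ × ℝ := (√(1 - m), m)

theorem planeWeight_eq_exp_F {a b x y : ℝ} (h : 0 < x + Real.exp (a * y + b)) :
    planeWeight a b (x, y) = Real.exp (F a b x y) := by
  rw [F, Real.exp_add, Real.exp_log h, planeWeight]
  congr 2
  ring

theorem sqrt_add_exp_pos (a b y : ℝ) : 0 < √(1 - y) + Real.exp (a * y + b) :=
  add_pos_of_nonneg_of_pos (Real.sqrt_nonneg _) (Real.exp_pos _)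

theorem planeWeight_basePoint (a b y : ℝ) :
    planeWeight a b (basePoint y) = Real.exp (F a b (√(1 - y)) y) :=
  planeWeight_eq_exp_F (sqrt_add_exp_pos a b y)

theorem tendsto_planeWeight_cocompact {a : ℝ} (ha : 0 < a) (b : ℝ) :
    Tendsto (fun z => |planeWeight a b z|) (cocompact (ℝ × ℝ)) (𝓝 0) := by
  set c := min 1 a / 4
  have hc : 0 < c := by positivity
  have h1 : Tendsto (fun z : ℝ × ℝ => c * ‖z‖ ^ 2) (cocompact (ℝ × ℝ)) atTop :=
    ((tendsto_pow_atTop two_ne_zero).comp tendsto_norm_cocompact_atTop).const_mul_atTop hc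
  have h2 : Tendsto (fun z : ℝ × ℝ => (1 + Real.exp (a + b)) * Real.exp (-(c * ‖z‖ ^ 2)))
      (cocompact (ℝ × ℝ)) (𝓝 ((1 + Real.exp (a + b)) * 0)) :=
    (Real.tendsto_exp_neg_atTop_nhds_zero.comp h1).const_mul _
  rw [mul_zero] at h2
  refine squeeze_zero (fun _ => abs_nonneg _) (fun z => (abs_planeWeight_le ha b z).trans ?_) h2
  gcongr
  have hn : ‖z‖ ^ 2 ≤ z.1 ^ 2 + z.2 ^ 2 := by
    rw [Prod.norm_def]
    rcases max_choice ‖z.1‖ ‖z.2‖ with h | h <;> rw [h, Real.norm_eq_abs, sq_abs]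
    · linarith [sq_nonneg z.2]
    · linarith [sq_nonneg z.1]
  have h3 : min 1 a * (z.1 ^ 2 + z.2 ^ 2) ≤ z.1 ^ 2 + a * z.2 ^ 2 := by
    have := mul_le_mul_of_nonneg_right (min_le_left 1 a) (sq_nonneg z.1)
    have := mul_le_mul_of_nonneg_right (min_le_right 1 a) (sq_nonneg z.2)
    linarith
  have h4 : min 1 a * ‖z‖ ^ 2 ≤ min 1 a * (z.1 ^ 2 + z.2 ^ 2) :=
    mul_le_mul_of_nonneg_left hn (by positivity)
  simp only [c]
  linarith

/-- A maximum of the weight is a critical point of `F`, and the critical point equations amount to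
the consistency equation. -/
theorem isConsistent_of_forall_le {a b : ℝ} (ha : 0 < a) {z : ℝ × ℝ}
    (hz : ∀ z', |planeWeight a b z'| ≤ |planeWeight a b z|) :
    IsConsistent a b z.2 ∧ z = basePoint z.2 := by
  obtain ⟨x, y⟩ := z
  set E := Real.exp (a * y + b) with hE
  have hE0 : 0 < E := Real.exp_pos _
  have hx : 0 ≤ x := by
    by_contra! hx
    have h := hz (-x, y)
    simp only [planeWeight, abs_mul, Real.abs_exp, neg_sq, ← hE] at h
    have h := le_of_mul_le_mul_left h (Real.exp_pos _)
    rw [abs_of_pos (by linarith)] at h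
    have : |x + E| < -x + E := abs_lt.2 ⟨by linarith, by linarith⟩
    linarith
  have hxE : 0 < x + E := by linarith
  have hpos : |planeWeight a b (x, y)| = planeWeight a b (x, y) := by
    rw [planeWeight_eq_exp_F hxE, Real.abs_exp]
  have hle : ∀ z', planeWeight a b z' ≤ planeWeight a b (x, y) := fun z' =>
    (le_abs_self _).trans ((hz z').trans hpos.le)
  have hdx : HasDerivAt (fun s => planeWeight a b (s, y))
      (Real.exp (-(x ^ 2 + a * y ^ 2) / 2) * (1 - x * (x + E))) x := by
    have h1 : HasDerivAt (fun s : ℝ => Real.exp (-(s ^ 2 + a * y ^ 2) / 2))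
        (Real.exp (-(x ^ 2 + a * y ^ 2) / 2) * (-((2 : ℕ) * x ^ (2 - 1)) / 2)) x :=
      ((((hasDerivAt_pow 2 x).add_const _).neg).div_const 2).exp
    refine (h1.mul ((hasDerivAt_id' x).add_const E)).congr_deriv ?_
    push_cast
    ring
  have hdy : HasDerivAt (fun t => planeWeight a b (x, t))
      (Real.exp (-(x ^ 2 + a * y ^ 2) / 2) * (a * (E - y * (x + E)))) y := by
    have h1 : HasDerivAt (fun t : ℝ => Real.exp (-(x ^ 2 + a * t ^ 2) / 2))
        (Real.exp (-(x ^ 2 + a * y ^ 2) / 2) * (-(a * ((2 : ℕ) * y ^ (2 - 1))) / 2)) y :=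
      (((((hasDerivAt_pow 2 y).const_mul a).const_add _).neg).div_const 2).exp
    have h2 : HasDerivAt (fun t : ℝ => x + Real.exp (a * t + b)) (E * (a * 1)) y :=
      ((((hasDerivAt_id' y).const_mul a).add_const b).exp).const_add x
    refine (h1.mul h2).congr_deriv ?_
    push_cast
    ring
  have hmx : IsLocalMax (fun s => planeWeight a b (s, y)) x :=
    Eventually.of_forall fun s => hle (s, y)
  have hmy : IsLocalMax (fun t => planeWeight a b (x, t)) y :=
    Eventually.of_forall fun t => hle (x, t)
  have ex : 1 - x * (x + E) = 0 :=
    (mul_eq_zero.1 (hmx.hasDerivAt_eq_zero hdx)).resolve_left (Real.exp_pos _).ne'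
  have ey : E - y * (x + E) = 0 :=
    (mul_eq_zero.1 ((mul_eq_zero.1 (hmy.hasDerivAt_eq_zero hdy)).resolve_left
      (Real.exp_pos _).ne')).resolve_left ha.ne'
  have hx0 : 0 < x := lt_of_le_of_ne hx (by rintro rfl; simp at ex)
  have hyx : y = x * E := by linear_combination y * ex - x * ey
  have hy0 : 0 < y := hyx ▸ mul_pos hx0 hE0
  have hxx : 1 - y = x ^ 2 := by linear_combination ex - hyx
  have hy1 : y < 1 := by nlinarith [sq_pos_of_pos hx0]
  have hsq : √(1 - y) = x := by rw [hxx, Real.sqrt_sq hx]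
  refine ⟨⟨hy0, hy1, ?_⟩, ?_⟩
  · change E = y / √(1 - y)
    rw [hsq, eq_div_iff hx0.ne', hyx, mul_comm]
  · simp only [basePoint, hsq]

theorem exists_forall_abs_planeWeight_le {a : ℝ} (ha : 0 < a) (b : ℝ) {s : Set (ℝ × ℝ)}
    (hs : IsClosed s) {z₀ : ℝ × ℝ} (hz₀ : z₀ ∈ s) (h₀ : planeWeight a b z₀ ≠ 0) :
    ∃ z ∈ s, ∀ z' ∈ s, |planeWeight a b z'| ≤ |planeWeight a b z| := by
  refine (continuous_planeWeight a b).abs.continuousOn.exists_isMaxOn' hs hz₀ ?_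
  have := (tendsto_planeWeight_cocompact ha b).eventually (gt_mem_nhds (abs_pos.2 h₀))
  exact (this.filter_mono inf_le_left).mono fun _ => le_of_lt

/-- A phase exists: the maximum of the weight over the plane is attained, at a phase. -/
theorem exists_isPhase {a : ℝ} (ha : 0 < a) (b : ℝ) : ∃ m, IsPhase a b m := by
  have h₀ : planeWeight a b (basePoint 0) ≠ 0 := by
    rw [planeWeight_basePoint]; exact (Real.exp_pos _).ne'
  obtain ⟨z, -, hz⟩ := exists_forall_abs_planeWeight_le ha b isClosed_univ (Set.mem_univ _) h₀
  obtain ⟨hc, hzb⟩ := isConsistent_of_forall_le ha fun z' => hz z' trivial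
  refine ⟨z.2, hc, fun y _ => ?_⟩
  have := hz (basePoint y) trivial
  rwa [hzb, planeWeight_basePoint, planeWeight_basePoint, Real.abs_exp, Real.abs_exp,
    Real.exp_le_exp] at this

/-- A phase maximizes the weight over the whole plane. -/
theorem IsPhase.abs_planeWeight_le {a b m : ℝ} (ha : 0 < a) (hm : IsPhase a b m) (z : ℝ × ℝ) :
    |planeWeight a b z| ≤ planeWeight a b (basePoint m) := by
  have h₀ : planeWeight a b (basePoint 0) ≠ 0 := by
    rw [planeWeight_basePoint]; exact (Real.exp_pos _).ne'
  obtain ⟨z₁, -, hz₁⟩ := exists_forall_abs_planeWeight_le ha b isClosed_univ (Set.mem_univ _) h₀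
  obtain ⟨hc, hzb⟩ := isConsistent_of_forall_le ha fun z' => hz₁ z' trivial
  refine (hz₁ z trivial).trans ?_
  rw [hzb, planeWeight_basePoint, planeWeight_basePoint, Real.abs_exp, Real.exp_le_exp]
  exact hm.2 _ hc

/-- If the phase is unique, the weight is smaller by a fixed factor away from the base point. -/
theorem IsPhase.exists_gap {a b m : ℝ} (ha : 0 < a) (hm : IsPhase a b m)
    (hunique : ∀ m', IsPhase a b m' → m' = m) {δ : ℝ} (hδ : 0 < δ) :
    ∃ ρ, 0 ≤ ρ ∧ ρ < 1 ∧ ∀ z, δ ≤ ‖z - basePoint m‖ →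
      |planeWeight a b z| ≤ ρ * planeWeight a b (basePoint m) := by
  have hs : IsClosed {z : ℝ × ℝ | δ ≤ ‖z - basePoint m‖} :=
    isClosed_le continuous_const (by fun_prop)
  have hz₀ : basePoint m + (δ, 0) ∈ {z : ℝ × ℝ | δ ≤ ‖z - basePoint m‖} := by
    simp [Prod.norm_def, le_abs_self]
  have h₀ : planeWeight a b (basePoint m + (δ, 0)) ≠ 0 := by
    have : (0 : ℝ) < √(1 - m) + δ + Real.exp (a * m + b) := by
      have := sqrt_add_exp_pos a b m; linarith
    have h := planeWeight_eq_exp_F this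
    have h1 : basePoint m + (δ, 0) = (√(1 - m) + δ, m) := by simp [basePoint]
    rw [h1, h]
    exact (Real.exp_pos _).ne'
  obtain ⟨z₁, hz₁, hmax⟩ := exists_forall_abs_planeWeight_le ha b hs hz₀ h₀
  have hW : 0 < planeWeight a b (basePoint m) := by
    rw [planeWeight_basePoint]; exact Real.exp_pos _
  refine ⟨|planeWeight a b z₁| / planeWeight a b (basePoint m), by positivity, ?_, fun z hz => ?_⟩
  · rw [div_lt_one hW]
    refine lt_of_le_of_ne (hm.abs_planeWeight_le ha z₁) fun heq => ?_
    obtain ⟨hc, hzb⟩ := isConsistent_of_forall_le ha fun z' =>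
      (hm.abs_planeWeight_le ha z').trans heq.ge
    have hp : IsPhase a b z₁.2 := by
      refine ⟨hc, fun y hy => ?_⟩
      rw [hzb, planeWeight_basePoint, planeWeight_basePoint, Real.abs_exp] at heq
      exact (hm.2 y hy).trans (Real.exp_le_exp.1 heq.ge)
    have : z₁ = basePoint m := by rw [hzb, hunique _ hp]
    rw [this] at hz₁
    simp only [Set.mem_ofPred_eq, sub_self, norm_zero] at hz₁
    linarith
  · rw [div_mul_cancel₀ _ hW.ne']
    exact hmax z hz

/-! ### Nondegeneracy of the maximum -/

theorem IsConsistent.log_eq {a b m : ℝ} (h : IsConsistent a b m) :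
    Real.log m - Real.log (1 - m) / 2 = a * m + b := by
  obtain ⟨h0, h1, h⟩ := h
  have := congrArg Real.log h
  rw [Real.log_exp, Real.log_div h0.ne' (Real.sqrt_pos.2 (by linarith)).ne',
    Real.log_sqrt (by linarith)] at this
  exact this.symm

theorem hasDerivAt_log_consistency (a b : ℝ) {y : ℝ} (h0 : 0 < y) (h1 : y < 1) :
    HasDerivAt (fun y => Real.log y - Real.log (1 - y) / 2 - (a * y + b))
      ((2 - y - 2 * a * y * (1 - y)) / (2 * y * (1 - y))) y := by
  have h1' : 1 - y ≠ 0 := by linarith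
  have hA := Real.hasDerivAt_log h0.ne'
  have hB : HasDerivAt (fun y : ℝ => Real.log (1 - y)) (-1 / (1 - y)) y :=
    ((hasDerivAt_id' y).const_sub 1).log h1'
  have hC : HasDerivAt (fun y : ℝ => a * y + b) (a * 1) y :=
    ((hasDerivAt_id' y).const_mul a).add_const b
  refine ((hA.sub (hB.div_const 2)).sub hC).congr_deriv ?_
  field_simp
  ring

/-- Along the curve `y ↦ (√(1-y), y)` the derivative of `F` has the sign of
`√(1-y) e^{ay+b} - y`. -/
theorem hasDerivAt_F_curve (a b : ℝ) {y : ℝ} (h1 : y < 1) :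
    HasDerivAt (fun y => F a b (√(1 - y)) y)
      ((√(1 - y) * Real.exp (a * y + b) - y) *
        ((1 / (2 * √(1 - y)) + a * √(1 - y)) / (√(1 - y) + Real.exp (a * y + b)))) y := by
  have h1' : 0 < 1 - y := by linarith
  have hx0 : 0 < √(1 - y) := Real.sqrt_pos.2 h1'
  have hS : HasDerivAt (fun y : ℝ => √(1 - y)) (-1 / (2 * √(1 - y))) y :=
    ((hasDerivAt_id' y).const_sub 1).sqrt h1'.ne'
  have hE : HasDerivAt (fun y : ℝ => Real.exp (a * y + b)) (Real.exp (a * y + b) * (a * 1)) y :=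
    (((hasDerivAt_id' y).const_mul a).add_const b).exp
  have hxE := sqrt_add_exp_pos a b y
  have hL := (hS.add hE).log hxE.ne'
  have hQ : HasDerivAt (fun y : ℝ => -√(1 - y) ^ 2 / 2 - a * y ^ 2 / 2)
      (-((2 : ℕ) * √(1 - y) ^ (2 - 1) * (-1 / (2 * √(1 - y)))) / 2
        - a * ((2 : ℕ) * y ^ (2 - 1)) / 2) y :=
    ((hS.pow 2).neg.div_const 2).sub (((hasDerivAt_pow 2 y).const_mul a).div_const 2)
  refine (hQ.add hL).congr_deriv ?_
  have hsq := Real.sq_sqrt h1'.le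
  simp only [Pi.add_apply]
  generalize √(1 - y) = x at *
  generalize Real.exp (a * y + b) = E at *
  obtain rfl : y = 1 - x ^ 2 := by linarith
  push_cast
  field_simp
  ring

theorem critical_of_double_root {a b m : ℝ} (ha : 0 < a) (hm : IsConsistent a b m)
    (h0 : 2 - m - 2 * a * m * (1 - m) = 0) (h1 : 4 * a * m = 1 + 2 * a) :
    a = aCrit ∧ b = bCrit := by
  have hs : √2 ^ 2 = 2 := Real.sq_sqrt (by norm_num)
  have hs1 : 1 < √2 := by rw [Real.lt_sqrt] <;> norm_num
  have hs2 : √2 < 2 := by rw [Real.sqrt_lt'] <;> norm_num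
  have hlog := hm.log_eq
  obtain ⟨hm0, hm1, -⟩ := hm
  have ha2 : 1 / 2 < a := by nlinarith
  have h2 : (2 * a - 3 - 2 * √2) * (2 * a - 3 + 2 * √2) = 0 := by
    linear_combination (-8 * a) * h0 + (4 * a * m - 1 - 2 * a) * h1 - 4 * hs
  have haC : a = aCrit := by
    rw [aCrit]
    rcases mul_eq_zero.1 h2 with h | h <;> nlinarith
  refine ⟨haC, ?_⟩
  have hmC : m = 2 - √2 := by
    rw [aCrit] at haC
    have : 4 * a * (m - (2 - √2)) = 0 := by
      rw [mul_sub, h1, haC]; linear_combination 4 * hs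
    rcases mul_eq_zero.1 this with h | h <;> linarith
  have hl : Real.log (2 * √2 - 2) = 2 * Real.log m - Real.log (1 - m) := by
    have h3 : m ^ 2 = (2 * √2 - 2) * (1 - m) := by
      rw [hmC]; linear_combination (-1 : ℝ) * hs
    have h4 := congrArg Real.log h3
    rw [Real.log_pow, Real.log_mul (by linarith) (by linarith)] at h4
    push_cast at h4
    linarith
  have ham : a * m = (2 + √2) / 2 := by
    rw [haC, hmC, aCrit]; linear_combination (-1 : ℝ) * hs
  rw [bCrit, hl]
  linarith

/-- Away from the critical point the maximum is nondegenerate: the logarithm of the consistency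
equation has a simple zero at the phase. At a multiple zero which is not a triple one, `F` would be
strictly monotone along the curve `y ↦ (√(1-y), y)` on one side of the phase, and increase. -/
theorem IsPhase.nondegenerate {a b m : ℝ} (ha : 0 < a) (hm : IsPhase a b m)
    (hcrit : ¬ (a = aCrit ∧ b = bCrit)) : 0 < 2 - m - 2 * a * m * (1 - m) := by
  by_contra! hle
  have hmax : ∀ y, F a b (√(1 - y)) y ≤ F a b (√(1 - m)) m := by
    intro y
    have := hm.abs_planeWeight_le ha (basePoint y)
    rwa [planeWeight_basePoint, planeWeight_basePoint, Real.abs_exp, Real.exp_le_exp] at this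
  have hlog := hm.1.log_eq
  obtain ⟨⟨hm0, hm1, hEm⟩, -⟩ := hm
  have hderivH := fun y h0 h1 => hasDerivAt_log_consistency a b (y := y) h0 h1
  have hderivF := fun y h1 => hasDerivAt_F_curve a b (y := y) h1
  set H : ℝ → ℝ := fun y => Real.log y - Real.log (1 - y) / 2 - (a * y + b) with hH
  have hHm : H m = 0 := by simp only [hH]; linarith
  have hlt : ∀ y, 0 < y → y < 1 → H y < 0 → y < √(1 - y) * Real.exp (a * y + b) := by
    intro y h0 h1 hy
    have hx0 : 0 < √(1 - y) := Real.sqrt_pos.2 (by linarith)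
    rw [← Real.log_lt_log_iff h0 (by positivity), Real.log_mul hx0.ne' (Real.exp_pos _).ne',
      Real.log_exp, Real.log_sqrt (by linarith)]
    simp only [hH] at hy
    linarith
  have hgt : ∀ y, 0 < y → y < 1 → 0 < H y → √(1 - y) * Real.exp (a * y + b) < y := by
    intro y h0 h1 hy
    have hx0 : 0 < √(1 - y) := Real.sqrt_pos.2 (by linarith)
    rw [← Real.log_lt_log_iff (by positivity) h0, Real.log_mul hx0.ne' (Real.exp_pos _).ne',
      Real.log_exp, Real.log_sqrt (by linarith)]
    simp only [hH] at hy
    linarith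
  have hfac : ∀ y, y < 1 → 0 < (1 / (2 * √(1 - y)) + a * √(1 - y)) /
      (√(1 - y) + Real.exp (a * y + b)) := by
    intro y h1
    have hx0 : 0 < √(1 - y) := Real.sqrt_pos.2 (by linarith)
    positivity
  -- The numerator of the derivative of `H` is a convex quadratic polynomial which is nonpositive at
  -- `m`, hence negative on one side of `m` unless `m` is a double root.
  have hside : (∃ ε > 0, m + ε < 1 ∧ ∀ y, m < y → y < m + ε → 2 - y - 2 * a * y * (1 - y) < 0) ∨
      (∃ ε > 0, 0 < m - ε ∧ ∀ y, m - ε < y → y < m → 2 - y - 2 * a * y * (1 - y) < 0) := by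
    have hexp : ∀ y, 2 - y - 2 * a * y * (1 - y) = (2 - m - 2 * a * m * (1 - m))
        + (y - m) * ((4 * a * m - (1 + 2 * a)) + 2 * a * (y - m)) := fun y => by ring
    rcases lt_trichotomy (4 * a * m) (1 + 2 * a) with h | h | h
    · left
      refine ⟨min ((1 - m) / 2) ((1 + 2 * a - 4 * a * m) / (2 * a)), ?_, ?_, ?_⟩
      · exact lt_min (by linarith) (div_pos (by linarith) (by linarith))
      · linarith [min_le_left ((1 - m) / 2) ((1 + 2 * a - 4 * a * m) / (2 * a))]
      · intro y h1 h2
        have h3 : y - m < (1 + 2 * a - 4 * a * m) / (2 * a) :=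
          lt_of_lt_of_le (by linarith) (min_le_right _ _)
        rw [lt_div_iff₀ (by linarith)] at h3
        rw [hexp]
        have := mul_pos (sub_pos.2 h1) (sub_pos.2 h3)
        nlinarith
    · have hne : 2 - m - 2 * a * m * (1 - m) ≠ 0 := fun h0 =>
        hcrit (critical_of_double_root ha ⟨hm0, hm1, hEm⟩ h0 h)
      have hneg := lt_of_le_of_ne hle hne
      have hcont : Tendsto (fun y : ℝ => 2 - y - 2 * a * y * (1 - y)) (𝓝 m)
          (𝓝 (2 - m - 2 * a * m * (1 - m))) := by
        apply Continuous.tendsto; fun_prop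
      obtain ⟨ε, hε, hball⟩ := Metric.eventually_nhds_iff.1 (hcont.eventually (gt_mem_nhds hneg))
      left
      refine ⟨min ((1 - m) / 2) ε, lt_min (by linarith) hε, ?_, fun y h1 h2 => hball ?_⟩
      · linarith [min_le_left ((1 - m) / 2) ε]
      · rw [Real.dist_eq, abs_of_pos (by linarith)]
        linarith [min_le_right ((1 - m) / 2) ε]
    · right
      refine ⟨min (m / 2) ((4 * a * m - (1 + 2 * a)) / (2 * a)), ?_, ?_, ?_⟩
      · exact lt_min (by linarith) (div_pos (by linarith) (by linarith))
      · linarith [min_le_left (m / 2) ((4 * a * m - (1 + 2 * a)) / (2 * a))]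
      · intro y h1 h2
        have h3 : m - y < (4 * a * m - (1 + 2 * a)) / (2 * a) :=
          lt_of_lt_of_le (by linarith) (min_le_right _ _)
        rw [lt_div_iff₀ (by linarith)] at h3
        rw [hexp]
        have := mul_pos (sub_pos.2 h2) (sub_pos.2 h3)
        nlinarith
  rcases hside with ⟨ε, hε, hε1, hneg⟩ | ⟨ε, hε, hε0, hneg⟩
  · have hanti : StrictAntiOn H (Set.Ico m (m + ε)) := by
      refine strictAntiOn_of_deriv_neg (convex_Ico _ _) ?_ ?_
      · intro y hy
        exact (hderivH y (by linarith [hy.1]) (by linarith [hy.2])).continuousAt.continuousWithinAt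
      · intro y hy
        rw [interior_Ico] at hy
        have h0 : 0 < y := by linarith [hy.1]
        have h1 : 0 < 1 - y := by linarith [hy.2]
        rw [(hderivH y h0 (by linarith)).deriv]
        exact div_neg_of_neg_of_pos (hneg y hy.1 hy.2) (by positivity)
    have hmono : StrictMonoOn (fun y => F a b (√(1 - y)) y) (Set.Ico m (m + ε)) := by
      refine strictMonoOn_of_deriv_pos (convex_Ico _ _) ?_ ?_
      · intro y hy
        exact (hderivF y (by linarith [hy.2])).continuousAt.continuousWithinAt
      · intro y hy
        rw [interior_Ico] at hy
        have h0 : 0 < y := by linarith [hy.1]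
        have h1 : y < 1 := by linarith [hy.2]
        rw [(hderivF y h1).deriv]
        have hHy : H y < 0 := by
          rw [← hHm]; exact hanti ⟨le_rfl, by linarith⟩ ⟨hy.1.le, hy.2⟩ hy.1
        exact mul_pos (by linarith [hlt y h0 h1 hHy]) (hfac y h1)
    have := hmono (a := m) (b := m + ε / 2) ⟨le_rfl, by linarith⟩ ⟨by linarith, by linarith⟩
      (by linarith)
    exact absurd (hmax (m + ε / 2)) (not_le.2 this)
  · have hanti : StrictAntiOn H (Set.Ioc (m - ε) m) := by
      refine strictAntiOn_of_deriv_neg (convex_Ioc _ _) ?_ ?_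
      · intro y hy
        exact (hderivH y (by linarith [hy.1]) (by linarith [hy.2])).continuousAt.continuousWithinAt
      · intro y hy
        rw [interior_Ioc] at hy
        have h0 : 0 < y := by linarith [hy.1]
        have h1 : 0 < 1 - y := by linarith [hy.2]
        rw [(hderivH y h0 (by linarith)).deriv]
        exact div_neg_of_neg_of_pos (hneg y hy.1 hy.2) (by positivity)
    have hanti' : StrictAntiOn (fun y => F a b (√(1 - y)) y) (Set.Ioc (m - ε) m) := by
      refine strictAntiOn_of_deriv_neg (convex_Ioc _ _) ?_ ?_
      · intro y hy
        exact (hderivF y (by linarith [hy.2])).continuousAt.continuousWithinAt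
      · intro y hy
        rw [interior_Ioc] at hy
        have h0 : 0 < y := by linarith [hy.1]
        have h1 : y < 1 := by linarith [hy.2]
        rw [(hderivF y h1).deriv]
        have hHy : 0 < H y := by
          rw [← hHm]; exact hanti ⟨hy.1, hy.2.le⟩ ⟨by linarith, le_rfl⟩ hy.2
        exact mul_neg_of_neg_of_pos (by linarith [hgt y h0 h1 hHy]) (hfac y h1)
    have := hanti' (a := m - ε / 2) (b := m) ⟨by linarith, by linarith⟩ ⟨by linarith, le_rfl⟩
      (by linarith)
    exact absurd (hmax (m - ε / 2)) (not_le.2 this)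

/-! ### Taylor expansion in two variables -/

/-- Taylor's inequality for a function `ψ 0` with successive derivatives `ψ 1`, …, `ψ n`. -/
theorem abs_sub_taylor_sum_le (n : ℕ) {ψ : ℕ → ℝ → ℝ} {δ C : ℝ}
    (hψ : ∀ k < n, ∀ t, |t| ≤ δ → HasDerivAt (ψ k) (ψ (k + 1) t) t)
    (hC : ∀ t, |t| ≤ δ → |ψ n t| ≤ C) {t : ℝ} (ht : |t| ≤ δ) :
    |ψ 0 t - ∑ k ∈ range n, ψ k 0 * t ^ k / k.factorial| ≤ C * |t| ^ n := by
  induction n generalizing ψ t with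
  | zero => simpa using hC t ht
  | succ n ih =>
    have hδ : 0 ≤ δ := (abs_nonneg t).trans ht
    have ih' := fun {s : ℝ} (hs : |s| ≤ δ) => ih (ψ := fun k => ψ (k + 1))
      (fun k hk => hψ (k + 1) (by lia)) (fun s hs => hC s hs) (t := s) hs
    set R : ℝ → ℝ := fun s => ψ 0 s - ∑ k ∈ range (n + 1), ψ k 0 * s ^ k / k.factorial with hR
    have hderiv : ∀ s ∈ Set.Icc (-|t|) |t|, HasDerivWithinAt R
        (ψ 1 s - ∑ k ∈ range n, ψ (k + 1) 0 * s ^ k / k.factorial) (Set.Icc (-|t|) |t|) s := by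
      intro s hs
      have h1 := hψ 0 (by lia) s ((abs_le.2 hs).trans ht)
      have h2 : HasDerivAt (fun s : ℝ => ∑ k ∈ range (n + 1), ψ k 0 * s ^ k / k.factorial)
          (∑ k ∈ range (n + 1), ψ k 0 * (k * s ^ (k - 1)) / k.factorial) s :=
        HasDerivAt.fun_sum fun k _ => ((hasDerivAt_pow k s).const_mul _).div_const _
      refine ((h1.sub h2).congr_deriv ?_).hasDerivWithinAt
      rw [sum_range_succ']
      simp only [Nat.cast_zero, zero_mul, mul_zero, zero_div, add_zero, zero_add]
      congr 1
      refine sum_congr rfl fun k _ => ?_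
      rw [Nat.add_sub_cancel, Nat.factorial_succ]
      push_cast
      field_simp
    have hbound : ∀ s ∈ Set.Icc (-|t|) |t|,
        ‖ψ 1 s - ∑ k ∈ range n, ψ (k + 1) 0 * s ^ k / k.factorial‖ ≤ C * |t| ^ n := by
      intro s hs
      have hs' := abs_le.2 hs
      have hC0 : 0 ≤ C := (abs_nonneg _).trans (hC 0 (by simpa using hδ))
      refine (ih' (hs'.trans ht)).trans ?_
      gcongr
    have key := (convex_Icc (-|t|) |t|).norm_image_sub_le_of_norm_hasDerivWithin_le hderiv hbound
      (x := 0) (y := t) ⟨by simp, by simp⟩ (abs_le.1 le_rfl)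
    have hR0 : R 0 = 0 := by
      simp only [hR]
      rw [sum_range_succ']
      simp
    rw [hR0, sub_zero, sub_zero, Real.norm_eq_abs, Real.norm_eq_abs] at key
    calc _ ≤ _ := key
      _ = _ := by ring

section Smooth

variable {U : Set (ℝ × ℝ)} {H : ℝ × ℝ → ℝ}

theorem hasDerivAt_snd_of_contDiffOn (hU : IsOpen U) (hH : ContDiffOn ℝ (⊤ : ℕ∞) H U) {x y : ℝ}
    (hz : (x, y) ∈ U) : HasDerivAt (fun t => H (x, t)) (fderiv ℝ H (x, y) (0, 1)) y := by
  have h1 : HasFDerivAt H (fderiv ℝ H (x, y)) (x, y) :=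
    ((hH.contDiffAt (hU.mem_nhds hz)).differentiableAt (by simp)).hasFDerivAt
  exact h1.comp_hasDerivAt y ((hasDerivAt_const y x).prodMk (hasDerivAt_id' y))

theorem hasDerivAt_fst_of_contDiffOn (hU : IsOpen U) (hH : ContDiffOn ℝ (⊤ : ℕ∞) H U) {x y : ℝ}
    (hz : (x, y) ∈ U) : HasDerivAt (fun s => H (s, y)) (fderiv ℝ H (x, y) (1, 0)) x := by
  have h1 : HasFDerivAt H (fderiv ℝ H (x, y)) (x, y) :=
    ((hH.contDiffAt (hU.mem_nhds hz)).differentiableAt (by simp)).hasFDerivAt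
  exact h1.comp_hasDerivAt x ((hasDerivAt_id' x).prodMk (hasDerivAt_const x y))

theorem contDiffOn_fderiv_apply (hU : IsOpen U) (hH : ContDiffOn ℝ (⊤ : ℕ∞) H U) (v : ℝ × ℝ) :
    ContDiffOn ℝ (⊤ : ℕ∞) (fun z => fderiv ℝ H z v) U :=
  (hH.fderiv_of_isOpen hU (by simp)).clm_apply contDiffOn_const

theorem contDiffOn_iteratedDeriv_snd (hU : IsOpen U) (hH : ContDiffOn ℝ (⊤ : ℕ∞) H U) (j : ℕ) :
    ContDiffOn ℝ (⊤ : ℕ∞) (fun z : ℝ × ℝ => iteratedDeriv j (fun t => H (z.1, t)) z.2) U := by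
  induction j with
  | zero => simpa using hH
  | succ j ih =>
    refine (contDiffOn_fderiv_apply hU ih (0, 1)).congr fun z hz => ?_
    rw [iteratedDeriv_succ]
    exact (hasDerivAt_snd_of_contDiffOn hU ih (x := z.1) (y := z.2) hz).deriv

theorem contDiffOn_iteratedDeriv_fst (hU : IsOpen U) (hH : ContDiffOn ℝ (⊤ : ℕ∞) H U) (i : ℕ) :
    ContDiffOn ℝ (⊤ : ℕ∞) (fun z : ℝ × ℝ => iteratedDeriv i (fun s => H (s, z.2)) z.1) U := by
  induction i with
  | zero => simpa using hH
  | succ i ih =>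
    refine (contDiffOn_fderiv_apply hU ih (1, 0)).congr fun z hz => ?_
    rw [iteratedDeriv_succ]
    exact (hasDerivAt_fst_of_contDiffOn hU ih (x := z.1) (y := z.2) hz).deriv

theorem hasDerivAt_iteratedDeriv_snd (hU : IsOpen U) (hH : ContDiffOn ℝ (⊤ : ℕ∞) H U) (j : ℕ)
    {x y : ℝ} (hz : (x, y) ∈ U) : HasDerivAt (iteratedDeriv j fun t => H (x, t))
      (iteratedDeriv (j + 1) (fun t => H (x, t)) y) y := by
  rw [iteratedDeriv_succ]
  exact (hasDerivAt_snd_of_contDiffOn hU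
    (contDiffOn_iteratedDeriv_snd hU hH j) hz).differentiableAt.hasDerivAt

theorem hasDerivAt_iteratedDeriv_fst (hU : IsOpen U) (hH : ContDiffOn ℝ (⊤ : ℕ∞) H U) (i : ℕ)
    {x y : ℝ} (hz : (x, y) ∈ U) : HasDerivAt (iteratedDeriv i fun s => H (s, y))
      (iteratedDeriv (i + 1) (fun s => H (s, y)) x) x := by
  rw [iteratedDeriv_succ]
  exact (hasDerivAt_fst_of_contDiffOn hU
    (contDiffOn_iteratedDeriv_fst hU hH i) hz).differentiableAt.hasDerivAt

end Smooth

/-- The homogeneous part of degree `k` of the Taylor expansion of `G` at `z`. -/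
def taylorPart (G : ℝ → ℝ → ℝ) (z : ℝ × ℝ) (k : ℕ) (u : ℝ × ℝ) : ℝ :=
  ∑ p ∈ antidiagonal k, partialDeriv p.1 p.2 G z.1 z.2 /
    ((p.1.factorial : ℝ) * p.2.factorial) * (u.1 ^ p.1 * u.2 ^ p.2)

theorem abs_fst_le_norm (u : ℝ × ℝ) : |u.1| ≤ ‖u‖ := norm_fst_le u

theorem abs_snd_le_norm (u : ℝ × ℝ) : |u.2| ≤ ‖u‖ := norm_snd_le u

/-- Taylor's formula in two variables. Expanding in the second variable first and then expanding
the coefficients in the first variable gives the mixed derivatives in the order of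
`partialDeriv`. -/
theorem exists_abs_sub_taylorPart_le {G : ℝ → ℝ → ℝ} {U : Set (ℝ × ℝ)} (hU : IsOpen U)
    (hG : ContDiffOn ℝ (⊤ : ℕ∞) (fun z : ℝ × ℝ => G z.1 z.2) U) {z : ℝ × ℝ} (hz : z ∈ U) (n : ℕ) :
    ∃ C δ, 0 < δ ∧ ∀ u : ℝ × ℝ, ‖u‖ ≤ δ →
      |G (z.1 + u.1) (z.2 + u.2) - ∑ k ∈ range n, taylorPart G z k u| ≤ C * ‖u‖ ^ n := by
  obtain ⟨δ, hδ, hball⟩ := Metric.nhds_basis_closedBall.mem_iff.1 (hU.mem_nhds hz)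
  have hmem : ∀ {s t : ℝ}, |s| ≤ δ → |t| ≤ δ → (z.1 + s, z.2 + t) ∈ U := by
    intro s t hs ht
    refine hball ?_
    rw [mem_closedBall_iff_norm, Prod.norm_def]
    simpa using ⟨hs, ht⟩
  have hmem' : ∀ {s t : ℝ}, |s| ≤ δ → |t| ≤ δ →
      (z.1 + s, z.2 + t) ∈ Metric.closedBall z δ := by
    intro s t hs ht
    rw [mem_closedBall_iff_norm, Prod.norm_def]
    simpa using ⟨hs, ht⟩
  have hcpt : IsCompact (Metric.closedBall z δ) := isCompact_closedBall _ _
  obtain ⟨A, hA⟩ := hcpt.exists_bound_of_continuousOn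
    ((contDiffOn_iteratedDeriv_snd hU hG n).continuousOn.mono hball)
  have hB : ∀ j : ℕ, ∃ B, ∀ w ∈ Metric.closedBall z δ,
      ‖iteratedDeriv (n - j) (fun s => iteratedDeriv j (fun t => G s t) w.2) w.1‖ ≤ B := fun j =>
    hcpt.exists_bound_of_continuousOn ((contDiffOn_iteratedDeriv_fst hU
      (contDiffOn_iteratedDeriv_snd hU hG j) (n - j)).continuousOn.mono hball)
  choose B hB using hB
  have h0δ : |(0 : ℝ)| ≤ δ := by simpa using hδ.le
  refine ⟨A + ∑ j ∈ range n, B j, δ, hδ, fun u hu => ?_⟩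
  have hu1 := (abs_fst_le_norm u).trans hu
  have hu2 := (abs_snd_le_norm u).trans hu
  have hzz : z ∈ Metric.closedBall z δ := Metric.mem_closedBall_self hδ.le
  have hA0 : 0 ≤ A := (norm_nonneg _).trans (hA z hzz)
  have hB0 : ∀ j, 0 ≤ B j := fun j => (norm_nonneg _).trans (hB j z hzz)
  have hy := abs_sub_taylor_sum_le n (δ := δ) (C := A)
    (ψ := fun j t => iteratedDeriv j (fun t => G (z.1 + u.1) t) (z.2 + t))
    (fun k _ t ht => (hasDerivAt_iteratedDeriv_snd hU hG k (hmem hu1 ht)).comp_const_add z.2 t)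
    (fun t ht => hA _ (hmem' hu1 ht)) hu2
  simp only [iteratedDeriv_zero, add_zero] at hy
  have hx : ∀ j ∈ range n, |iteratedDeriv j (fun t => G (z.1 + u.1) t) z.2
      - ∑ i ∈ range (n - j), partialDeriv i j G z.1 z.2 * u.1 ^ i / i.factorial|
      ≤ B j * |u.1| ^ (n - j) := by
    intro j _
    have := abs_sub_taylor_sum_le (n - j) (δ := δ) (C := B j)
      (ψ := fun i s => iteratedDeriv i (fun s => iteratedDeriv j (fun t => G s t) z.2) (z.1 + s))
      (fun k _ s hs => (hasDerivAt_iteratedDeriv_fst hU (contDiffOn_iteratedDeriv_snd hU hG j) k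
        (y := z.2) (by simpa using hmem hs h0δ)).comp_const_add z.1 s)
      (fun s hs => hB j (z.1 + s, z.2) (by simpa using hmem' hs h0δ)) hu1
    simpa only [iteratedDeriv_zero, add_zero, partialDeriv] using this
  have hsum : ∑ k ∈ range n, taylorPart G z k u = ∑ j ∈ range n,
      (∑ i ∈ range (n - j), partialDeriv i j G z.1 z.2 * u.1 ^ i / i.factorial)
        * u.2 ^ j / j.factorial := by
    have h1 : ∀ k, taylorPart G z k u = ∑ j ∈ range (k + 1),
        partialDeriv (k - j) j G z.1 z.2 / (((k - j).factorial : ℝ) * j.factorial) *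
          (u.1 ^ (k - j) * u.2 ^ j) := by
      intro k
      rw [taylorPart, ← Finset.Nat.sum_antidiagonal_swap,
        Finset.Nat.sum_antidiagonal_eq_sum_range_succ_mk]
      rfl
    simp only [h1]
    rw [sum_range_diag_flip n (fun j i => partialDeriv i j G z.1 z.2 /
      ((i.factorial : ℝ) * j.factorial) * (u.1 ^ i * u.2 ^ j))]
    refine sum_congr rfl fun j _ => ?_
    rw [sum_mul, sum_div]
    refine sum_congr rfl fun i _ => ?_
    field_simp
  have hrest : |∑ j ∈ range n, iteratedDeriv j (fun t => G (z.1 + u.1) t) z.2 * u.2 ^ j /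
      j.factorial - ∑ k ∈ range n, taylorPart G z k u| ≤ (∑ j ∈ range n, B j) * ‖u‖ ^ n := by
    rw [hsum, ← sum_sub_distrib, sum_mul]
    refine (abs_sum_le_sum_abs _ _).trans (sum_le_sum fun j hj => ?_)
    rw [← sub_div, ← sub_mul, abs_div, abs_mul, abs_pow, Nat.abs_cast]
    have hj' : n - j + j = n := Nat.sub_add_cancel (mem_range.1 hj).le
    calc _ ≤ |iteratedDeriv j (fun t => G (z.1 + u.1) t) z.2
          - ∑ i ∈ range (n - j), partialDeriv i j G z.1 z.2 * u.1 ^ i / i.factorial|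
            * |u.2| ^ j :=
          div_le_self (by positivity)
            (by exact_mod_cast Nat.one_le_iff_ne_zero.2 (Nat.factorial_ne_zero j))
      _ ≤ (B j * |u.1| ^ (n - j)) * |u.2| ^ j :=
          mul_le_mul_of_nonneg_right (hx j hj) (by positivity)
      _ ≤ (B j * ‖u‖ ^ (n - j)) * ‖u‖ ^ j := by
          have := hB0 j
          have := abs_fst_le_norm u
          have := abs_snd_le_norm u
          gcongr
      _ = B j * ‖u‖ ^ n := by rw [mul_assoc, ← pow_add, hj']
  have hy' : A * |u.2| ^ n ≤ A * ‖u‖ ^ n := by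
    have := abs_snd_le_norm u
    gcongr
  rw [add_mul]
  refine (abs_sub_le _ _ _).trans (add_le_add (hy.trans hy') hrest)

/-! ### Expansions up to fourth order in the scale -/

/-- `x = a₀ + a₁ s + a₂ s² + a₃ s³ + O(s⁴)`, with all coefficients and the constant in the error
term bounded by `T`. Keeping `T` explicit gives expansions which are uniform up to polynomial and
exponential factors in a parameter. -/
structure HasExpansion (s T x a₀ a₁ a₂ a₃ : ℝ) : Prop where
  abs_coeff_zero_le : |a₀| ≤ T
  abs_coeff_one_le : |a₁| ≤ T
  abs_coeff_two_le : |a₂| ≤ T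
  abs_coeff_three_le : |a₃| ≤ T
  abs_sub_le : |x - (a₀ + s * a₁ + s ^ 2 * a₂ + s ^ 3 * a₃)| ≤ T * s ^ 4

namespace HasExpansion

variable {s T T' x y a₀ a₁ a₂ a₃ b₀ b₁ b₂ b₃ : ℝ}

theorem nonneg (h : HasExpansion s T x a₀ a₁ a₂ a₃) : 0 ≤ T :=
  (abs_nonneg _).trans h.abs_coeff_zero_le

theorem mono (h : HasExpansion s T x a₀ a₁ a₂ a₃) (hT : T ≤ T') :
    HasExpansion s T' x a₀ a₁ a₂ a₃ :=
  ⟨h.1.trans hT, h.2.trans hT, h.3.trans hT, h.4.trans hT,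
    h.5.trans (mul_le_mul_of_nonneg_right hT (by positivity))⟩

theorem congr_coeff (h : HasExpansion s T x a₀ a₁ a₂ a₃) (h₀ : a₀ = b₀) (h₁ : a₁ = b₁)
    (h₂ : a₂ = b₂) (h₃ : a₃ = b₃) : HasExpansion s T x b₀ b₁ b₂ b₃ := by
  subst h₀ h₁ h₂ h₃; exact h

theorem add (hx : HasExpansion s T x a₀ a₁ a₂ a₃) (hy : HasExpansion s T' y b₀ b₁ b₂ b₃) :
    HasExpansion s (T + T') (x + y) (a₀ + b₀) (a₁ + b₁) (a₂ + b₂) (a₃ + b₃) := by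
  refine ⟨(abs_add_le _ _).trans (add_le_add hx.1 hy.1), (abs_add_le _ _).trans
    (add_le_add hx.2 hy.2), (abs_add_le _ _).trans (add_le_add hx.3 hy.3),
    (abs_add_le _ _).trans (add_le_add hx.4 hy.4), ?_⟩
  rw [add_mul]
  refine le_trans (le_of_eq ?_) ((abs_add_le _ _).trans (add_le_add hx.5 hy.5))
  congr 1
  ring

theorem const_mul (hx : HasExpansion s T x a₀ a₁ a₂ a₃) (c : ℝ) :
    HasExpansion s (|c| * T) (c * x) (c * a₀) (c * a₁) (c * a₂) (c * a₃) := by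
  have key : ∀ {u B : ℝ}, |u| ≤ B → |c * u| ≤ |c| * B := fun {u B} hu => by
    rw [abs_mul]; exact mul_le_mul_of_nonneg_left hu (abs_nonneg c)
  refine ⟨key hx.1, key hx.2, key hx.3, key hx.4, ?_⟩
  rw [mul_assoc]
  refine le_trans (le_of_eq ?_) (key hx.5)
  congr 1
  ring

theorem abs_poly_le (hx : HasExpansion s T x a₀ a₁ a₂ a₃) (hs : 0 ≤ s) (hs1 : s ≤ 1) :
    |a₀ + s * a₁ + s ^ 2 * a₂ + s ^ 3 * a₃| ≤ 4 * T := by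
  have key : ∀ (k : ℕ) {u : ℝ}, |u| ≤ T → |s ^ k * u| ≤ T := fun k u hu => by
    rw [abs_mul, abs_of_nonneg (pow_nonneg hs k)]
    exact (mul_le_of_le_one_left (abs_nonneg u) (pow_le_one₀ hs hs1)).trans hu
  have h1 := key 1 hx.2
  rw [pow_one] at h1
  calc _ ≤ |a₀| + |s * a₁| + |s ^ 2 * a₂| + |s ^ 3 * a₃| :=
        (abs_add_le _ _).trans (add_le_add ((abs_add_le _ _).trans
          (add_le_add (abs_add_le _ _) le_rfl)) le_rfl)
    _ ≤ _ := by linarith [hx.1, key 2 hx.3, key 3 hx.4]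

theorem mul (hx : HasExpansion s T x a₀ a₁ a₂ a₃) (hy : HasExpansion s T' y b₀ b₁ b₂ b₃)
    (hs : 0 ≤ s) (hs1 : s ≤ 1) :
    HasExpansion s (15 * (T * T')) (x * y) (a₀ * b₀) (a₀ * b₁ + a₁ * b₀)
      (a₀ * b₂ + a₁ * b₁ + a₂ * b₀) (a₀ * b₃ + a₁ * b₂ + a₂ * b₁ + a₃ * b₀) := by
  have hT := hx.nonneg
  have hT' := hy.nonneg
  have hTT : 0 ≤ T * T' := mul_nonneg hT hT'
  have key : ∀ {u v B B' : ℝ}, |u| ≤ B → |v| ≤ B' → |u * v| ≤ B * B' := fun {u v B B'} hu hv => by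
    rw [abs_mul]; exact mul_le_mul hu hv (abs_nonneg _) ((abs_nonneg _).trans hu)
  have hpa := hx.abs_poly_le hs hs1
  have hpb := hy.abs_poly_le hs hs1
  have k00 := key hx.1 hy.1
  have k01 := key hx.1 hy.2
  have k02 := key hx.1 hy.3
  have k03 := key hx.1 hy.4
  have k10 := key hx.2 hy.1
  have k11 := key hx.2 hy.2
  have k12 := key hx.2 hy.3
  have k13 := key hx.2 hy.4
  have k20 := key hx.3 hy.1
  have k21 := key hx.3 hy.2
  have k22 := key hx.3 hy.3
  have k23 := key hx.3 hy.4
  have k30 := key hx.4 hy.1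
  have k31 := key hx.4 hy.2
  have k32 := key hx.4 hy.3
  have k33 := key hx.4 hy.4
  refine ⟨by linarith, ?_, ?_, ?_, ?_⟩
  · rw [abs_le] at *; constructor <;> linarith
  · rw [abs_le] at *; constructor <;> linarith
  · rw [abs_le] at *; constructor <;> linarith
  set pa := a₀ + s * a₁ + s ^ 2 * a₂ + s ^ 3 * a₃ with hpa_def
  set pb := b₀ + s * b₁ + s ^ 2 * b₂ + s ^ 3 * b₃ with hpb_def
  have e1 := key hpa hy.5
  have e2 := key hx.5 hpb
  have e3 := key hx.5 hy.5
  have hs4 : 0 ≤ s ^ 4 := by positivity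
  have hs41 : s ^ 4 ≤ 1 := pow_le_one₀ hs hs1
  have e4 : |a₁ * b₃ + a₂ * b₂ + a₃ * b₁ + s * (a₂ * b₃ + a₃ * b₂) + s ^ 2 * (a₃ * b₃)|
      ≤ 6 * (T * T') := by
    have f1 : |s * (a₂ * b₃ + a₃ * b₂)| ≤ 1 * (T * T' + T * T') :=
      key (by rwa [abs_of_nonneg hs]) ((abs_add_le _ _).trans (add_le_add k23 k32))
    have f2 : |s ^ 2 * (a₃ * b₃)| ≤ 1 * (T * T') :=
      key (by rw [abs_of_nonneg (by positivity)]; exact pow_le_one₀ hs hs1) k33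
    rw [abs_le] at *; constructor <;> linarith
  have e5 : |s ^ 4 * (a₁ * b₃ + a₂ * b₂ + a₃ * b₁ + s * (a₂ * b₃ + a₃ * b₂) + s ^ 2 * (a₃ * b₃))|
      ≤ s ^ 4 * (6 * (T * T')) := key (by rw [abs_of_nonneg hs4]) e4
  have e6 : T * s ^ 4 * (T' * s ^ 4) ≤ T * T' * s ^ 4 := by
    have := mul_le_mul_of_nonneg_left hs41 (mul_nonneg hTT hs4)
    linarith
  have hdecomp : x * y - (a₀ * b₀ + s * (a₀ * b₁ + a₁ * b₀) +
      s ^ 2 * (a₀ * b₂ + a₁ * b₁ + a₂ * b₀) +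
      s ^ 3 * (a₀ * b₃ + a₁ * b₂ + a₂ * b₁ + a₃ * b₀))
      = pa * (y - pb) + (x - pa) * pb + (x - pa) * (y - pb) +
        s ^ 4 * (a₁ * b₃ + a₂ * b₂ + a₃ * b₁ + s * (a₂ * b₃ + a₃ * b₂) + s ^ 2 * (a₃ * b₃)) := by
    rw [hpa_def, hpb_def]; ring
  rw [hdecomp]
  calc _ ≤ |pa * (y - pb)| + |(x - pa) * pb| + |(x - pa) * (y - pb)| + |s ^ 4 *
        (a₁ * b₃ + a₂ * b₂ + a₃ * b₁ + s * (a₂ * b₃ + a₃ * b₂) + s ^ 2 * (a₃ * b₃))| :=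
        (abs_add_le _ _).trans (add_le_add ((abs_add_le _ _).trans
          (add_le_add (abs_add_le _ _) le_rfl)) le_rfl)
    _ ≤ 4 * T * (T' * s ^ 4) + T * s ^ 4 * (4 * T') + T * T' * s ^ 4 + s ^ 4 * (6 * (T * T')) := by
        linarith
    _ = 15 * (T * T') * s ^ 4 := by ring

theorem one : HasExpansion s 1 1 1 0 0 0 :=
  ⟨by simp, by simp, by simp, by simp, by simp; positivity⟩

theorem exp {K : ℝ} (hx : HasExpansion s T x 0 a₁ a₂ a₃) (hs : 0 ≤ s) (hs1 : s ≤ 1)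
    (hT : 1 ≤ T) (hK : |x| ≤ K) :
    HasExpansion s (400 * T ^ 4 * Real.exp K) (Real.exp x) 1 a₁ (a₂ + a₁ ^ 2 / 2)
      (a₃ + a₁ * a₂ + a₁ ^ 3 / 6) := by
  have hT0 : 0 ≤ T := hx.nonneg
  have hK0 : 0 ≤ K := (abs_nonneg _).trans hK
  have hexp : |Real.exp x - (1 + x + x ^ 2 / 2 + x ^ 3 / 6)| ≤ Real.exp K * |x| ^ 4 := by
    have := abs_sub_taylor_sum_le 4 (ψ := fun _ => Real.exp) (δ := |x|) (C := Real.exp K)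
      (fun _ _ t _ => Real.hasDerivAt_exp t)
      (fun t ht => by
        rw [Real.abs_exp]
        exact Real.exp_le_exp.2 ((le_abs_self t).trans (ht.trans hK))) le_rfl
    simpa [sum_range_succ, Nat.factorial] using this
  have hxs : |x| ≤ 4 * T * s := by
    have h2 : |s * a₁| ≤ T * s := by
      rw [abs_mul, abs_of_nonneg hs, mul_comm]; exact mul_le_mul_of_nonneg_right hx.2 hs
    have hp : ∀ k : ℕ, s ^ (k + 1) ≤ s := fun k => by
      rw [pow_succ]; exact mul_le_of_le_one_left hs (pow_le_one₀ hs hs1)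
    have h3 : |s ^ 2 * a₂| ≤ T * s := by
      rw [abs_mul, abs_of_nonneg (by positivity), mul_comm]
      exact mul_le_mul hx.3 (hp 1) (by positivity) hT0
    have h4 : |s ^ 3 * a₃| ≤ T * s := by
      rw [abs_mul, abs_of_nonneg (by positivity), mul_comm]
      exact mul_le_mul hx.4 (hp 2) (by positivity) hT0
    have h5 : T * s ^ 4 ≤ T * s := mul_le_mul_of_nonneg_left (hp 3) hT0
    have h6 := hx.5
    rw [abs_le] at *
    constructor <;> linarith
  have hx4 : |x| ^ 4 ≤ 256 * T ^ 4 * s ^ 4 := by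
    calc |x| ^ 4 ≤ (4 * T * s) ^ 4 := pow_le_pow_left₀ (abs_nonneg _) hxs 4
      _ = _ := by ring
  have hx2 := hx.mul hx hs hs1
  have hx3 := hx2.mul hx hs hs1
  have hpoly := ((one.add hx).add (hx2.const_mul (1 / 2))).add (hx3.const_mul (1 / 6))
  have hr : HasExpansion s (256 * T ^ 4 * Real.exp K)
      (Real.exp x - (1 + x + x ^ 2 / 2 + x ^ 3 / 6)) 0 0 0 0 := by
    have : 0 ≤ 256 * T ^ 4 * Real.exp K := by positivity
    refine ⟨by simpa, by simpa, by simpa, by simpa, ?_⟩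
    simp only [mul_zero, add_zero, sub_zero]
    refine hexp.trans ?_
    calc Real.exp K * |x| ^ 4 ≤ Real.exp K * (256 * T ^ 4 * s ^ 4) := by gcongr
      _ = _ := by ring
  have hsum := hpoly.add hr
  have hval : 1 + x + 1 / 2 * (x * x) + 1 / 6 * (x * x * x) +
      (Real.exp x - (1 + x + x ^ 2 / 2 + x ^ 3 / 6)) = Real.exp x := by ring
  rw [hval] at hsum
  refine (hsum.congr_coeff (by ring) (by ring) (by ring) (by ring)).mono ?_
  have hE : 1 ≤ Real.exp K := Real.one_le_exp hK0
  have t1 : T ^ 4 ≤ T ^ 4 * Real.exp K := le_mul_of_one_le_right (by positivity) hE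
  have t2 : 1 ≤ T ^ 4 := one_le_pow₀ hT
  have t3 : T ≤ T ^ 4 := le_self_pow₀ hT (by norm_num)
  have t4 : T ^ 2 ≤ T ^ 4 := pow_le_pow_right₀ hT (by norm_num)
  have t5 : T ^ 3 ≤ T ^ 4 := pow_le_pow_right₀ hT (by norm_num)
  have a1 : |(1 : ℝ) / 2| = 1 / 2 := by norm_num
  have a2 : |(1 : ℝ) / 6| = 1 / 6 := by norm_num
  rw [a1, a2]
  nlinarith

end HasExpansion

/-! ### Homogeneous parts and Gaussian integrability -/

theorem taylorPart_smul (G : ℝ → ℝ → ℝ) (z : ℝ × ℝ) (k : ℕ) (s : ℝ) (v : ℝ × ℝ) :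
    taylorPart G z k (s • v) = s ^ k * taylorPart G z k v := by
  rw [taylorPart, taylorPart, mul_sum]
  refine sum_congr rfl fun p hp => ?_
  rw [← mem_antidiagonal.1 hp, pow_add, Prod.smul_fst, Prod.smul_snd, smul_eq_mul, smul_eq_mul,
    mul_pow, mul_pow]
  ring

theorem taylorPart_neg (G : ℝ → ℝ → ℝ) (z : ℝ × ℝ) (k : ℕ) (v : ℝ × ℝ) :
    taylorPart G z k (-v) = (-1) ^ k * taylorPart G z k v := by
  rw [← taylorPart_smul, neg_one_smul]

theorem continuous_taylorPart (G : ℝ → ℝ → ℝ) (z : ℝ × ℝ) (k : ℕ) :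
    Continuous (taylorPart G z k) := by
  unfold taylorPart; fun_prop

theorem exists_abs_taylorPart_le (G : ℝ → ℝ → ℝ) (z : ℝ × ℝ) (n : ℕ) :
    ∃ C, 0 ≤ C ∧ ∀ k ≤ n, ∀ v, |taylorPart G z k v| ≤ C * (1 + ‖v‖) ^ n := by
  refine ⟨∑ k ∈ range (n + 1), ∑ p ∈ antidiagonal k, |partialDeriv p.1 p.2 G z.1 z.2 /
    ((p.1.factorial : ℝ) * p.2.factorial)|, by positivity, fun k hk v => ?_⟩
  have h1 : |taylorPart G z k v| ≤ (∑ p ∈ antidiagonal k, |partialDeriv p.1 p.2 G z.1 z.2 /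
      ((p.1.factorial : ℝ) * p.2.factorial)|) * (1 + ‖v‖) ^ n := by
    rw [taylorPart, sum_mul]
    refine (abs_sum_le_sum_abs _ _).trans (sum_le_sum fun p hp => ?_)
    rw [abs_mul, abs_mul, abs_pow, abs_pow]
    refine mul_le_mul_of_nonneg_left ?_ (abs_nonneg _)
    have hv := norm_nonneg v
    have h1 : |v.1| ≤ 1 + ‖v‖ := (abs_fst_le_norm v).trans (by linarith)
    have h2 : |v.2| ≤ 1 + ‖v‖ := (abs_snd_le_norm v).trans (by linarith)
    calc |v.1| ^ p.1 * |v.2| ^ p.2 ≤ (1 + ‖v‖) ^ p.1 * (1 + ‖v‖) ^ p.2 := by gcongr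
      _ = (1 + ‖v‖) ^ k := by rw [← pow_add, mem_antidiagonal.1 hp]
      _ ≤ (1 + ‖v‖) ^ n := pow_le_pow_right₀ (by linarith) hk
  refine h1.trans (mul_le_mul_of_nonneg_right ?_ (by positivity))
  exact single_le_sum (f := fun k => ∑ p ∈ antidiagonal k, |partialDeriv p.1 p.2 G z.1 z.2 /
    ((p.1.factorial : ℝ) * p.2.factorial)|) (fun _ _ => by positivity)
    (mem_range.2 (by lia))

theorem integrable_one_add_norm_pow_mul_exp (K : ℕ) {c : ℝ} (hc : 0 < c) :
    Integrable fun v : ℝ × ℝ => (1 + ‖v‖) ^ K * Real.exp (-c * ‖v‖ ^ 2) := by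
  have hprod : Integrable fun v : ℝ × ℝ =>
      (K.factorial * Real.exp (1 + 1 / (2 * c))) *
        (Real.exp (-(c / 4) * v.1 ^ 2) * Real.exp (-(c / 4) * v.2 ^ 2)) :=
    ((integrable_exp_neg_mul_sq (by positivity)).mul_prod
      (integrable_exp_neg_mul_sq (by positivity))).const_mul _
  refine hprod.mono' (by fun_prop) (Eventually.of_forall fun v => ?_)
  rw [Real.norm_of_nonneg (by positivity)]
  have hr : 0 ≤ ‖v‖ := norm_nonneg v
  have h1 : (1 + ‖v‖) ^ K ≤ K.factorial * Real.exp (1 + ‖v‖) := by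
    have := Real.pow_div_factorial_le_exp (1 + ‖v‖) (by positivity) K
    rwa [div_le_iff₀ (by positivity), mul_comm] at this
  have h2 : v.1 ^ 2 + v.2 ^ 2 ≤ 2 * ‖v‖ ^ 2 := by
    have h3 := pow_le_pow_left₀ (abs_nonneg _) (abs_fst_le_norm v) 2
    have h4 := pow_le_pow_left₀ (abs_nonneg _) (abs_snd_le_norm v) 2
    rw [sq_abs] at h3 h4
    linarith
  have h3 : ‖v‖ ≤ c / 2 * ‖v‖ ^ 2 + 1 / (2 * c) := by
    have : 0 ≤ c / 2 * (‖v‖ - 1 / c) ^ 2 := by positivity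
    have h : c / 2 * (‖v‖ - 1 / c) ^ 2 = c / 2 * ‖v‖ ^ 2 + 1 / (2 * c) - ‖v‖ := by
      field_simp
      ring
    linarith
  calc (1 + ‖v‖) ^ K * Real.exp (-c * ‖v‖ ^ 2)
      ≤ K.factorial * Real.exp (1 + ‖v‖) * Real.exp (-c * ‖v‖ ^ 2) := by gcongr
    _ = K.factorial * Real.exp (1 + ‖v‖ + -c * ‖v‖ ^ 2) := by rw [Real.exp_add (1 + ‖v‖)]; ring
    _ ≤ K.factorial * Real.exp (1 + 1 / (2 * c) + (-(c / 4) * v.1 ^ 2 + -(c / 4) * v.2 ^ 2)) := by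
        refine mul_le_mul_of_nonneg_left (Real.exp_le_exp.2 ?_) (by positivity)
        nlinarith
    _ = _ := by
        rw [Real.exp_add (1 + 1 / (2 * c)), Real.exp_add (-(c / 4) * v.1 ^ 2)]; ring

theorem integrable_exp_mul_of_abs_le {q φ : ℝ × ℝ → ℝ} {κ C : ℝ} {K : ℕ} (hκ : 0 < κ)
    (hq : Continuous q) (hqκ : ∀ v, q v ≤ -κ * ‖v‖ ^ 2) (hφ : Continuous φ)
    (hφC : ∀ v, |φ v| ≤ C * (1 + ‖v‖) ^ K) : Integrable fun v => Real.exp (q v) * φ v := by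
  refine ((integrable_one_add_norm_pow_mul_exp K hκ).const_mul C).mono' (by fun_prop)
    (Eventually.of_forall fun v => ?_)
  rw [Real.norm_eq_abs, abs_mul, Real.abs_exp]
  calc Real.exp (q v) * |φ v| ≤ Real.exp (-κ * ‖v‖ ^ 2) * (C * (1 + ‖v‖) ^ K) :=
        mul_le_mul (Real.exp_le_exp.2 (hqκ v)) (hφC v) (abs_nonneg _) (Real.exp_pos _).le
    _ = _ := by ring

/-! ### Laplace's method in the plane -/

/-- The coefficient of `s ^ i`, for `i ≤ 3`, in the expansion of
`s ^ (-p) G (z + s v) exp (∑ k ≥ 3, s ^ (k - 2) Φ_k v)`, where `Φ_k` is the homogeneous Taylor part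
of degree `k` of `Φ`, and `G` vanishes to order `p` at `z`. -/
def laplaceCoeff (Φ G : ℝ → ℝ → ℝ) (z : ℝ × ℝ) (p : ℕ) (i : ℕ) (v : ℝ × ℝ) : ℝ :=
  match i with
  | 0 => taylorPart G z p v
  | 1 => taylorPart G z (p + 1) v + taylorPart Φ z 3 v * taylorPart G z p v
  | 2 => taylorPart G z (p + 2) v + taylorPart Φ z 3 v * taylorPart G z (p + 1) v
      + (taylorPart Φ z 4 v + taylorPart Φ z 3 v ^ 2 / 2) * taylorPart G z p v
  | 3 => taylorPart G z (p + 3) v + taylorPart Φ z 3 v * taylorPart G z (p + 2) v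
      + (taylorPart Φ z 4 v + taylorPart Φ z 3 v ^ 2 / 2) * taylorPart G z (p + 1) v
      + (taylorPart Φ z 5 v + taylorPart Φ z 3 v * taylorPart Φ z 4 v
          + taylorPart Φ z 3 v ^ 3 / 6) * taylorPart G z p v
  | _ => 0

theorem continuous_laplaceCoeff (Φ G : ℝ → ℝ → ℝ) (z : ℝ × ℝ) (p i : ℕ) :
    Continuous (laplaceCoeff Φ G z p i) := by
  have hΦ := continuous_taylorPart Φ z
  have hG := continuous_taylorPart G z
  unfold laplaceCoeff
  rcases i with _ | _ | _ | _ | i <;> fun_prop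

theorem laplaceCoeff_neg (Φ G : ℝ → ℝ → ℝ) (z : ℝ × ℝ) {p i : ℕ} (hp : Even p) (hi : Odd i)
    (v : ℝ × ℝ) : laplaceCoeff Φ G z p i (-v) = -laplaceCoeff Φ G z p i v := by
  rcases i with _ | _ | _ | _ | i
  · simp at hi
  · simp only [laplaceCoeff, taylorPart_neg, pow_add, hp.neg_one_pow]; ring
  · exact absurd hi (by decide)
  · simp only [laplaceCoeff, taylorPart_neg, pow_add, hp.neg_one_pow]; ring
  · simp [laplaceCoeff]

/-- The setting of Laplace's method: near `z` the phase function `Φ` and the amplitude `G` are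
smooth, `z` is a nondegenerate critical point of `Φ`, and `G` vanishes to order `p` there. -/
structure LaplaceData (Φ G : ℝ → ℝ → ℝ) (U : Set (ℝ × ℝ)) (z : ℝ × ℝ) (κ : ℝ) (p : ℕ) : Prop where
  isOpen : IsOpen U
  mem : z ∈ U
  smooth_phase : ContDiffOn ℝ (⊤ : ℕ∞) (fun w : ℝ × ℝ => Φ w.1 w.2) U
  smooth_amplitude : ContDiffOn ℝ (⊤ : ℕ∞) (fun w : ℝ × ℝ => G w.1 w.2) U
  pos : 0 < κ
  critical : ∀ v, taylorPart Φ z 1 v = 0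
  hessian : ∀ v, taylorPart Φ z 2 v ≤ -κ * ‖v‖ ^ 2
  vanish : ∀ k < p, ∀ v, taylorPart G z k v = 0

theorem taylorPart_zero (G : ℝ → ℝ → ℝ) (z v : ℝ × ℝ) : taylorPart G z 0 v = G z.1 z.2 := by
  simp [taylorPart, partialDeriv]

namespace LaplaceData

variable {Φ G : ℝ → ℝ → ℝ} {U : Set (ℝ × ℝ)} {z : ℝ × ℝ} {κ : ℝ} {p : ℕ}

/-- The rescaled integrand, divided by its Gaussian factor, has an expansion in the scale `s`,
uniformly in `v` up to a factor which is dominated by the Gaussian. -/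
theorem exists_hasExpansion (h : LaplaceData Φ G U z κ p) :
    ∃ δ > 0, (∀ u : ℝ × ℝ, ‖u‖ ≤ δ → z + u ∈ U) ∧ ∃ C ≥ 0, ∃ K : ℕ,
      ∀ s : ℝ, 0 < s → s ≤ 1 → ∀ v : ℝ × ℝ, s * ‖v‖ ≤ δ →
        HasExpansion s (C * (1 + ‖v‖) ^ K * Real.exp (κ / 2 * ‖v‖ ^ 2))
          (Real.exp ((Φ (z.1 + s * v.1) (z.2 + s * v.2) - Φ z.1 z.2) / s ^ 2 - taylorPart Φ z 2 v)
            * (G (z.1 + s * v.1) (z.2 + s * v.2) / s ^ p))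
          (laplaceCoeff Φ G z p 0 v) (laplaceCoeff Φ G z p 1 v) (laplaceCoeff Φ G z p 2 v)
          (laplaceCoeff Φ G z p 3 v) := by
  obtain ⟨C₁, δ₁, hδ₁, hC₁⟩ := exists_abs_sub_taylorPart_le h.isOpen h.smooth_phase h.mem 6
  obtain ⟨C₂, δ₂, hδ₂, hC₂⟩ := exists_abs_sub_taylorPart_le h.isOpen h.smooth_phase h.mem 3
  obtain ⟨C₃, δ₃, hδ₃, hC₃⟩ :=
    exists_abs_sub_taylorPart_le h.isOpen h.smooth_amplitude h.mem (p + 4)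
  obtain ⟨δ₄, hδ₄, hball⟩ := Metric.nhds_basis_closedBall.mem_iff.1 (h.isOpen.mem_nhds h.mem)
  obtain ⟨B₁, hB₁0, hB₁⟩ := exists_abs_taylorPart_le Φ z 6
  obtain ⟨B₂, hB₂0, hB₂⟩ := exists_abs_taylorPart_le G z (p + 4)
  have hκ := h.pos
  have hκ' : 0 < κ / (2 * (|C₂| + 1)) := by positivity
  obtain ⟨δ, hδ, d1, d2, d3, d4, d5⟩ : ∃ δ > 0, δ ≤ δ₁ ∧ δ ≤ δ₂ ∧ δ ≤ δ₃ ∧ δ ≤ δ₄ ∧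
      δ ≤ κ / (2 * (|C₂| + 1)) :=
    ⟨min (min δ₁ δ₂) (min (min δ₃ δ₄) (κ / (2 * (|C₂| + 1)))),
      lt_min (lt_min hδ₁ hδ₂) (lt_min (lt_min hδ₃ hδ₄) hκ'),
      (min_le_left _ _).trans (min_le_left _ _), (min_le_left _ _).trans (min_le_right _ _),
      (min_le_right _ _).trans ((min_le_left _ _).trans (min_le_left _ _)),
      (min_le_right _ _).trans ((min_le_left _ _).trans (min_le_right _ _)),
      (min_le_right _ _).trans (min_le_right _ _)⟩
  refine ⟨δ, hδ, fun u hu => hball ?_, 15 * (400 * (1 + |C₁| + B₁) ^ 4 * (|C₃| + B₂)),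
    by positivity, 24 + (p + 4), fun s hs hs1 v hv => ?_⟩
  · rw [mem_closedBall_iff_norm]
    simpa using hu.trans d4
  have hr : 0 ≤ ‖v‖ := norm_nonneg v
  have hr1 : 1 ≤ 1 + ‖v‖ := by linarith
  have hsv : ‖s • v‖ = s * ‖v‖ := by rw [norm_smul, Real.norm_of_nonneg hs.le]
  have e₁ := hC₁ (s • v) (by rw [hsv]; exact hv.trans d1)
  have e₂ := hC₂ (s • v) (by rw [hsv]; exact hv.trans d2)
  have e₃ := hC₃ (s • v) (by rw [hsv]; exact hv.trans d3)
  simp only [hsv, taylorPart_smul, Prod.smul_fst, Prod.smul_snd, smul_eq_mul] at e₁ e₂ e₃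
  generalize Φ (z.1 + s * v.1) (z.2 + s * v.2) = Φs at *
  generalize G (z.1 + s * v.1) (z.2 + s * v.2) = Gs at *
  have hs0 : s ≠ 0 := hs.ne'
  have hA : HasExpansion s ((1 + |C₁| + B₁) * (1 + ‖v‖) ^ 6)
      ((Φs - Φ z.1 z.2) / s ^ 2 - taylorPart Φ z 2 v) 0 (taylorPart Φ z 3 v)
      (taylorPart Φ z 4 v) (taylorPart Φ z 5 v) := by
    have hpow : 0 ≤ (1 + ‖v‖) ^ 6 := by positivity
    have hB : ∀ k ≤ 6, |taylorPart Φ z k v| ≤ (1 + |C₁| + B₁) * (1 + ‖v‖) ^ 6 := fun k hk =>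
      (hB₁ k hk v).trans (mul_le_mul_of_nonneg_right
        (by linarith [abs_nonneg C₁]) hpow)
    refine ⟨by rw [abs_zero]; positivity, hB 3 (by norm_num), hB 4 (by norm_num),
      hB 5 (by norm_num), ?_⟩
    simp only [sum_range_succ, range_zero, sum_empty, taylorPart_zero, h.critical] at e₁
    have heq : (Φs - Φ z.1 z.2) / s ^ 2 - taylorPart Φ z 2 v - (0 + s * taylorPart Φ z 3 v +
        s ^ 2 * taylorPart Φ z 4 v + s ^ 3 * taylorPart Φ z 5 v)
        = (Φs - (0 + s ^ 0 * Φ z.1 z.2 + s ^ 1 * 0 + s ^ 2 * taylorPart Φ z 2 v +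
          s ^ 3 * taylorPart Φ z 3 v + s ^ 4 * taylorPart Φ z 4 v + s ^ 5 * taylorPart Φ z 5 v))
          / s ^ 2 := by
      field_simp
      ring
    rw [heq, abs_div, abs_of_pos (by positivity : 0 < s ^ 2), div_le_iff₀ (by positivity)]
    refine e₁.trans ?_
    have h1 : ‖v‖ ^ 6 ≤ (1 + ‖v‖) ^ 6 := pow_le_pow_left₀ hr (by linarith) 6
    calc C₁ * (s * ‖v‖) ^ 6 ≤ (1 + |C₁| + B₁) * (s * ‖v‖) ^ 6 :=
          mul_le_mul_of_nonneg_right (by linarith [le_abs_self C₁]) (by positivity)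
      _ = (1 + |C₁| + B₁) * ‖v‖ ^ 6 * s ^ 6 := by ring
      _ ≤ (1 + |C₁| + B₁) * (1 + ‖v‖) ^ 6 * s ^ 6 := by gcongr
      _ = _ := by ring
  have hAK : |(Φs - Φ z.1 z.2) / s ^ 2 - taylorPart Φ z 2 v| ≤ κ / 2 * ‖v‖ ^ 2 := by
    simp only [sum_range_succ, range_zero, sum_empty, taylorPart_zero, h.critical] at e₂
    have heq : (Φs - Φ z.1 z.2) / s ^ 2 - taylorPart Φ z 2 v
        = (Φs - (0 + s ^ 0 * Φ z.1 z.2 + s ^ 1 * 0 + s ^ 2 * taylorPart Φ z 2 v)) / s ^ 2 := by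
      field_simp
      ring
    rw [heq, abs_div, abs_of_pos (by positivity : 0 < s ^ 2), div_le_iff₀ (by positivity)]
    refine e₂.trans ?_
    have h1 : (|C₂| + 1) * (s * ‖v‖) ≤ κ / 2 := by
      have := hv.trans d5
      rw [le_div_iff₀ (by positivity)] at this
      linarith
    calc C₂ * (s * ‖v‖) ^ 3 ≤ (|C₂| + 1) * (s * ‖v‖) ^ 3 :=
          mul_le_mul_of_nonneg_right (by linarith [le_abs_self C₂]) (by positivity)
      _ = (|C₂| + 1) * (s * ‖v‖) * (‖v‖ ^ 2 * s ^ 2) := by ring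
      _ ≤ κ / 2 * (‖v‖ ^ 2 * s ^ 2) := mul_le_mul_of_nonneg_right h1 (by positivity)
      _ = _ := by ring
  have hH : HasExpansion s ((|C₃| + B₂) * (1 + ‖v‖) ^ (p + 4)) (Gs / s ^ p)
      (taylorPart G z p v) (taylorPart G z (p + 1) v) (taylorPart G z (p + 2) v)
      (taylorPart G z (p + 3) v) := by
    have hpow : 0 ≤ (1 + ‖v‖) ^ (p + 4) := by positivity
    have hB : ∀ k ≤ p + 4, |taylorPart G z k v| ≤ (|C₃| + B₂) * (1 + ‖v‖) ^ (p + 4) := fun k hk =>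
      (hB₂ k hk v).trans (mul_le_mul_of_nonneg_right (by linarith [abs_nonneg C₃]) hpow)
    refine ⟨hB _ (by omega), hB _ (by omega), hB _ (by omega), hB _ (by omega), ?_⟩
    have hvan : ∑ k ∈ range p, s ^ k * taylorPart G z k v = 0 :=
      sum_eq_zero fun k hk => by rw [h.vanish k (mem_range.1 hk), mul_zero]
    rw [sum_range_succ, sum_range_succ, sum_range_succ, sum_range_succ, hvan] at e₃
    have heq : Gs / s ^ p - (taylorPart G z p v + s * taylorPart G z (p + 1) v +
        s ^ 2 * taylorPart G z (p + 2) v + s ^ 3 * taylorPart G z (p + 3) v)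
        = (Gs - (0 + s ^ p * taylorPart G z p v + s ^ (p + 1) * taylorPart G z (p + 1) v +
          s ^ (p + 2) * taylorPart G z (p + 2) v + s ^ (p + 3) * taylorPart G z (p + 3) v))
          / s ^ p := by
      field_simp
      ring
    rw [heq, abs_div, abs_of_pos (by positivity : 0 < s ^ p), div_le_iff₀ (by positivity)]
    refine e₃.trans ?_
    have h1 : ‖v‖ ^ (p + 4) ≤ (1 + ‖v‖) ^ (p + 4) := pow_le_pow_left₀ hr (by linarith) _
    calc C₃ * (s * ‖v‖) ^ (p + 4) ≤ (|C₃| + B₂) * (s * ‖v‖) ^ (p + 4) :=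
          mul_le_mul_of_nonneg_right (by linarith [le_abs_self C₃]) (by positivity)
      _ = (|C₃| + B₂) * ‖v‖ ^ (p + 4) * s ^ (p + 4) := by rw [mul_pow]; ring
      _ ≤ (|C₃| + B₂) * (1 + ‖v‖) ^ (p + 4) * s ^ (p + 4) := by gcongr
      _ = _ := by rw [pow_add s]; ring
  have hT1 : 1 ≤ (1 + |C₁| + B₁) * (1 + ‖v‖) ^ 6 :=
    one_le_mul_of_one_le_of_one_le (by linarith [abs_nonneg C₁]) (one_le_pow₀ hr1)
  refine (((hA.exp hs.le hs1 hT1 hAK).mul hH hs.le hs1).congr_coeff ?_ ?_ ?_ ?_).mono (le_of_eq ?_)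
  · simp only [laplaceCoeff, one_mul]
  · simp only [laplaceCoeff, one_mul]
  · simp only [laplaceCoeff, one_mul]
  · simp only [laplaceCoeff, one_mul]
  · generalize 1 + ‖v‖ = R
    generalize 1 + |C₁| + B₁ = B
    ring

/-- Gaussian domination of the rescaled integrand's expansion coefficients. -/
theorem exists_abs_exp_mul_laplaceCoeff_le (h : LaplaceData Φ G U z κ p) :
    ∃ C ≥ 0, ∃ K : ℕ, ∀ i ≤ 3, ∀ v, |Real.exp (taylorPart Φ z 2 v) * laplaceCoeff Φ G z p i v|
      ≤ C * (1 + ‖v‖) ^ K * Real.exp (-(κ / 2) * ‖v‖ ^ 2) := by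
  obtain ⟨δ, hδ, -, C, hC, K, hexp⟩ := h.exists_hasExpansion
  refine ⟨C, hC, K, fun i hi v => ?_⟩
  have hr := norm_nonneg v
  have hs : 0 < min 1 (δ / (1 + ‖v‖)) := by positivity
  have hsv : min 1 (δ / (1 + ‖v‖)) * ‖v‖ ≤ δ := by
    calc _ ≤ δ / (1 + ‖v‖) * (1 + ‖v‖) :=
          mul_le_mul (min_le_right _ _) (by linarith) hr (by positivity)
      _ = δ := by field_simp
  have hE := hexp _ hs (min_le_left _ _) v hsv
  have hi' : |laplaceCoeff Φ G z p i v| ≤ C * (1 + ‖v‖) ^ K * Real.exp (κ / 2 * ‖v‖ ^ 2) := by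
    interval_cases i
    exacts [hE.1, hE.2, hE.3, hE.4]
  rw [abs_mul, Real.abs_exp]
  calc _ ≤ Real.exp (-κ * ‖v‖ ^ 2) * (C * (1 + ‖v‖) ^ K * Real.exp (κ / 2 * ‖v‖ ^ 2)) :=
        mul_le_mul (Real.exp_le_exp.2 (h.hessian v)) hi' (abs_nonneg _) (Real.exp_pos _).le
    _ = C * (1 + ‖v‖) ^ K * (Real.exp (-κ * ‖v‖ ^ 2) * Real.exp (κ / 2 * ‖v‖ ^ 2)) := by ring
    _ = _ := by rw [← Real.exp_add]; congr 2; ring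

theorem integrable_exp_mul_laplaceCoeff (h : LaplaceData Φ G U z κ p) {i : ℕ} (hi : i ≤ 3) :
    Integrable fun v => Real.exp (taylorPart Φ z 2 v) * laplaceCoeff Φ G z p i v := by
  obtain ⟨C, _, K, hCK⟩ := h.exists_abs_exp_mul_laplaceCoeff_le
  have hκ := h.pos
  refine ((integrable_one_add_norm_pow_mul_exp K (half_pos hκ)).const_mul C).mono'
    ((Real.continuous_exp.comp (continuous_taylorPart Φ z 2)).mul
      (continuous_laplaceCoeff Φ G z p i)).aestronglyMeasurable
    (Eventually.of_forall fun v => ?_)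
  rw [Real.norm_eq_abs, ← mul_assoc]
  exact hCK i hi v

theorem integral_exp_mul_laplaceCoeff_of_odd (Φ G : ℝ → ℝ → ℝ) (z : ℝ × ℝ) {p i : ℕ}
    (hp : Even p) (hi : Odd i) :
    ∫ v, Real.exp (taylorPart Φ z 2 v) * laplaceCoeff Φ G z p i v = 0 := by
  have h1 := integral_neg_eq_self
    (fun v => Real.exp (taylorPart Φ z 2 v) * laplaceCoeff Φ G z p i v) volume
  simp only [laplaceCoeff_neg Φ G z hp hi, taylorPart_neg, mul_neg, integral_neg] at h1
  norm_num at h1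
  linarith

/-- Pointwise comparison of the rescaled integrand with its Gaussian expansion, on the whole plane.
Far from `z` the integrand is exponentially small by the gap, and the expansion is small since
`1 ≤ (s ‖v‖ / δ) ^ 4` there. -/
theorem exists_pointwise_bound (h : LaplaceData Φ G U z κ p) {W P : ℝ × ℝ → ℝ}
    (hW : ∀ w ∈ U, W w = Real.exp (Φ w.1 w.2))
    (hP : ∀ w ∈ U, P w = Real.exp (2 * Φ w.1 w.2) * G w.1 w.2)
    (hgap : ∀ δ > 0, ∃ ρ, 0 ≤ ρ ∧ ρ < 1 ∧
      ∀ w, δ ≤ ‖w - z‖ → |W w| ≤ ρ * Real.exp (Φ z.1 z.2)) :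
    ∃ C ≥ 0, ∃ K : ℕ, ∃ ρ, 0 ≤ ρ ∧ ρ < 1 ∧ ∀ (n : ℕ) (s : ℝ), 0 < s → s ^ 2 * (n + 2) = 1 →
      ∀ v, |Real.exp (-(n + 2) * Φ z.1 z.2) * (W (z + s • v) ^ n * P (z + s • v))
        - s ^ p * (Real.exp (taylorPart Φ z 2 v) * laplaceCoeff Φ G z p 0 v
          + s * (Real.exp (taylorPart Φ z 2 v) * laplaceCoeff Φ G z p 1 v)
          + s ^ 2 * (Real.exp (taylorPart Φ z 2 v) * laplaceCoeff Φ G z p 2 v)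
          + s ^ 3 * (Real.exp (taylorPart Φ z 2 v) * laplaceCoeff Φ G z p 3 v))|
      ≤ s ^ (p + 4) * (C * ((1 + ‖v‖) ^ K * Real.exp (-(κ / 2) * ‖v‖ ^ 2)))
        + ρ ^ n * Real.exp (-2 * Φ z.1 z.2) * |P (z + s • v)| := by
  obtain ⟨δ, hδ, hball, C, hC, K, hexp⟩ := h.exists_hasExpansion
  obtain ⟨C', hC', K', hcoef⟩ := h.exists_abs_exp_mul_laplaceCoeff_le
  obtain ⟨ρ, hρ0, hρ1, hρ⟩ := hgap δ hδ
  refine ⟨C + 4 * C' / δ ^ 4, by positivity, K + (K' + 4), ρ, hρ0, hρ1,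
    fun n s hs hsn v => ?_⟩
  have hr := norm_nonneg v
  have hr1 : 1 ≤ 1 + ‖v‖ := by linarith
  have hs1 : s ≤ 1 := by
    have hn : (0 : ℝ) ≤ n := Nat.cast_nonneg n
    have : s ^ 2 ≤ 1 := by nlinarith [sq_nonneg s]
    exact (sq_le_one_iff₀ hs.le).1 this
  have hn2 : ((n : ℝ) + 2) = 1 / s ^ 2 := by
    rw [eq_div_iff (by positivity)]; linarith
  have hsv : ‖s • v‖ = s * ‖v‖ := by rw [norm_smul, Real.norm_of_nonneg hs.le]
  have hP0 : 0 ≤ ρ ^ n * Real.exp (-2 * Φ z.1 z.2) * |P (z + s • v)| := by positivity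
  rcases le_or_gt (s * ‖v‖) δ with hle | hgt
  · have hU : z + s • v ∈ U := hball _ (hsv ▸ hle)
    have hE := hexp s hs hs1 v hle
    set Φs := Φ (z.1 + s * v.1) (z.2 + s * v.2) with hΦs
    set Gs := G (z.1 + s * v.1) (z.2 + s * v.2) with hGs
    set q := taylorPart Φ z 2 v with hq
    have hint : Real.exp (-(n + 2) * Φ z.1 z.2) * (W (z + s • v) ^ n * P (z + s • v))
        = s ^ p * (Real.exp q * (Real.exp ((Φs - Φ z.1 z.2) / s ^ 2 - q) * (Gs / s ^ p))) := by
      have h1 : Real.exp (-(n + 2) * Φ z.1 z.2) * (Real.exp Φs ^ n * Real.exp (2 * Φs))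
          = Real.exp q * Real.exp ((Φs - Φ z.1 z.2) / s ^ 2 - q) := by
        rw [← Real.exp_nat_mul, ← Real.exp_add, ← Real.exp_add, ← Real.exp_add]
        congr 1
        rw [div_eq_mul_one_div, ← hn2]
        ring
      rw [hW _ hU, hP _ hU]
      simp only [Prod.fst_add, Prod.snd_add, Prod.smul_fst, Prod.smul_snd, smul_eq_mul,
        ← hΦs, ← hGs]
      have h2 : s ^ p * (Gs / s ^ p) = Gs := by field_simp
      linear_combination Gs * h1 - (Real.exp q * Real.exp ((Φs - Φ z.1 z.2) / s ^ 2 - q)) * h2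
    have heq : ∀ X : ℝ, s ^ p * (Real.exp q * X)
        - s ^ p * (Real.exp q * laplaceCoeff Φ G z p 0 v
          + s * (Real.exp q * laplaceCoeff Φ G z p 1 v)
          + s ^ 2 * (Real.exp q * laplaceCoeff Φ G z p 2 v)
          + s ^ 3 * (Real.exp q * laplaceCoeff Φ G z p 3 v))
        = s ^ p * (Real.exp q * (X - (laplaceCoeff Φ G z p 0 v + s * laplaceCoeff Φ G z p 1 v +
          s ^ 2 * laplaceCoeff Φ G z p 2 v + s ^ 3 * laplaceCoeff Φ G z p 3 v))) := fun X => by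
      ring
    rw [hint, heq, abs_mul, abs_mul, Real.abs_exp, abs_of_pos (by positivity : 0 < s ^ p)]
    refine le_trans ?_ (le_add_of_nonneg_right hP0)
    have hexpq : Real.exp q * Real.exp (κ / 2 * ‖v‖ ^ 2) ≤ Real.exp (-(κ / 2) * ‖v‖ ^ 2) := by
      rw [← Real.exp_add]
      apply Real.exp_le_exp.2
      have := h.hessian v
      linarith
    calc _ ≤ s ^ p * (Real.exp q * (C * (1 + ‖v‖) ^ K * Real.exp (κ / 2 * ‖v‖ ^ 2) * s ^ 4)) := by
          have := hE.abs_sub_le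
          gcongr
      _ = s ^ (p + 4) * (C * ((1 + ‖v‖) ^ K *
            (Real.exp q * Real.exp (κ / 2 * ‖v‖ ^ 2)))) := by ring
      _ ≤ s ^ (p + 4) * ((C + 4 * C' / δ ^ 4) * ((1 + ‖v‖) ^ (K + (K' + 4)) *
            Real.exp (-(κ / 2) * ‖v‖ ^ 2))) := by
          have h1 : C ≤ C + 4 * C' / δ ^ 4 := le_add_of_nonneg_right (by positivity)
          have h2 : (1 + ‖v‖) ^ K ≤ (1 + ‖v‖) ^ (K + (K' + 4)) :=
            pow_le_pow_right₀ hr1 (by omega)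
          gcongr
  · have hΘ : |Real.exp (-(n + 2) * Φ z.1 z.2) * (W (z + s • v) ^ n * P (z + s • v))|
        ≤ ρ ^ n * Real.exp (-2 * Φ z.1 z.2) * |P (z + s • v)| := by
      rw [abs_mul, abs_mul, Real.abs_exp, abs_pow]
      have h1 := hρ (z + s • v) (by rw [add_sub_cancel_left, hsv]; exact hgt.le)
      calc _ ≤ Real.exp (-(n + 2) * Φ z.1 z.2) *
            ((ρ * Real.exp (Φ z.1 z.2)) ^ n * |P (z + s • v)|) := by gcongr
        _ = ρ ^ n * (Real.exp (-(n + 2) * Φ z.1 z.2) * Real.exp (Φ z.1 z.2) ^ n) *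
            |P (z + s • v)| := by rw [mul_pow]; ring
        _ = _ := by
            rw [← Real.exp_nat_mul, ← Real.exp_add]
            congr 3
            ring
    have hpoly : |s ^ p * (Real.exp (taylorPart Φ z 2 v) * laplaceCoeff Φ G z p 0 v
          + s * (Real.exp (taylorPart Φ z 2 v) * laplaceCoeff Φ G z p 1 v)
          + s ^ 2 * (Real.exp (taylorPart Φ z 2 v) * laplaceCoeff Φ G z p 2 v)
          + s ^ 3 * (Real.exp (taylorPart Φ z 2 v) * laplaceCoeff Φ G z p 3 v))|
        ≤ s ^ (p + 4) * ((C + 4 * C' / δ ^ 4) * ((1 + ‖v‖) ^ (K + (K' + 4)) *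
            Real.exp (-(κ / 2) * ‖v‖ ^ 2))) := by
      set B := C' * (1 + ‖v‖) ^ K' * Real.exp (-(κ / 2) * ‖v‖ ^ 2) with hB
      have hB0 : 0 ≤ B := by positivity
      have hE : HasExpansion s B _ (Real.exp (taylorPart Φ z 2 v) * laplaceCoeff Φ G z p 0 v)
          (Real.exp (taylorPart Φ z 2 v) * laplaceCoeff Φ G z p 1 v)
          (Real.exp (taylorPart Φ z 2 v) * laplaceCoeff Φ G z p 2 v)
          (Real.exp (taylorPart Φ z 2 v) * laplaceCoeff Φ G z p 3 v) :=
        ⟨hcoef 0 (by omega) v, hcoef 1 (by omega) v, hcoef 2 (by omega) v, hcoef 3 (by omega) v,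
          by rw [sub_self, abs_zero]; positivity⟩
      rw [abs_mul, abs_of_pos (by positivity : 0 < s ^ p)]
      have h1 : 1 ≤ (s * ‖v‖ / δ) ^ 4 := one_le_pow₀ ((one_le_div hδ).2 hgt.le)
      have h2 : ‖v‖ ^ 4 ≤ (1 + ‖v‖) ^ 4 := pow_le_pow_left₀ hr (by linarith) 4
      calc _ ≤ s ^ p * (4 * B) :=
            mul_le_mul_of_nonneg_left (hE.abs_poly_le hs.le hs1) (by positivity)
        _ ≤ s ^ p * (4 * B) * (s * ‖v‖ / δ) ^ 4 := le_mul_of_one_le_right (by positivity) h1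
        _ = s ^ (p + 4) * (4 * C' / δ ^ 4 * ((1 + ‖v‖) ^ K' * ‖v‖ ^ 4 *
            Real.exp (-(κ / 2) * ‖v‖ ^ 2))) := by
            rw [hB]; field_simp; ring
        _ ≤ s ^ (p + 4) * (4 * C' / δ ^ 4 * ((1 + ‖v‖) ^ K' * (1 + ‖v‖) ^ 4 *
            Real.exp (-(κ / 2) * ‖v‖ ^ 2))) := by gcongr
        _ ≤ _ := by
            rw [← pow_add]
            have h3 : 4 * C' / δ ^ 4 ≤ C + 4 * C' / δ ^ 4 := le_add_of_nonneg_left hC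
            have h4 : (1 + ‖v‖) ^ (K' + 4) ≤ (1 + ‖v‖) ^ (K + (K' + 4)) :=
              pow_le_pow_right₀ hr1 (by omega)
            gcongr
    rw [sub_eq_add_neg]
    refine (abs_add_le _ _).trans ?_
    rw [abs_neg, add_comm]
    exact add_le_add hpoly hΘ

end LaplaceData

theorem integral_add_smul (f : ℝ × ℝ → ℝ) (z : ℝ × ℝ) (s : ℝ) :
    ∫ v, f (z + s • v) = (s ^ 2)⁻¹ * ∫ w, f w := by
  have h := Measure.integral_comp_smul (volume : Measure (ℝ × ℝ)) (fun w => f (z + w)) s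
  rw [h, integral_add_left_eq_self f z]
  simp

/-- Laplace's method: expansion of `∫ exp (N Φ) G` to second order in `1 / N`, for `N = n + 2`. The
integrand is `W ^ n P`, where `W` and `P` continue `exp Φ` and `exp (2 Φ) G` to the plane. -/
theorem LaplaceData.isBigO {Φ G : ℝ → ℝ → ℝ} {U : Set (ℝ × ℝ)} {z : ℝ × ℝ} {κ : ℝ} {r : ℕ}
    (h : LaplaceData Φ G U z κ (2 * r)) {W P : ℝ × ℝ → ℝ}
    (hW : ∀ w ∈ U, W w = Real.exp (Φ w.1 w.2))
    (hP : ∀ w ∈ U, P w = Real.exp (2 * Φ w.1 w.2) * G w.1 w.2)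
    (hgap : ∀ δ > 0, ∃ ρ, 0 ≤ ρ ∧ ρ < 1 ∧
      ∀ w, δ ≤ ‖w - z‖ → |W w| ≤ ρ * Real.exp (Φ z.1 z.2))
    (hPint : Integrable P) (hWP : ∀ n : ℕ, Integrable fun w => W w ^ n * P w) :
    (fun n : ℕ => ((n : ℝ) + 2) ^ (r + 1) *
        (Real.exp (-((n : ℝ) + 2) * Φ z.1 z.2) * ∫ w, W w ^ n * P w)
        - ((∫ v, Real.exp (taylorPart Φ z 2 v) * laplaceCoeff Φ G z (2 * r) 0 v)
          + (∫ v, Real.exp (taylorPart Φ z 2 v) * laplaceCoeff Φ G z (2 * r) 2 v) / ((n : ℝ) + 2)))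
      =O[atTop] fun n : ℕ => 1 / ((n : ℝ) + 2) ^ 2 := by
  obtain ⟨C, hC, K, ρ, hρ0, hρ1, hbound⟩ := h.exists_pointwise_bound hW hP hgap
  have hκ := h.pos
  have hI := fun i (hi : i ≤ 3) => h.integrable_exp_mul_laplaceCoeff hi
  have hJ : ∀ i, Odd i → ∫ v, Real.exp (taylorPart Φ z 2 v) * laplaceCoeff Φ G z (2 * r) i v = 0 :=
    fun i hi => LaplaceData.integral_exp_mul_laplaceCoeff_of_odd Φ G z (even_two_mul r) hi
  set J : ℕ → ℝ := fun i =>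
    ∫ v, Real.exp (taylorPart Φ z 2 v) * laplaceCoeff Φ G z (2 * r) i v with hJdef
  set C₁ := C * ∫ v : ℝ × ℝ, (1 + ‖v‖) ^ K * Real.exp (-(κ / 2) * ‖v‖ ^ 2) with hC₁
  set C₂ := Real.exp (-2 * Φ z.1 z.2) * ∫ w, |P w| with hC₂
  -- the integrated form of the pointwise bound
  have key : ∀ n : ℕ, |((n : ℝ) + 2) ^ (r + 1) *
        (Real.exp (-((n : ℝ) + 2) * Φ z.1 z.2) * ∫ w, W w ^ n * P w)
        - (J 0 + J 2 / ((n : ℝ) + 2))|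
      ≤ C₁ * (1 / ((n : ℝ) + 2) ^ 2) + C₂ * (((n : ℝ) + 2) ^ (r + 1) * ρ ^ n) := by
    intro n
    set N : ℝ := (n : ℝ) + 2 with hN
    have hN0 : 0 < N := by positivity
    set s : ℝ := 1 / √N with hs_def
    have hs : 0 < s := by positivity
    have hs2 : s ^ 2 = 1 / N := by rw [hs_def, div_pow, Real.sq_sqrt hN0.le, one_pow]
    have hsn : s ^ 2 * N = 1 := by rw [hs2]; field_simp
    have hint : ∫ v, Real.exp (-N * Φ z.1 z.2) * (W (z + s • v) ^ n * P (z + s • v))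
        = N * (Real.exp (-N * Φ z.1 z.2) * ∫ w, W w ^ n * P w) := by
      rw [integral_const_mul, integral_add_smul (fun w => W w ^ n * P w), hs2]
      field_simp
    have hintP : ∫ v, |P (z + s • v)| = N * ∫ w, |P w| := by
      rw [integral_add_smul (fun w => |P w|), hs2]; field_simp
    have hcomp : ∀ f : ℝ × ℝ → ℝ, Integrable f → Integrable fun v => f (z + s • v) := fun f hf =>
      (hf.comp_add_left z).comp_smul hs.ne'
    have i0 := (hcomp _ (hWP n)).const_mul (Real.exp (-N * Φ z.1 z.2))
    have p0 := hI 0 (by omega)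
    have p1 := (hI 1 (by omega)).const_mul s
    have p2 := (hI 2 (by omega)).const_mul (s ^ 2)
    have p3 := (hI 3 le_rfl).const_mul (s ^ 3)
    have p01 : Integrable fun v => Real.exp (taylorPart Φ z 2 v) * laplaceCoeff Φ G z (2 * r) 0 v
        + s * (Real.exp (taylorPart Φ z 2 v) * laplaceCoeff Φ G z (2 * r) 1 v) := p0.add p1
    have p012 : Integrable fun v => Real.exp (taylorPart Φ z 2 v) * laplaceCoeff Φ G z (2 * r) 0 v
        + s * (Real.exp (taylorPart Φ z 2 v) * laplaceCoeff Φ G z (2 * r) 1 v)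
        + s ^ 2 * (Real.exp (taylorPart Φ z 2 v) * laplaceCoeff Φ G z (2 * r) 2 v) := p01.add p2
    have hpint : Integrable fun v => s ^ (2 * r) *
        (Real.exp (taylorPart Φ z 2 v) * laplaceCoeff Φ G z (2 * r) 0 v
          + s * (Real.exp (taylorPart Φ z 2 v) * laplaceCoeff Φ G z (2 * r) 1 v)
          + s ^ 2 * (Real.exp (taylorPart Φ z 2 v) * laplaceCoeff Φ G z (2 * r) 2 v)
          + s ^ 3 * (Real.exp (taylorPart Φ z 2 v) * laplaceCoeff Φ G z (2 * r) 3 v)) :=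
      (p012.add p3).const_mul _
    have hpval : ∫ v, s ^ (2 * r) *
        (Real.exp (taylorPart Φ z 2 v) * laplaceCoeff Φ G z (2 * r) 0 v
          + s * (Real.exp (taylorPart Φ z 2 v) * laplaceCoeff Φ G z (2 * r) 1 v)
          + s ^ 2 * (Real.exp (taylorPart Φ z 2 v) * laplaceCoeff Φ G z (2 * r) 2 v)
          + s ^ 3 * (Real.exp (taylorPart Φ z 2 v) * laplaceCoeff Φ G z (2 * r) 3 v))
        = s ^ (2 * r) * (J 0 + s ^ 2 * J 2) := by
      rw [integral_const_mul, integral_add p012 p3, integral_add p01 p2, integral_add p0 p1,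
        integral_const_mul, integral_const_mul, integral_const_mul, hJ 1 odd_one,
        hJ 3 (by decide)]
      ring
    have hright : Integrable fun v : ℝ × ℝ =>
        s ^ (2 * r + 4) * (C * ((1 + ‖v‖) ^ K * Real.exp (-(κ / 2) * ‖v‖ ^ 2)))
        + ρ ^ n * Real.exp (-2 * Φ z.1 z.2) * |P (z + s • v)| :=
      (((integrable_one_add_norm_pow_mul_exp K (half_pos hκ)).const_mul C).const_mul _).add
        ((hcomp _ hPint.abs).const_mul _)
    have hg := ((integrable_one_add_norm_pow_mul_exp K (half_pos hκ)).const_mul C).const_mul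
      (s ^ (2 * r + 4))
    have hmain := norm_integral_le_of_norm_le (f := fun v =>
      Real.exp (-N * Φ z.1 z.2) * (W (z + s • v) ^ n * P (z + s • v)) - s ^ (2 * r) *
        (Real.exp (taylorPart Φ z 2 v) * laplaceCoeff Φ G z (2 * r) 0 v
          + s * (Real.exp (taylorPart Φ z 2 v) * laplaceCoeff Φ G z (2 * r) 1 v)
          + s ^ 2 * (Real.exp (taylorPart Φ z 2 v) * laplaceCoeff Φ G z (2 * r) 2 v)
          + s ^ 3 * (Real.exp (taylorPart Φ z 2 v) * laplaceCoeff Φ G z (2 * r) 3 v))) hright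
      (Eventually.of_forall fun v => hbound n s hs hsn v)
    rw [integral_sub i0 hpint, hpval, hint,
      integral_add hg ((hcomp _ hPint.abs).const_mul _), integral_const_mul, integral_const_mul,
      integral_const_mul, hintP, Real.norm_eq_abs] at hmain
    have hNr : (0 : ℝ) < N ^ r := by positivity
    have hsr : N ^ r * s ^ (2 * r) = 1 := by
      rw [pow_mul, ← mul_pow, mul_comm N, hsn, one_pow]
    have hs4 : s ^ 4 = 1 / N ^ 2 := by
      rw [show s ^ 4 = (s ^ 2) ^ 2 by ring, hs2, div_pow, one_pow]
    have hscale : N ^ (r + 1) * (Real.exp (-N * Φ z.1 z.2) * ∫ w, W w ^ n * P w)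
        - (J 0 + J 2 / N) = N ^ r * (N * (Real.exp (-N * Φ z.1 z.2) * ∫ w, W w ^ n * P w)
        - s ^ (2 * r) * (J 0 + s ^ 2 * J 2)) := by
      rw [hs2]
      linear_combination (J 0 + 1 / N * J 2) * hsr
    rw [hscale, abs_mul, abs_of_pos hNr]
    calc _ ≤ _ := mul_le_mul_of_nonneg_left hmain hNr.le
      _ = (N ^ r * s ^ (2 * r)) * s ^ 4 * C₁ + C₂ * (N ^ (r + 1) * ρ ^ n) := by
          rw [hC₁, hC₂]; ring
      _ = _ := by rw [hsr, hs4]; ring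
  -- exponentially small terms are negligible
  have hexp : (fun n : ℕ => ((n : ℝ) + 2) ^ (r + 1) * ρ ^ n)
      =O[atTop] fun n : ℕ => 1 / ((n : ℝ) + 2) ^ 2 := by
    have hlim := tendsto_pow_const_mul_const_pow_of_abs_lt_one (r + 3)
      (r := max ρ (1 / 2)) (by rw [abs_of_nonneg (by positivity)]; exact max_lt hρ1 (by norm_num))
    have hev := (((tendsto_add_atTop_iff_nat 2).2 hlim).eventually (gt_mem_nhds one_pos))
    refine IsBigO.of_bound ((max ρ (1 / 2) ^ 2)⁻¹) (hev.mono fun n hn => ?_)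
    rw [Real.norm_of_nonneg (by positivity), Real.norm_of_nonneg (by positivity)]
    push_cast at hn
    have hN0 : (0 : ℝ) < (n : ℝ) + 2 := by positivity
    have hm0 : 0 < max ρ (1 / 2) := lt_max_of_lt_right (by norm_num)
    have h1 : ρ ^ n ≤ max ρ (1 / 2) ^ n := pow_le_pow_left₀ hρ0 (le_max_left _ _) n
    rw [inv_eq_one_div]
    rw [mul_one_div, div_div, le_div_iff₀ (by positivity)]
    calc ((n : ℝ) + 2) ^ (r + 1) * ρ ^ n * (max ρ (1 / 2) ^ 2 * ((n : ℝ) + 2) ^ 2)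
        ≤ ((n : ℝ) + 2) ^ (r + 1) * max ρ (1 / 2) ^ n *
          (max ρ (1 / 2) ^ 2 * ((n : ℝ) + 2) ^ 2) := by gcongr
      _ = ((n : ℝ) + 2) ^ (r + 3) * max ρ (1 / 2) ^ (n + 2) := by ring
      _ ≤ 1 := hn.le
  refine (IsBigO.of_bound 1 (Eventually.of_forall fun n => ?_)).trans
    (((isBigO_refl (fun n : ℕ => 1 / ((n : ℝ) + 2) ^ 2) atTop).const_mul_left C₁).add
      (hexp.const_mul_left C₂))
  rw [one_mul, Real.norm_eq_abs]
  exact (key n).trans (le_abs_self _)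

/-! ### The phase function near its maximum -/

/-- The region `x + e ^ (a y + b) > 0`, on which `F` and `g` are smooth. -/
def smoothRegion (a b : ℝ) : Set (ℝ × ℝ) := {z | 0 < z.1 + Real.exp (a * z.2 + b)}

theorem isOpen_smoothRegion (a b : ℝ) : IsOpen (smoothRegion a b) :=
  isOpen_lt continuous_const (by fun_prop)

theorem basePoint_mem_smoothRegion (a b m : ℝ) : basePoint m ∈ smoothRegion a b :=
  sqrt_add_exp_pos a b m

theorem contDiffOn_F (a b : ℝ) :
    ContDiffOn ℝ (⊤ : ℕ∞) (fun z : ℝ × ℝ => F a b z.1 z.2) (smoothRegion a b) := by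
  unfold F
  refine ContDiffOn.add (by fun_prop) (ContDiffOn.log (by fun_prop) fun z hz => ?_)
  exact ne_of_gt (show 0 < z.1 + Real.exp (a * z.2 + b) from hz)

theorem contDiffOn_g (a b : ℝ) :
    ContDiffOn ℝ (⊤ : ℕ∞) (fun z : ℝ × ℝ => g a b z.1 z.2) (smoothRegion a b) := by
  unfold g
  refine ContDiffOn.div (by fun_prop) (by fun_prop) fun z hz => ?_
  exact ne_of_gt (show 0 < z.1 + Real.exp (a * z.2 + b) from hz)

section Derivatives

variable {a b x y : ℝ}

theorem hasDerivAt_F_fst (h : 0 < x + Real.exp (a * y + b)) :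
    HasDerivAt (fun s => F a b s y) (-x + 1 / (x + Real.exp (a * y + b))) x := by
  have h1 : HasDerivAt (fun s : ℝ => -s ^ 2 / 2 - a * y ^ 2 / 2) (-((2 : ℕ) * x ^ (2 - 1)) / 2) x :=
    (((hasDerivAt_pow 2 x).neg).div_const 2).sub_const _
  have h2 := ((hasDerivAt_id' x).add_const (Real.exp (a * y + b))).log h.ne'
  refine (h1.add h2).congr_deriv ?_
  push_cast
  ring

theorem hasDerivAt_exp_linear (a b y : ℝ) :
    HasDerivAt (fun t : ℝ => Real.exp (a * t + b)) (a * Real.exp (a * y + b)) y := by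
  refine ((((hasDerivAt_id' y).const_mul a).add_const b).exp).congr_deriv ?_
  ring

theorem hasDerivAt_F_snd (h : 0 < x + Real.exp (a * y + b)) :
    HasDerivAt (fun t => F a b x t)
      (-(a * y) + a * Real.exp (a * y + b) / (x + Real.exp (a * y + b))) y := by
  have h1 : HasDerivAt (fun t : ℝ => -x ^ 2 / 2 - a * t ^ 2 / 2)
      (-(a * ((2 : ℕ) * y ^ (2 - 1)) / 2)) y :=
    (((hasDerivAt_pow 2 y).const_mul a).div_const 2).const_sub _
  have h2 := ((hasDerivAt_exp_linear a b y).const_add x).log h.ne'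
  refine (h1.add h2).congr_deriv ?_
  push_cast
  ring

theorem partialDeriv_F_one_zero (h : 0 < x + Real.exp (a * y + b)) :
    partialDeriv 1 0 (F a b) x y = -x + 1 / (x + Real.exp (a * y + b)) := by
  simp only [partialDeriv, iteratedDeriv_one, iteratedDeriv_zero]
  exact (hasDerivAt_F_fst h).deriv

theorem partialDeriv_F_zero_one (h : 0 < x + Real.exp (a * y + b)) :
    partialDeriv 0 1 (F a b) x y
      = -(a * y) + a * Real.exp (a * y + b) / (x + Real.exp (a * y + b)) := by
  simp only [partialDeriv, iteratedDeriv_one, iteratedDeriv_zero]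
  exact (hasDerivAt_F_snd h).deriv

theorem eventually_fst_pos (h : 0 < x + Real.exp (a * y + b)) :
    ∀ᶠ s in 𝓝 x, 0 < s + Real.exp (a * y + b) :=
  (by fun_prop : Continuous fun s : ℝ => s + Real.exp (a * y + b)).tendsto x |>.eventually
    (lt_mem_nhds h)

theorem eventually_snd_pos (h : 0 < x + Real.exp (a * y + b)) :
    ∀ᶠ t in 𝓝 y, 0 < x + Real.exp (a * t + b) :=
  (by fun_prop : Continuous fun t : ℝ => x + Real.exp (a * t + b)).tendsto y |>.eventually
    (lt_mem_nhds h)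

theorem partialDeriv_F_two_zero (h : 0 < x + Real.exp (a * y + b)) :
    partialDeriv 2 0 (F a b) x y = -1 - 1 / (x + Real.exp (a * y + b)) ^ 2 := by
  simp only [partialDeriv, iteratedDeriv_succ, iteratedDeriv_zero]
  have he : deriv (fun s => F a b s y) =ᶠ[𝓝 x] fun s => -s + 1 / (s + Real.exp (a * y + b)) :=
    (eventually_fst_pos h).mono fun s hs => (hasDerivAt_F_fst hs).deriv
  rw [he.deriv_eq]
  have h2 := ((hasDerivAt_id' x).add_const (Real.exp (a * y + b))).fun_inv h.ne'
  simp only [one_div]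
  refine ((hasDerivAt_id' x).neg.add h2).deriv.trans ?_
  field_simp
  ring

theorem partialDeriv_F_one_one (h : 0 < x + Real.exp (a * y + b)) :
    partialDeriv 1 1 (F a b) x y
      = -(a * Real.exp (a * y + b)) / (x + Real.exp (a * y + b)) ^ 2 := by
  simp only [partialDeriv, iteratedDeriv_one]
  have he : (fun s => deriv (fun t => F a b s t) y) =ᶠ[𝓝 x]
      fun s => -(a * y) + a * Real.exp (a * y + b) / (s + Real.exp (a * y + b)) :=
    (eventually_fst_pos h).mono fun s hs => (hasDerivAt_F_snd hs).deriv
  rw [he.deriv_eq]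
  have h2 := (((hasDerivAt_id' x).add_const (Real.exp (a * y + b))).fun_inv h.ne').const_mul
    (a * Real.exp (a * y + b))
  simp only [div_eq_mul_inv]
  refine (h2.const_add _).deriv.trans ?_
  field_simp

theorem partialDeriv_F_zero_two (h : 0 < x + Real.exp (a * y + b)) :
    partialDeriv 0 2 (F a b) x y
      = -a + a ^ 2 * Real.exp (a * y + b) * x / (x + Real.exp (a * y + b)) ^ 2 := by
  simp only [partialDeriv, iteratedDeriv_succ, iteratedDeriv_zero]
  have he : deriv (fun t => F a b x t) =ᶠ[𝓝 y]
      fun t => -(a * t) + a * Real.exp (a * t + b) / (x + Real.exp (a * t + b)) :=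
    (eventually_snd_pos h).mono fun t ht => (hasDerivAt_F_snd ht).deriv
  rw [he.deriv_eq]
  have hE := hasDerivAt_exp_linear a b y
  have h2 := (hE.const_mul a).fun_div (hE.const_add x) h.ne'
  refine ((((hasDerivAt_id' y).const_mul a).neg).add h2).deriv.trans ?_
  field_simp
  ring

end Derivatives

theorem IsConsistent.exp_eq {a b m : ℝ} (h : IsConsistent a b m) :
    0 < √(1 - m) ∧ √(1 - m) ^ 2 = 1 - m ∧ √(1 - m) * Real.exp (a * m + b) = m ∧
      √(1 - m) + Real.exp (a * m + b) = 1 / √(1 - m) := by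
  obtain ⟨h0, h1, h⟩ := h
  have hx : 0 < √(1 - m) := Real.sqrt_pos.2 (by linarith)
  have hsq : √(1 - m) ^ 2 = 1 - m := Real.sq_sqrt (by linarith)
  have hE : √(1 - m) * Real.exp (a * m + b) = m := by rw [h]; field_simp
  refine ⟨hx, hsq, hE, ?_⟩
  rw [eq_div_iff hx.ne']
  nlinarith

section Hessian

variable {a b m : ℝ}

theorem IsConsistent.derivAt_F (h : IsConsistent a b m) :
    derivAt m (F a b) 1 0 = 0 ∧ derivAt m (F a b) 0 1 = 0 ∧ derivAt m (F a b) 2 0 = -(2 - m) ∧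
      derivAt m (F a b) 1 1 = -(a * m * √(1 - m)) ∧
      derivAt m (F a b) 0 2 = -(a - a ^ 2 * m * (1 - m)) := by
  obtain ⟨hx, hsq, hxE, hsum⟩ := h.exp_eq
  have hpos := sqrt_add_exp_pos a b m
  simp only [derivAt]
  rw [partialDeriv_F_one_zero hpos, partialDeriv_F_zero_one hpos, partialDeriv_F_two_zero hpos,
    partialDeriv_F_one_one hpos, partialDeriv_F_zero_two hpos, hsum]
  generalize Real.exp (a * m + b) = E at *
  generalize √(1 - m) = x at *
  have hx0 := hx.ne'
  refine ⟨?_, ?_, ?_, ?_, ?_⟩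
  · field_simp; ring
  · field_simp; linear_combination a * hxE
  · field_simp; linear_combination (-1 : ℝ) * hsq
  · field_simp; linear_combination (-a) * hxE
  · field_simp
    linear_combination (a ^ 2 * x ^ 2) * hxE + a ^ 2 * m * hsq

theorem taylorPart_one (G : ℝ → ℝ → ℝ) (m : ℝ) (v : ℝ × ℝ) :
    taylorPart G (basePoint m) 1 v = derivAt m G 0 1 * v.2 + derivAt m G 1 0 * v.1 := by
  simp [taylorPart, Finset.Nat.antidiagonal_succ, basePoint, derivAt]

theorem taylorPart_two (G : ℝ → ℝ → ℝ) (m : ℝ) (v : ℝ × ℝ) :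
    taylorPart G (basePoint m) 2 v = derivAt m G 0 2 / 2 * v.2 ^ 2 +
      derivAt m G 1 1 * (v.1 * v.2) + derivAt m G 2 0 / 2 * v.1 ^ 2 := by
  simp [taylorPart, Finset.Nat.antidiagonal_succ, basePoint, derivAt]
  ring

theorem IsConsistent.taylorPart_F_two (h : IsConsistent a b m) (v : ℝ × ℝ) :
    taylorPart (F a b) (basePoint m) 2 v = -(1 / 2) * ((2 - m) * v.1 ^ 2 +
      2 * (a * m * √(1 - m)) * (v.1 * v.2) + (a - a ^ 2 * m * (1 - m)) * v.2 ^ 2) := by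
  obtain ⟨-, -, h1, h2, h3⟩ := h.derivAt_F
  rw [taylorPart_two, h1, h2, h3]
  ring

theorem IsConsistent.detD_eq (h : IsConsistent a b m) :
    detD a b m = (2 - m) * (a - a ^ 2 * m * (1 - m)) - (a * m * √(1 - m)) ^ 2 := by
  obtain ⟨-, -, h1, h2, h3⟩ := h.derivAt_F
  rw [detD, hessF, h1, h2, h3, Matrix.det_fin_two]
  simp
  ring

theorem IsConsistent.detD_eq_mul (h : IsConsistent a b m) :
    detD a b m = a * (2 - m - 2 * a * m * (1 - m)) := by
  rw [h.detD_eq]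
  linear_combination (-(a * m) ^ 2) * h.exp_eq.2.1

/-- A positive definite binary quadratic form dominates the squared norm. -/
theorem exists_quadratic_form_ge {α β γ : ℝ} (hα : 0 < α) (hdet : 0 < α * γ - β ^ 2) :
    ∃ κ > 0, ∀ v : ℝ × ℝ,
      κ * ‖v‖ ^ 2 ≤ α * v.1 ^ 2 + 2 * β * (v.1 * v.2) + γ * v.2 ^ 2 := by
  have hγ : 0 < γ := by
    by_contra! hγ
    nlinarith [sq_nonneg β, mul_nonneg hα.le (neg_nonneg.2 hγ)]
  refine ⟨(α * γ - β ^ 2) / (α + γ), by positivity, fun v => ?_⟩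
  rw [div_mul_eq_mul_div, div_le_iff₀ (by positivity)]
  have h1 : (α * γ - β ^ 2) * v.1 ^ 2
      ≤ (α * v.1 ^ 2 + 2 * β * (v.1 * v.2) + γ * v.2 ^ 2) * γ := by
    nlinarith [sq_nonneg (β * v.1 + γ * v.2)]
  have h2 : (α * γ - β ^ 2) * v.2 ^ 2
      ≤ (α * v.1 ^ 2 + 2 * β * (v.1 * v.2) + γ * v.2 ^ 2) * α := by
    nlinarith [sq_nonneg (α * v.1 + β * v.2)]
  have h3 : ‖v‖ ^ 2 ≤ v.1 ^ 2 + v.2 ^ 2 := by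
    rw [Prod.norm_def]
    rcases max_choice ‖v.1‖ ‖v.2‖ with h | h <;> rw [h, Real.norm_eq_abs, sq_abs]
    · linarith [sq_nonneg v.2]
    · linarith [sq_nonneg v.1]
  have h4 := mul_le_mul_of_nonneg_left h3 hdet.le
  linarith

theorem IsConsistent.exists_hessian_le (h : IsConsistent a b m) (hD : 0 < detD a b m) :
    ∃ κ > 0, ∀ v, taylorPart (F a b) (basePoint m) 2 v ≤ -κ * ‖v‖ ^ 2 := by
  have h1 := h.2.1
  rw [h.detD_eq] at hD
  obtain ⟨κ, hκ, hq⟩ := exists_quadratic_form_ge (by linarith : 0 < 2 - m) hD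
  refine ⟨κ / 2, by positivity, fun v => ?_⟩
  rw [h.taylorPart_F_two]
  linarith [hq v]

end Hessian

/-! ### Gaussian moments -/

/-- The two-dimensional Gaussian integral. -/
theorem integral_exp_neg_quadratic_form {α β γ : ℝ} (hα : 0 < α) (hdet : 0 < α * γ - β ^ 2) :
    ∫ v : ℝ × ℝ, Real.exp (-(1 / 2) * (α * v.1 ^ 2 + 2 * β * (v.1 * v.2) + γ * v.2 ^ 2))
      = 2 * Real.pi / √(α * γ - β ^ 2) := by
  obtain ⟨κ, hκ, hq⟩ := exists_quadratic_form_ge hα hdet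
  have hint : Integrable fun v : ℝ × ℝ =>
      Real.exp (-(1 / 2) * (α * v.1 ^ 2 + 2 * β * (v.1 * v.2) + γ * v.2 ^ 2)) := by
    have := integrable_exp_mul_of_abs_le (φ := fun _ => 1) (C := 1) (K := 0) (half_pos hκ)
      (q := fun v : ℝ × ℝ => -(1 / 2) * (α * v.1 ^ 2 + 2 * β * (v.1 * v.2) + γ * v.2 ^ 2))
      (by fun_prop) (fun v => by linarith [hq v]) (by fun_prop) (fun v => by simp)
    simpa using this
  rw [Measure.volume_eq_prod] at hint ⊢
  rw [integral_prod_symm _ hint]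
  have hinner : ∀ y : ℝ, ∫ x : ℝ, Real.exp (-(1 / 2) *
      (α * x ^ 2 + 2 * β * (x * y) + γ * y ^ 2))
      = √(Real.pi / (α / 2)) * Real.exp (-((α * γ - β ^ 2) / (2 * α)) * y ^ 2) := by
    intro y
    have h1 : ∀ x : ℝ, Real.exp (-(1 / 2) * (α * x ^ 2 + 2 * β * (x * y) + γ * y ^ 2))
        = Real.exp (-(α / 2) * (x + β * y / α) ^ 2) *
          Real.exp (-((α * γ - β ^ 2) / (2 * α)) * y ^ 2) := by
      intro x
      rw [← Real.exp_add]
      congr 1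
      field_simp
      ring
    simp only [h1]
    rw [integral_mul_const, integral_add_right_eq_self (fun x => Real.exp (-(α / 2) * x ^ 2)),
      integral_gaussian]
  simp only [hinner]
  rw [integral_const_mul, integral_gaussian, ← Real.sqrt_mul (by positivity)]
  have h2 : Real.pi / (α / 2) * (Real.pi / ((α * γ - β ^ 2) / (2 * α)))
      = (2 * Real.pi) ^ 2 / (α * γ - β ^ 2) := by
    field_simp
  rw [h2, Real.sqrt_div (by positivity), Real.sqrt_sq (by positivity)]

/-- The monomial `x ^ i y ^ j`, for `p = (i, j)`. -/
def monomial (p : ℕ × ℕ) (v : ℝ × ℝ) : ℝ := v.1 ^ p.1 * v.2 ^ p.2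

theorem monomial_add (p q : ℕ × ℕ) (v : ℝ × ℝ) :
    monomial (p + q) v = monomial p v * monomial q v := by
  simp only [monomial, Prod.fst_add, Prod.snd_add, pow_add]; ring

theorem taylorPart_eq_sum_monomial (G : ℝ → ℝ → ℝ) (m : ℝ) (k : ℕ) (v : ℝ × ℝ) :
    taylorPart G (basePoint m) k v = ∑ p ∈ antidiagonal k, taylorCoeff m G p * monomial p v := rfl

/-- The expectation of `φ` under the centred Gaussian measure with covariance matrix `C`. -/
def gaussMean (a b m : ℝ) (φ : ℝ × ℝ → ℝ) : ℝ :=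
  √(detD a b m) / (2 * Real.pi) * ∫ v, Real.exp (taylorPart (F a b) (basePoint m) 2 v) * φ v

section GaussMean

variable {a b m : ℝ}

theorem gaussMoment_eq (h : IsConsistent a b m) (hD : 0 < detD a b m) (p : ℕ × ℕ) :
    gaussMoment a b m p = gaussMean a b m (monomial p) := by
  obtain ⟨-, -, h1, h2, h3⟩ := h.derivAt_F
  have hinv : (covC a b m)⁻¹ = -hessF a b m :=
    Matrix.nonsing_inv_nonsing_inv _ (isUnit_iff_ne_zero.2 hD.ne')
  rw [gaussMoment, gaussMean]
  congr 1
  refine integral_congr_ae (Eventually.of_forall fun v => ?_)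
  simp only [hinv, monomial]
  rw [mul_comm]
  congr 2
  rw [taylorPart_two, hessF]
  simp [Matrix.mulVec, dotProduct, Fin.sum_univ_two]
  ring

theorem gaussMoment_zero (h : IsConsistent a b m) (hD : 0 < detD a b m) :
    gaussMoment a b m (0, 0) = 1 := by
  rw [gaussMoment_eq h hD, gaussMean]
  have h1 := h.2.1
  simp only [monomial, pow_zero, mul_one, h.taylorPart_F_two]
  have hD' := hD
  rw [h.detD_eq] at hD' ⊢
  rw [integral_exp_neg_quadratic_form (by linarith) hD']
  have := Real.sqrt_pos.2 hD'
  generalize √((2 - m) * (a - a ^ 2 * m * (1 - m)) - (a * m * √(1 - m)) ^ 2) = s at *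
  field_simp

theorem integrable_exp_mul_monomial (h : IsConsistent a b m) (hD : 0 < detD a b m) (p : ℕ × ℕ) :
    Integrable fun v => Real.exp (taylorPart (F a b) (basePoint m) 2 v) * monomial p v := by
  obtain ⟨κ, hκ, hq⟩ := h.exists_hessian_le hD
  refine integrable_exp_mul_of_abs_le (C := 1) (K := p.1 + p.2) hκ (continuous_taylorPart _ _ _) hq
    (by unfold monomial; fun_prop) fun v => ?_
  have hv := norm_nonneg v
  have h1 : |v.1| ≤ 1 + ‖v‖ := (abs_fst_le_norm v).trans (by linarith)
  have h2 : |v.2| ≤ 1 + ‖v‖ := (abs_snd_le_norm v).trans (by linarith)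
  rw [monomial, abs_mul, abs_pow, abs_pow, one_mul, pow_add]
  gcongr

theorem integrable_exp_mul_sum (h : IsConsistent a b m) (hD : 0 < detD a b m) {ι : Type*}
    (S : Finset ι) (c : ι → ℝ) (p : ι → ℕ × ℕ) :
    Integrable fun v => Real.exp (taylorPart (F a b) (basePoint m) 2 v) *
      ∑ i ∈ S, c i * monomial (p i) v := by
  simp only [mul_sum, mul_left_comm]
  exact integrable_finsetSum _ fun i _ => (integrable_exp_mul_monomial h hD (p i)).const_mul _

theorem gaussMean_sum (h : IsConsistent a b m) (hD : 0 < detD a b m) {ι : Type*}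
    (S : Finset ι) (c : ι → ℝ) (p : ι → ℕ × ℕ) :
    gaussMean a b m (fun v => ∑ i ∈ S, c i * monomial (p i) v)
      = ∑ i ∈ S, c i * gaussMoment a b m (p i) := by
  simp only [gaussMean, mul_sum, mul_left_comm]
  rw [integral_finsetSum _ fun i _ => (integrable_exp_mul_monomial h hD (p i)).const_mul _, mul_sum]
  refine sum_congr rfl fun i _ => ?_
  rw [integral_const_mul, gaussMoment_eq h hD, gaussMean]
  ring

theorem gaussMean_add {φ ψ : ℝ × ℝ → ℝ}
    (hφ : Integrable fun v => Real.exp (taylorPart (F a b) (basePoint m) 2 v) * φ v)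
    (hψ : Integrable fun v => Real.exp (taylorPart (F a b) (basePoint m) 2 v) * ψ v) :
    gaussMean a b m (fun v => φ v + ψ v) = gaussMean a b m φ + gaussMean a b m ψ := by
  simp only [gaussMean, mul_add]
  rw [integral_add hφ hψ, mul_add]

theorem gaussMean_const_mul (c : ℝ) (φ : ℝ × ℝ → ℝ) :
    gaussMean a b m (fun v => c * φ v) = c * gaussMean a b m φ := by
  simp only [gaussMean, mul_left_comm _ c]
  rw [integral_const_mul, mul_left_comm]

theorem taylorPart_mul_eq_sum (G H : ℝ → ℝ → ℝ) (m : ℝ) (k l : ℕ) (v : ℝ × ℝ) :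
    taylorPart G (basePoint m) k v * taylorPart H (basePoint m) l v =
      ∑ i ∈ antidiagonal k ×ˢ antidiagonal l, (taylorCoeff m G i.1 * taylorCoeff m H i.2) *
        monomial (i.1 + i.2) v := by
  rw [taylorPart_eq_sum_monomial, taylorPart_eq_sum_monomial, sum_mul_sum, ← sum_product']
  refine sum_congr rfl fun i _ => ?_
  rw [monomial_add]; ring

theorem taylorPart_mul_mul_eq_sum (G H I : ℝ → ℝ → ℝ) (m : ℝ) (k l j : ℕ) (v : ℝ × ℝ) :
    taylorPart G (basePoint m) k v * taylorPart H (basePoint m) l v * taylorPart I (basePoint m) j v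
      = ∑ i ∈ (antidiagonal k ×ˢ antidiagonal l) ×ˢ antidiagonal j,
        (taylorCoeff m G i.1.1 * taylorCoeff m H i.1.2 * taylorCoeff m I i.2) *
          monomial (i.1.1 + i.1.2 + i.2) v := by
  rw [taylorPart_mul_eq_sum, taylorPart_eq_sum_monomial, sum_mul_sum, ← sum_product']
  refine sum_congr rfl fun i _ => ?_
  rw [monomial_add (i.1.1 + i.1.2)]; ring

theorem integrable_exp_mul_taylorPart (h : IsConsistent a b m) (hD : 0 < detD a b m)
    (G : ℝ → ℝ → ℝ) (k : ℕ) :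
    Integrable fun v => Real.exp (taylorPart (F a b) (basePoint m) 2 v) *
      taylorPart G (basePoint m) k v :=
  integrable_exp_mul_sum h hD _ _ _

theorem integrable_exp_mul_taylorPart_mul (h : IsConsistent a b m) (hD : 0 < detD a b m)
    (G H : ℝ → ℝ → ℝ) (k l : ℕ) :
    Integrable fun v => Real.exp (taylorPart (F a b) (basePoint m) 2 v) *
      (taylorPart G (basePoint m) k v * taylorPart H (basePoint m) l v) := by
  simp only [taylorPart_mul_eq_sum G]
  exact integrable_exp_mul_sum h hD _ _ _

theorem integrable_exp_mul_taylorPart_mul_mul (h : IsConsistent a b m) (hD : 0 < detD a b m)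
    (G H I : ℝ → ℝ → ℝ) (k l j : ℕ) :
    Integrable fun v => Real.exp (taylorPart (F a b) (basePoint m) 2 v) *
      (taylorPart G (basePoint m) k v * taylorPart H (basePoint m) l v *
        taylorPart I (basePoint m) j v) := by
  simp only [taylorPart_mul_mul_eq_sum G]
  exact integrable_exp_mul_sum h hD _ _ _

theorem gaussMean_taylorPart (h : IsConsistent a b m) (hD : 0 < detD a b m)
    (G : ℝ → ℝ → ℝ) (k : ℕ) : gaussMean a b m (taylorPart G (basePoint m) k)
      = ∑ p ∈ antidiagonal k, taylorCoeff m G p * gaussMoment a b m p :=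
  gaussMean_sum h hD _ _ _

theorem gaussMean_taylorPart_mul (h : IsConsistent a b m) (hD : 0 < detD a b m)
    (G H : ℝ → ℝ → ℝ) (k l : ℕ) :
    gaussMean a b m (fun v => taylorPart G (basePoint m) k v * taylorPart H (basePoint m) l v)
      = ∑ p ∈ antidiagonal k, ∑ q ∈ antidiagonal l,
        taylorCoeff m G p * taylorCoeff m H q * gaussMoment a b m (p + q) := by
  simp only [taylorPart_mul_eq_sum G]
  rw [gaussMean_sum h hD, sum_product]

theorem gaussMean_taylorPart_mul_mul (h : IsConsistent a b m) (hD : 0 < detD a b m)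
    (G H I : ℝ → ℝ → ℝ) (k l j : ℕ) :
    gaussMean a b m (fun v => taylorPart G (basePoint m) k v * taylorPart H (basePoint m) l v *
        taylorPart I (basePoint m) j v)
      = ∑ p ∈ antidiagonal k, ∑ q ∈ antidiagonal l, ∑ r ∈ antidiagonal j,
        taylorCoeff m G p * taylorCoeff m H q * taylorCoeff m I r *
          gaussMoment a b m (p + q + r) := by
  simp only [taylorPart_mul_mul_eq_sum G]
  rw [gaussMean_sum h hD, sum_product, sum_product]

theorem gaussMean_laplaceCoeff_zero (h : IsConsistent a b m) (hD : 0 < detD a b m)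
    (G : ℝ → ℝ → ℝ) : gaussMean a b m (laplaceCoeff (F a b) G (basePoint m) 0 0)
      = G (√(1 - m)) m := by
  have h1 := gaussMean_taylorPart h hD G 0
  rw [Finset.Nat.antidiagonal_zero, sum_singleton] at h1
  have h2 : taylorCoeff m G (0, 0) = G (√(1 - m)) m := by
    simp [taylorCoeff, derivAt, partialDeriv]
  rw [gaussMoment_zero h hD, h2, mul_one] at h1
  exact h1

theorem gaussMean_laplaceCoeff_two (h : IsConsistent a b m) (hD : 0 < detD a b m)
    (G : ℝ → ℝ → ℝ) : gaussMean a b m (laplaceCoeff (F a b) G (basePoint m) 0 2)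
      = coeffK a b m G + G (√(1 - m)) m * coeffL a b m := by
  have hfun : laplaceCoeff (F a b) G (basePoint m) 0 2 = fun v =>
      taylorPart G (basePoint m) 2 v +
        (taylorPart (F a b) (basePoint m) 3 v * taylorPart G (basePoint m) 1 v +
        G (√(1 - m)) m * (taylorPart (F a b) (basePoint m) 4 v +
          1 / 2 * (taylorPart (F a b) (basePoint m) 3 v *
            taylorPart (F a b) (basePoint m) 3 v))) := by
    funext v
    simp only [laplaceCoeff, taylorPart_zero, zero_add, basePoint]
    ring
  have i1 := integrable_exp_mul_taylorPart h hD G 2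
  have i2 := integrable_exp_mul_taylorPart_mul h hD (F a b) G 3 1
  have i3 := integrable_exp_mul_taylorPart h hD (F a b) 4
  have i4 : Integrable fun v => Real.exp (taylorPart (F a b) (basePoint m) 2 v) *
      (1 / 2 * (taylorPart (F a b) (basePoint m) 3 v * taylorPart (F a b) (basePoint m) 3 v)) := by
    simp only [mul_left_comm _ (1 / 2 : ℝ)]
    exact (integrable_exp_mul_taylorPart_mul h hD (F a b) (F a b) 3 3).const_mul _
  have i5 : Integrable fun v => Real.exp (taylorPart (F a b) (basePoint m) 2 v) *
      (G (√(1 - m)) m * (taylorPart (F a b) (basePoint m) 4 v +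
          1 / 2 * (taylorPart (F a b) (basePoint m) 3 v *
            taylorPart (F a b) (basePoint m) 3 v))) := by
    simp only [mul_left_comm _ (G (√(1 - m)) m), mul_add (Real.exp _)]
    exact (i3.add i4).const_mul _
  have i6 : Integrable fun v => Real.exp (taylorPart (F a b) (basePoint m) 2 v) *
      (taylorPart (F a b) (basePoint m) 3 v * taylorPart G (basePoint m) 1 v +
        G (√(1 - m)) m * (taylorPart (F a b) (basePoint m) 4 v +
          1 / 2 * (taylorPart (F a b) (basePoint m) 3 v *
            taylorPart (F a b) (basePoint m) 3 v))) := by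
    simp only [mul_add (Real.exp _) (_ * taylorPart G _ _ _)]
    exact i2.add i5
  rw [hfun, gaussMean_add i1 i6, gaussMean_add i2 i5, gaussMean_const_mul, gaussMean_add i3 i4,
    gaussMean_const_mul, gaussMean_taylorPart h hD, gaussMean_taylorPart h hD,
    gaussMean_taylorPart_mul h hD, gaussMean_taylorPart_mul h hD, coeffK, coeffK1, coeffK2, coeffL]
  ring

theorem gaussMean_laplaceCoeff_quadratic_zero (h : IsConsistent a b m) (hD : 0 < detD a b m)
    (G : ℝ → ℝ → ℝ) : gaussMean a b m (laplaceCoeff (F a b) G (basePoint m) 2 0)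
      = coeffK1 a b m G :=
  gaussMean_taylorPart h hD G 2

theorem gaussMean_laplaceCoeff_quadratic_two (h : IsConsistent a b m) (hD : 0 < detD a b m)
    (G : ℝ → ℝ → ℝ) : gaussMean a b m (laplaceCoeff (F a b) G (basePoint m) 2 2)
      = coeffM a b m G := by
  have hfun : laplaceCoeff (F a b) G (basePoint m) 2 2 = fun v =>
      (taylorPart G (basePoint m) 4 v +
        taylorPart (F a b) (basePoint m) 3 v * taylorPart G (basePoint m) 3 v) +
        (taylorPart (F a b) (basePoint m) 4 v * taylorPart G (basePoint m) 2 v +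
          1 / 2 * (taylorPart (F a b) (basePoint m) 3 v *
            taylorPart (F a b) (basePoint m) 3 v * taylorPart G (basePoint m) 2 v)) := by
    funext v
    simp only [laplaceCoeff]
    ring
  have i1 := integrable_exp_mul_taylorPart h hD G 4
  have i2 := integrable_exp_mul_taylorPart_mul h hD (F a b) G 3 3
  have i3 := integrable_exp_mul_taylorPart_mul h hD (F a b) G 4 2
  have i4 : Integrable fun v => Real.exp (taylorPart (F a b) (basePoint m) 2 v) *
      (1 / 2 * (taylorPart (F a b) (basePoint m) 3 v * taylorPart (F a b) (basePoint m) 3 v *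
        taylorPart G (basePoint m) 2 v)) := by
    simp only [mul_left_comm _ (1 / 2 : ℝ)]
    exact (integrable_exp_mul_taylorPart_mul_mul h hD (F a b) (F a b) G 3 3 2).const_mul _
  have i12 : Integrable fun v => Real.exp (taylorPart (F a b) (basePoint m) 2 v) *
      (taylorPart G (basePoint m) 4 v +
        taylorPart (F a b) (basePoint m) 3 v * taylorPart G (basePoint m) 3 v) := by
    simp only [mul_add]
    exact i1.add i2
  have i34 : Integrable fun v => Real.exp (taylorPart (F a b) (basePoint m) 2 v) *
      (taylorPart (F a b) (basePoint m) 4 v * taylorPart G (basePoint m) 2 v +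
          1 / 2 * (taylorPart (F a b) (basePoint m) 3 v *
            taylorPart (F a b) (basePoint m) 3 v * taylorPart G (basePoint m) 2 v)) := by
    simp only [mul_add]
    exact i3.add i4
  rw [hfun, gaussMean_add i12 i34, gaussMean_add i1 i2, gaussMean_add i3 i4, gaussMean_const_mul,
    gaussMean_taylorPart h hD, gaussMean_taylorPart_mul h hD, gaussMean_taylorPart_mul h hD,
    gaussMean_taylorPart_mul_mul h hD, coeffM]
  ring

end GaussMean

/-! ### Laplace expansions for the observables -/

/-- The amplitude `c₀ + c₁ g + c₂ g ^ 2`. -/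
def amplitude (a b : ℝ) (c : Fin 3 → ℝ) (x y : ℝ) : ℝ :=
  c 0 + c 1 * g a b x y + c 2 * g a b x y ^ 2

/-- The plane integral of `exp (N F) g ^ k` for `N = n + 2`, divided by the leading order of the
plane integral of `exp (N F)`. -/
def normalizedIntegral (a b m : ℝ) (n k : ℕ) : ℝ :=
  √(detD a b m) / (2 * Real.pi) * (((n : ℝ) + 2) *
    (Real.exp (-((n : ℝ) + 2) * F a b (√(1 - m)) m) * planeIntegral a b n k))

theorem contDiffOn_amplitude (a b : ℝ) (c : Fin 3 → ℝ) :
    ContDiffOn ℝ (⊤ : ℕ∞) (fun z : ℝ × ℝ => amplitude a b c z.1 z.2) (smoothRegion a b) := by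
  have hg := contDiffOn_g a b
  unfold amplitude
  exact (contDiffOn_const.add (contDiffOn_const.mul hg)).add (contDiffOn_const.mul (hg.pow 2))

theorem observable_eq {a b : ℝ} {k : ℕ} (hk : k ≤ 2) {w : ℝ × ℝ} (hw : w ∈ smoothRegion a b) :
    observable a b k w = Real.exp (2 * F a b w.1 w.2) * g a b w.1 w.2 ^ k := by
  have hpos : 0 < w.1 + Real.exp (a * w.2 + b) := hw
  have h1 : Real.exp (2 * F a b w.1 w.2)
      = Real.exp (-(w.1 ^ 2 + a * w.2 ^ 2)) * (w.1 + Real.exp (a * w.2 + b)) ^ 2 := by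
    have h2 : Real.exp (2 * F a b w.1 w.2) = Real.exp (F a b w.1 w.2) ^ 2 := by
      rw [← Real.exp_nat_mul]; norm_num
    rw [h2, ← planeWeight_eq_exp_F hpos, planeWeight, mul_pow, ← Real.exp_nat_mul]
    congr 2
    push_cast
    ring
  have h3 : (w.1 + Real.exp (a * w.2 + b)) ^ 2
      = (w.1 + Real.exp (a * w.2 + b)) ^ (2 - k) * (w.1 + Real.exp (a * w.2 + b)) ^ k := by
    rw [← pow_add, Nat.sub_add_cancel hk]
  rw [h1, h3, observable, g, div_pow]
  field_simp

section Expansions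

variable {a b m : ℝ}

theorem IsConsistent.laplaceData (h : IsConsistent a b m) {κ : ℝ} (hκ : 0 < κ)
    (hq : ∀ v, taylorPart (F a b) (basePoint m) 2 v ≤ -κ * ‖v‖ ^ 2) (c : Fin 3 → ℝ) {p : ℕ}
    (hp : ∀ k < p, ∀ v, taylorPart (amplitude a b c) (basePoint m) k v = 0) :
    LaplaceData (F a b) (amplitude a b c) (smoothRegion a b) (basePoint m) κ p where
  isOpen := isOpen_smoothRegion a b
  mem := basePoint_mem_smoothRegion a b m
  smooth_phase := contDiffOn_F a b
  smooth_amplitude := contDiffOn_amplitude a b c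
  pos := hκ
  critical v := by
    obtain ⟨h1, h2, -⟩ := h.derivAt_F
    rw [taylorPart_one, h1, h2]
    ring
  hessian := hq
  vanish := hp

theorem isBigO_normalizedIntegral (ha : 0 < a) (hm : IsPhase a b m)
    (hunique : ∀ m', IsPhase a b m' → m' = m) (hD : 0 < detD a b m) (c : Fin 3 → ℝ) (r : ℕ)
    (hr : ∀ k < 2 * r, ∀ v, taylorPart (amplitude a b c) (basePoint m) k v = 0) :
    (fun n : ℕ => ((n : ℝ) + 2) ^ r * (c 0 * normalizedIntegral a b m n 0
        + c 1 * normalizedIntegral a b m n 1 + c 2 * normalizedIntegral a b m n 2)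
        - (gaussMean a b m (laplaceCoeff (F a b) (amplitude a b c) (basePoint m) (2 * r) 0)
          + gaussMean a b m (laplaceCoeff (F a b) (amplitude a b c) (basePoint m) (2 * r) 2)
            / ((n : ℝ) + 2)))
      =O[atTop] fun n : ℕ => 1 / ((n : ℝ) + 2) ^ 2 := by
  obtain ⟨κ, hκ, hq⟩ := hm.1.exists_hessian_le hD
  have hobs := fun k => integrable_observable ha b k
  have hW := fun n k => integrable_planeWeight_pow_mul ha b n (hobs k)
  have i01 : Integrable fun w => c 0 * observable a b 0 w + c 1 * observable a b 1 w :=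
    ((hobs 0).const_mul _).add ((hobs 1).const_mul _)
  have i012 : Integrable fun w => c 0 * observable a b 0 w + c 1 * observable a b 1 w
      + c 2 * observable a b 2 w := i01.add ((hobs 2).const_mul _)
  have hmain := (hm.1.laplaceData hκ hq c hr).isBigO (W := planeWeight a b)
    (P := fun w => c 0 * observable a b 0 w + c 1 * observable a b 1 w + c 2 * observable a b 2 w)
    (fun w hw => planeWeight_eq_exp_F hw)
    (fun w hw => by
      simp only [observable_eq (by norm_num : 0 ≤ 2) hw, observable_eq (by norm_num : 1 ≤ 2) hw,
        observable_eq le_rfl hw, amplitude]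
      ring)
    (fun δ hδ => by
      obtain ⟨ρ, h0, h1, h⟩ := hm.exists_gap ha hunique hδ
      refine ⟨ρ, h0, h1, fun w hw => ?_⟩
      rw [← planeWeight_eq_exp_F (basePoint_mem_smoothRegion a b m)]
      exact h w hw)
    i012 (fun n => integrable_planeWeight_pow_mul ha b n i012)
  refine (hmain.const_mul_left (√(detD a b m) / (2 * Real.pi))).congr_left fun n => ?_
  have hint : ∫ w, planeWeight a b w ^ n *
      (c 0 * observable a b 0 w + c 1 * observable a b 1 w + c 2 * observable a b 2 w)
      = c 0 * planeIntegral a b n 0 + c 1 * planeIntegral a b n 1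
        + c 2 * planeIntegral a b n 2 := by
    have e : ∀ w, planeWeight a b w ^ n *
        (c 0 * observable a b 0 w + c 1 * observable a b 1 w + c 2 * observable a b 2 w)
        = c 0 * (planeWeight a b w ^ n * observable a b 0 w)
          + c 1 * (planeWeight a b w ^ n * observable a b 1 w)
          + c 2 * (planeWeight a b w ^ n * observable a b 2 w) := fun w => by ring
    have j01 : Integrable fun w => c 0 * (planeWeight a b w ^ n * observable a b 0 w)
          + c 1 * (planeWeight a b w ^ n * observable a b 1 w) :=
      ((hW n 0).const_mul _).add ((hW n 1).const_mul _)
    simp only [e]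
    rw [integral_add j01 ((hW n 2).const_mul _),
      integral_add ((hW n 0).const_mul _) ((hW n 1).const_mul _), integral_const_mul,
      integral_const_mul, integral_const_mul]
    rfl
  rw [hint]
  simp only [gaussMean, normalizedIntegral, basePoint]
  ring

theorem g_basePoint (h : IsConsistent a b m) : g a b (√(1 - m)) m = m := by
  obtain ⟨hx, -, hxE, hsum⟩ := h.exp_eq
  rw [g, hsum, div_div_eq_mul_div, div_one, mul_comm, hxE]

theorem taylorCoeff_const (m c : ℝ) {p : ℕ × ℕ} (hp : p ≠ 0) :
    taylorCoeff m (fun _ _ => c) p = 0 := by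
  have : partialDeriv p.1 p.2 (fun _ _ => c) (√(1 - m)) m = 0 := by
    simp only [partialDeriv, iteratedDeriv_const]
    obtain ⟨i, j⟩ := p
    rcases j with _ | j
    · rcases i with _ | i
      · exact absurd rfl hp
      · simp
    · simp
  rw [taylorCoeff, derivAt, this, zero_div]

theorem coeffK_const (a b m c : ℝ) : coeffK a b m (fun _ _ => c) = 0 := by
  have h : ∀ k ≠ 0, ∀ p ∈ antidiagonal k, taylorCoeff m (fun _ _ => c) p = 0 := by
    intro k hk p hp
    refine taylorCoeff_const m c ?_
    rintro rfl
    exact hk (mem_antidiagonal.1 hp).symm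
  rw [coeffK, coeffK1, coeffK2, sum_eq_zero, sum_eq_zero, add_zero]
  · exact fun p _ => sum_eq_zero fun q hq => by rw [h 1 one_ne_zero q hq, mul_zero, zero_mul]
  · exact fun p hp => by rw [h 2 two_ne_zero p hp, zero_mul]

/-- The expansion of a normalized integral for a general amplitude. -/
theorem isBigO_normalizedIntegral_linear (ha : 0 < a) (hm : IsPhase a b m)
    (hunique : ∀ m', IsPhase a b m' → m' = m) (hD : 0 < detD a b m) (c : Fin 3 → ℝ) :
    (fun n : ℕ => (c 0 * normalizedIntegral a b m n 0
        + c 1 * normalizedIntegral a b m n 1 + c 2 * normalizedIntegral a b m n 2)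
        - (amplitude a b c (√(1 - m)) m + (coeffK a b m (amplitude a b c)
          + amplitude a b c (√(1 - m)) m * coeffL a b m) / ((n : ℝ) + 2)))
      =O[atTop] fun n : ℕ => 1 / ((n : ℝ) + 2) ^ 2 := by
  have h := isBigO_normalizedIntegral ha hm hunique hD c 0 (by simp)
  simpa only [pow_zero, one_mul, mul_zero, gaussMean_laplaceCoeff_zero hm.1 hD,
    gaussMean_laplaceCoeff_two hm.1 hD] using h

theorem isBigO_normalizedIntegral_zero (ha : 0 < a) (hm : IsPhase a b m)
    (hunique : ∀ m', IsPhase a b m' → m' = m) (hD : 0 < detD a b m) :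
    (fun n : ℕ => normalizedIntegral a b m n 0 - (1 + coeffL a b m / ((n : ℝ) + 2)))
      =O[atTop] fun n : ℕ => 1 / ((n : ℝ) + 2) ^ 2 := by
  have h := isBigO_normalizedIntegral_linear ha hm hunique hD ![1, 0, 0]
  have hG : amplitude a b ![1, 0, 0] = fun _ _ => 1 := by
    funext x y; simp [amplitude]
  rw [hG, coeffK_const] at h
  simpa using h

theorem isBigO_normalizedIntegral_one (ha : 0 < a) (hm : IsPhase a b m)
    (hunique : ∀ m', IsPhase a b m' → m' = m) (hD : 0 < detD a b m) :
    (fun n : ℕ => normalizedIntegral a b m n 1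
        - (m + (coeffK a b m (g a b) + m * coeffL a b m) / ((n : ℝ) + 2)))
      =O[atTop] fun n : ℕ => 1 / ((n : ℝ) + 2) ^ 2 := by
  have h := isBigO_normalizedIntegral_linear ha hm hunique hD ![0, 1, 0]
  have hG : amplitude a b ![0, 1, 0] = g a b := by
    funext x y; simp [amplitude]
  rw [hG, g_basePoint hm.1] at h
  simpa using h

theorem isBigO_normalizedIntegral_one_sub_two (ha : 0 < a) (hm : IsPhase a b m)
    (hunique : ∀ m', IsPhase a b m' → m' = m) (hD : 0 < detD a b m) :
    (fun n : ℕ => (normalizedIntegral a b m n 1 - normalizedIntegral a b m n 2)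
        - (m * (1 - m) + (coeffK a b m (fun x y => g a b x y * (1 - g a b x y))
          + m * (1 - m) * coeffL a b m) / ((n : ℝ) + 2)))
      =O[atTop] fun n : ℕ => 1 / ((n : ℝ) + 2) ^ 2 := by
  have h := isBigO_normalizedIntegral_linear ha hm hunique hD ![0, 1, -1]
  have hG : amplitude a b ![0, 1, -1] = fun x y => g a b x y * (1 - g a b x y) := by
    funext x y; simp [amplitude]; ring
  rw [hG] at h
  simp only [g_basePoint hm.1] at h
  simpa [sub_eq_add_neg] using h

/-- The amplitude `(g - m) ^ 2` vanishes to second order at the base point. -/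
theorem taylorPart_gSq_eq_zero (h : IsConsistent a b m) {k : ℕ} (hk : k < 2) (v : ℝ × ℝ) :
    taylorPart (gSq a b m) (basePoint m) k v = 0 := by
  have hg := g_basePoint h
  interval_cases k
  · rw [taylorPart_zero]
    simp [gSq, basePoint, hg]
  · have hz := basePoint_mem_smoothRegion a b m
    have h1 := (hasDerivAt_fst_of_contDiffOn (isOpen_smoothRegion a b) (contDiffOn_g a b) hz)
    have h2 := (hasDerivAt_snd_of_contDiffOn (isOpen_smoothRegion a b) (contDiffOn_g a b) hz)
    have e1 : derivAt m (gSq a b m) 1 0 = 0 := by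
      simp only [derivAt, partialDeriv, iteratedDeriv_one, iteratedDeriv_zero, gSq]
      rw [((h1.sub_const m).fun_pow 2).deriv]
      simp [hg]
    have e2 : derivAt m (gSq a b m) 0 1 = 0 := by
      simp only [derivAt, partialDeriv, iteratedDeriv_one, iteratedDeriv_zero, gSq]
      rw [((h2.sub_const m).fun_pow 2).deriv]
      simp [hg]
    rw [taylorPart_one, e1, e2]
    ring

theorem isBigO_normalizedIntegral_gSq (ha : 0 < a) (hm : IsPhase a b m)
    (hunique : ∀ m', IsPhase a b m' → m' = m) (hD : 0 < detD a b m) :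
    (fun n : ℕ => ((n : ℝ) + 2) * (m ^ 2 * normalizedIntegral a b m n 0
        - 2 * m * normalizedIntegral a b m n 1 + normalizedIntegral a b m n 2)
        - (coeffK1 a b m (gSq a b m) + coeffM a b m (gSq a b m) / ((n : ℝ) + 2)))
      =O[atTop] fun n : ℕ => 1 / ((n : ℝ) + 2) ^ 2 := by
  have hG : amplitude a b ![m ^ 2, -(2 * m), 1] = gSq a b m := by
    funext x y; simp [amplitude, gSq]; ring
  have h := isBigO_normalizedIntegral ha hm hunique hD ![m ^ 2, -(2 * m), 1] 1
    (by rw [hG]; exact fun k hk v => taylorPart_gSq_eq_zero hm.1 hk v)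
  rw [hG] at h
  simp only [pow_one, mul_one, gaussMean_laplaceCoeff_quadratic_zero hm.1 hD,
    gaussMean_laplaceCoeff_quadratic_two hm.1 hD] at h
  simpa [sub_eq_add_neg] using h

end Expansions

/-! ### Ratios of expansions -/

section Ratios

variable {N X Y : ℕ → ℝ} {α β l : ℝ}

theorem isBigO_one_div_sq_one_div (hN : Tendsto N atTop atTop) :
    (fun n => 1 / N n ^ 2) =O[atTop] fun n => 1 / N n := by
  refine IsBigO.of_bound 1 ((hN.eventually_ge_atTop 1).mono fun n hn => ?_)
  rw [Real.norm_of_nonneg (by positivity), Real.norm_of_nonneg (by positivity), one_mul]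
  exact one_div_le_one_div_of_le (by linarith) (by nlinarith)

theorem tendsto_of_expansion (hN : Tendsto N atTop atTop)
    (hX : (fun n => X n - (α + β / N n)) =O[atTop] fun n => 1 / N n ^ 2) :
    Tendsto X atTop (𝓝 α) := by
  have h0 : Tendsto (fun n => 1 / N n) atTop (𝓝 0) := hN.const_div_atTop 1
  have h1 := (hX.trans (isBigO_one_div_sq_one_div hN)).trans_tendsto h0
  have h2 : Tendsto (fun n => X n - (α + β / N n) + (α + β * (1 / N n))) atTop
      (𝓝 (0 + (α + β * 0))) := h1.add ((h0.const_mul β).const_add α)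
  simp only [zero_add, mul_zero, add_zero] at h2
  refine h2.congr fun n => ?_
  ring

theorem isBigO_sub_of_expansion (hN : Tendsto N atTop atTop)
    (hX : (fun n => X n - (α + β / N n)) =O[atTop] fun n => 1 / N n ^ 2) :
    (fun n => X n - α) =O[atTop] fun n => 1 / N n := by
  have h1 := (hX.trans (isBigO_one_div_sq_one_div hN)).add
    ((isBigO_refl (fun n => 1 / N n) atTop).const_mul_left β)
  refine h1.congr_left fun n => ?_
  ring

theorem isBigO_div_of_expansion (hN : Tendsto N atTop atTop)
    (hX : (fun n => X n - (α + β / N n)) =O[atTop] fun n => 1 / N n ^ 2)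
    (hY : (fun n => Y n - (1 + l / N n)) =O[atTop] fun n => 1 / N n ^ 2) :
    (fun n => X n / Y n - (α + (β - α * l) / N n)) =O[atTop] fun n => 1 / N n ^ 2 := by
  have hYlim := tendsto_of_expansion hN hY
  have hYinv : (fun n => (Y n)⁻¹) =O[atTop] fun _ => (1 : ℝ) :=
    (hYlim.inv₀ one_ne_zero).isBigO_one ℝ
  have hbdd : (fun n => α + (β - α * l) / N n) =O[atTop] fun _ => (1 : ℝ) := by
    have : Tendsto (fun n => α + (β - α * l) / N n) atTop (𝓝 (α + 0)) :=
      (hN.const_div_atTop (β - α * l)).const_add α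
    exact this.isBigO_one ℝ
  have h1 := hbdd.mul hY
  simp only [one_mul] at h1
  have h2 : (fun n => -((β - α * l) * l) * (1 / N n ^ 2)) =O[atTop] fun n => 1 / N n ^ 2 :=
    (isBigO_refl _ _).const_mul_left _
  have h3 := ((hX.sub h1).add h2).mul hYinv
  simp only [mul_one] at h3
  refine h3.congr' ?_ EventuallyEq.rfl
  filter_upwards [hYlim.eventually_ne one_ne_zero, hN.eventually_gt_atTop 0] with n hn hn0
  field_simp
  ring

end Ratios

/-! ### The finite system in terms of the normalized integrals -/

section FiniteSystem

variable {a b : ℝ}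

theorem partitionFunction_pos (a b : ℝ) (N : ℕ) : 0 < partitionFunction a b (N + 1) := by
  refine sum_pos (fun D _ => ?_) ⟨∅, by simp [configurations]⟩
  rw [weight]
  have := Real.exp_pos (-hamiltonian a b D)
  positivity

theorem gaussConst_eq (ha : 0 < a) (n : ℕ) :
    gaussConst a n = 2 * Real.pi / (((n : ℝ) + 2) * √a) := by
  have hN : (0 : ℝ) < (n : ℝ) + 2 := by positivity
  rw [gaussConst, ← Real.sqrt_mul (by positivity)]
  push_cast
  have h1 : 2 * Real.pi / ((n : ℝ) + 2) * (2 * Real.pi / (((n : ℝ) + 2) * a))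
      = (2 * Real.pi / ((n : ℝ) + 2)) ^ 2 / a := by
    field_simp
  rw [h1, Real.sqrt_div (by positivity), Real.sqrt_sq (by positivity), div_div]

theorem normalizedIntegral_zero_eq (ha : 0 < a) {m : ℝ} (hD : 0 < detD a b m) (n : ℕ) :
    normalizedIntegral a b m n 0 = √(detD a b m / a) *
      (Real.exp (-((n : ℝ) + 2) * F a b (√(1 - m)) m) * partitionFunction a b (n + 2)) := by
  have hN : (0 : ℝ) < (n : ℝ) + 2 := by positivity
  have hsa := Real.sqrt_pos.2 ha
  rw [normalizedIntegral, planeIntegral_zero ha, gaussConst_eq ha, Real.sqrt_div hD.le]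
  field_simp

theorem gibbsExpectation_monomerDensity_pow (a b : ℝ) (N k : ℕ) :
    gibbsExpectation a b N (fun D => monomerDensity D ^ k) = 1 / partitionFunction a b N *
      ((∑ D ∈ configurations N, ((monomers D).card : ℝ) ^ k * weight a b D) / (N : ℝ) ^ k) := by
  rw [gibbsExpectation, sum_div]
  congr 1
  refine sum_congr rfl fun D _ => ?_
  rw [monomerDensity, div_pow]
  ring

theorem averageMonomerDensity_eq (ha : 0 < a) {m : ℝ} (hD : 0 < detD a b m) (n : ℕ) :
    averageMonomerDensity a b (n + 2)
      = normalizedIntegral a b m n 1 / normalizedIntegral a b m n 0 := by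
  have hN : (0 : ℝ) < (n : ℝ) + 2 := by positivity
  have hZ := partitionFunction_pos a b (n + 1)
  have hc : 0 < gaussConst a n := by rw [gaussConst_eq ha]; positivity
  have hs := Real.sqrt_pos.2 hD
  have he := Real.exp_pos (-((n : ℝ) + 2) * F a b (√(1 - m)) m)
  have h1 := planeIntegral_one ha b n
  have h := gibbsExpectation_monomerDensity_pow a b (n + 2) 1
  simp only [pow_one] at h
  rw [averageMonomerDensity, h, normalizedIntegral, normalizedIntegral, planeIntegral_zero ha]
  generalize ∑ D ∈ configurations (n + 2), ((monomers D).card : ℝ) * weight a b D = S at *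
  push_cast at h1 ⊢
  field_simp
  linear_combination (-1 : ℝ) * h1

theorem susceptibility_eq (ha : 0 < a) {m : ℝ} (hD : 0 < detD a b m) (n : ℕ) :
    susceptibility a b (n + 2)
      = ((n : ℝ) + 2) * (m ^ 2 * normalizedIntegral a b m n 0
          - 2 * m * normalizedIntegral a b m n 1 + normalizedIntegral a b m n 2)
          / normalizedIntegral a b m n 0
        - ((n : ℝ) + 2) * (normalizedIntegral a b m n 1 / normalizedIntegral a b m n 0 - m) ^ 2
        + (normalizedIntegral a b m n 1 - normalizedIntegral a b m n 2)
          / normalizedIntegral a b m n 0 := by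
  have hN : (0 : ℝ) < (n : ℝ) + 2 := by positivity
  have hZ := partitionFunction_pos a b (n + 1)
  have hc : 0 < gaussConst a n := by rw [gaussConst_eq ha]; positivity
  have hs := Real.sqrt_pos.2 hD
  have he := Real.exp_pos (-((n : ℝ) + 2) * F a b (√(1 - m)) m)
  have h0 : normalizedIntegral a b m n 0 ≠ 0 := by
    rw [normalizedIntegral, planeIntegral_zero ha]
    exact (mul_pos (by positivity) (mul_pos hN (mul_pos he (mul_pos hc hZ)))).ne'
  have h2 := planeIntegral_two ha b n
  have hsq : gibbsExpectation a b (n + 2) (fun D => monomerDensity D ^ 2)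
      = (normalizedIntegral a b m n 1 + ((n : ℝ) + 1) * normalizedIntegral a b m n 2)
        / (((n : ℝ) + 2) * normalizedIntegral a b m n 0) := by
    rw [gibbsExpectation_monomerDensity_pow, normalizedIntegral, normalizedIntegral,
      normalizedIntegral,
      planeIntegral_zero ha]
    generalize ∑ D ∈ configurations (n + 2), ((monomers D).card : ℝ) ^ 2 * weight a b D = S at *
    push_cast at h2 ⊢
    field_simp
    linear_combination (-1 : ℝ) * h2
  have hav := averageMonomerDensity_eq ha hD n
  rw [averageMonomerDensity] at hav
  rw [susceptibility, hsq, hav]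
  push_cast
  field_simp
  ring

end FiniteSystem

theorem isBigO_of_shift {f h : ℕ → ℝ}
    (hfh : (fun n => f (n + 2)) =O[atTop] fun n => h (n + 2)) : f =O[atTop] h := by
  rw [← map_add_atTop_eq_nat 2]
  exact isBigO_map.2 hfh

end MonomerDimer

end

open MonomerDimer Filter Topology Asymptotics in
theorem theorem1 (a b : ℝ) (ha : 0 < a)
    (hunique : ∀ m m' : ℝ, MonomerDimer.IsPhase a b m → MonomerDimer.IsPhase a b m' → m = m')
    (hcrit : ¬ (a = MonomerDimer.aCrit ∧ b = MonomerDimer.bCrit)) :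
    ∃ m : ℝ, MonomerDimer.IsPhase a b m ∧
      (fun N : ℕ => MonomerDimer.pressureDensity a b N
          - (MonomerDimer.pStar a b m + MonomerDimer.Lam a b m / N))
        =O[Filter.atTop] (fun N : ℕ => 1 / (N : ℝ) ^ 2) ∧
      (fun N : ℕ => MonomerDimer.averageMonomerDensity a b N
          - (m + MonomerDimer.Lam' a b m / N))
        =O[Filter.atTop] (fun N : ℕ => 1 / (N : ℝ) ^ 2) ∧
      (fun N : ℕ => MonomerDimer.susceptibility a b N
          - (MonomerDimer.chiStar a b m + MonomerDimer.Lam'' a b m / N))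
        =O[Filter.atTop] (fun N : ℕ => 1 / (N : ℝ) ^ 2) := by
  obtain ⟨m, hm⟩ := exists_isPhase ha b
  have huniq : ∀ m', IsPhase a b m' → m' = m := fun m' hm' => hunique m' m hm' hm
  have hD : 0 < detD a b m := by
    rw [hm.1.detD_eq_mul]
    exact mul_pos ha (hm.nondegenerate ha hcrit)
  have hN : Tendsto (fun n : ℕ => (n : ℝ) + 2) atTop atTop :=
    tendsto_atTop_add_const_right _ _ tendsto_natCast_atTop_atTop
  have e0 := isBigO_normalizedIntegral_zero ha hm huniq hD
  have e1 := isBigO_normalizedIntegral_one ha hm huniq hD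
  have e12 := isBigO_normalizedIntegral_one_sub_two ha hm huniq hD
  have e2 := isBigO_normalizedIntegral_gSq ha hm huniq hD
  have hlim := tendsto_of_expansion hN e0
  have hμ := isBigO_div_of_expansion hN e1 e0
  refine ⟨m, hm, isBigO_of_shift ?_, isBigO_of_shift ?_, isBigO_of_shift ?_⟩
  · -- `log Z_N = N p_* + Λ + log I` with `I` the normalized integral, and `log I = O(1 / N)`
    have hlog : (fun n => Real.log (normalizedIntegral a b m n 0)) =O[atTop]
        fun n : ℕ => 1 / ((n : ℝ) + 2) := by
      have h1 := (Real.hasDerivAt_log one_ne_zero).isBigO_sub.comp_tendsto hlim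
      refine (h1.congr_left fun n => ?_).trans (isBigO_sub_of_expansion hN e0)
      simp
    have h2 := (isBigO_refl (fun n : ℕ => 1 / ((n : ℝ) + 2)) atTop).mul hlog
    refine (h2.congr_left fun n => ?_).congr_right fun n => ?_
    · have hN0 : (0 : ℝ) < (n : ℝ) + 2 := by positivity
      have hZ := partitionFunction_pos a b (n + 1)
      have hs : 0 < √(detD a b m / a) := Real.sqrt_pos.2 (div_pos hD ha)
      rw [normalizedIntegral_zero_eq ha hD, Real.log_mul hs.ne' (by positivity),
        Real.log_mul (Real.exp_pos _).ne' hZ.ne', Real.log_exp, pressureDensity, pStar, Lam]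
      push_cast
      field_simp
      ring
    · push_cast
      field_simp
  · refine (hμ.congr_left fun n => ?_).congr_right fun n => ?_
    · rw [averageMonomerDensity_eq ha hD, Lam']
      push_cast
      ring
    · push_cast
      rfl
  · have hA := isBigO_div_of_expansion hN e2 e0
    have hB := isBigO_div_of_expansion hN e12 e0
    -- the square of the deviation of the mean, up to the order `1 / N ^ 2`
    have hC : (fun n : ℕ => ((n : ℝ) + 2) *
        (normalizedIntegral a b m n 1 / normalizedIntegral a b m n 0 - m) ^ 2
        - coeffK a b m (g a b) ^ 2 / ((n : ℝ) + 2)) =O[atTop]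
        fun n : ℕ => 1 / ((n : ℝ) + 2) ^ 2 := by
      have h1 := isBigO_sub_of_expansion hN hμ
      have h2 : (fun n : ℕ => normalizedIntegral a b m n 1 / normalizedIntegral a b m n 0 - m
          + coeffK a b m (g a b) * (1 / ((n : ℝ) + 2))) =O[atTop]
          fun n : ℕ => 1 / ((n : ℝ) + 2) :=
        h1.add ((isBigO_refl _ _).const_mul_left _)
      have h3 := (isBigO_refl (fun n : ℕ => (n : ℝ) + 2) atTop).mul (hμ.mul h2)
      refine (h3.congr_left fun n => ?_).congr_right fun n => ?_
      · have hN0 : (0 : ℝ) < (n : ℝ) + 2 := by positivity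
        field_simp
        ring
      · have hN0 : (0 : ℝ) < (n : ℝ) + 2 := by positivity
        field_simp
    refine (((hA.sub hC).add hB).congr_left fun n => ?_).congr_right fun n => ?_
    · rw [susceptibility_eq ha hD, chiStar, Lam'']
      push_cast
      ring
    · push_cast
      rfl
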